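/- Setting. A quantum Markov chain (QMC) with system space $\mathcal H=\mathbb C^d$ and output unit space $\mathcal K=\mathbb C^\kappa$ is given by an isometry $V:\mathcal H\to\mathcal H\otimes\mathcal K$, $V\psi=\sum_{i} K_i\psi\otimes|i\rangle$. Its channel is $\mathcal T_*(\rho)=\sum_i K_i\rho K_i^*$, and the QMC is irreducible if $\mathcal T_*$ has a unique faithful invariant state $\rho^{\rm ss}_V$. Put $V(n)\psi=\sum_{i_1,\dots,i_n}K_{i_n}\cdots K_{i_1}\psi\otimes|i_1\rangle\otimes\dots\otimes|i_n\rangle$. The output state of $n$ units for the initial state $\rho$ is $\rho^{\rm out}_V(n,\rho)=\mathrm{Tr}_{\mathcal H}(V(n)\rho V(n)^*)$; the stationary output is $\rho^{\rm out}_V(n)=\rho^{\rm out}_V(n,\rho^{\rm ss}_V)$. A local observable is a selfadjoint operator $Q$ on $\mathcal K^{\otimes k}$ for some $k\ge1$. For $n\ge k$ and $1\le l\le n-k+1$ let $Q^{(l)}$ be the operator on $\mathcal K^{\otimes n}$ acting as $Q$ on the units $l,\dots,l+k-1$ and as the identity on the others. Put $$m_V(Q)=\mathrm{Tr}\big(\rho_V^{\rm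 out}(k)\,Q\big),\qquad c_{a,V}(Q)=\mathrm{Tr}\big[\rho_V^{\rm out}(a+k)\,(Q^{(1)}-m_V(Q)\mathbf 1)\circ(Q^{(1+a)}-m_V(Q)\mathbf 1)\big]\quad(a\ge0),$$ where $A\circ B=(AB+BA)/2$, and $$\overline Q_n=\frac1{n-k+1}\sum_{l=1}^{n-k+1}Q^{(l)},\qquad F_n(Q)=\sqrt{n-k+1}\,\big(\overline Q_n-m_V(Q)\mathbf 1\big).$$ The asymptotic variance is $$\sigma_V^2(Q)=c_{0,V}(Q)+2\sum_{l=1}^{\infty}c_{l,V}(Q),$$ where the series is summed in the sense of Cesàro: with $S_j=c_{0,V}(Q)+2\sum_{l=1}^{j}c_{l,V}(Q)$, $\sigma_V^2(Q)=\lim_{N\to\infty}\frac1N\sum_{j=0}^{N-1}S_j$. For a selfadjoint $A$ and a state $\rho$ let $\mathbb P(A,\rho)$ be the probability distribution of $A$ in the state $\rho$ (the value $x$ has probability $\mathrm{Tr}(\rho\,1_{\{x\}}(A))$). Proposition. (a) Let $V$ be the isometry of an irreducible QMC and $Q$ a local observable. The Cesàro limit defining $\sigma^2_V(Q)$ exists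 and is $\ge 0$; if the partial sums $S_j$ converge, their limit is $\sigma^2_V(Q)$; and if the chain is primitive (that is, $\mathcal T_*^n(\rho)\to\rho_V^{\rm ss}$ for every state $\rho$), the series $\sum_l c_{l,V}(Q)$ converges absolutely. For every initial state $\rho$, in the sense of convergence in distribution as $n\to\infty$, $$\mathbb P\big(\overline Q_n,\rho_V^{\rm out}(n,\rho)\big)\to\delta_{m_V(Q)},\qquad \mathbb P\big(F_n(Q),\rho_V^{\rm out}(n,\rho)\big)\to\mathcal N(0,\sigma_V^2(Q)),$$ where $\mathcal N(0,0)=\delta_0$. (b) Let $V_1:\mathcal H_1\to\mathcal H_1\otimes\mathcal K$ and $V_2:\mathcal H_2\to\mathcal H_2\otimes\mathcal K$ be isometries of irreducible QMCs with the same output space and possibly different system spaces. The following are equivalent: (i) (stationary output equivalence) $\rho_{V_1}^{\rm out}(n)=\rho_{V_2}^{\rm out}(n)$ for all $n$; (ii) (weak output equivalence) there are states $\rho_1$ on $\mathcal H_1$ and $\rho_2$ on $\mathcal H_2$ with $\rho_{V_1}^{\rm out}(n,\rho_1)=\rho_{V_2}^{\rm out}(n,\rho_2)$ for all $n$; (iii)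 (macroscopic output equivalence) for every local observable $Q$ and every pair of initial states $(\rho_1,\rho_2)$, the distributions of $\overline Q_n$ for the two chains converge to the same limit law, and so do those of $F_n(Q)$ (each centred at the chain's own mean $m_{V_j}(Q)$); (iii') $m_{V_1}(Q)=m_{V_2}(Q)$ and $\sigma^2_{V_1}(Q)=\sigma^2_{V_2}(Q)$ for every local observable $Q$. -/

import Mathlib

open MeasureTheory ProbabilityTheory Filter Topology
open scoped Matrix ComplexOrder

/-- A state on the Hilbert space `ℂ^ι`: a positive semidefinite matrix of trace one. -/
@[ext]
structure DensityMatrix (ι : Type) [Fintype ι] where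
  mat : Matrix ι ι ℂ
  posSemidef : mat.PosSemidef
  trace_eq_one : mat.trace = 1

/-- The law `ℙ(A, ρ)` of the observable `A` in the state `ρ`: if `A = U diag(λ) U*` is the spectral
decomposition, the eigenvalue `λ_i` gets the mass `⟨u_i, ρ u_i⟩ = (U* ρ U)_{ii}`, where `u_i` is
the `i`-th column of `U` (so a value `x` gets the mass `Tr (ρ 1_{x}(A))`). -/
noncomputable def spectralMeasure {ι : Type} [Fintype ι] [DecidableEq ι] (ρ : DensityMatrix ι)
    (A : Matrix ι ι ℂ) (hA : A.IsHermitian) : Measure ℝ :=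
  ∑ i, ENNReal.ofReal ((star (hA.eigenvectorUnitary : Matrix ι ι ℂ) * ρ.mat *
    (hA.eigenvectorUnitary : Matrix ι ι ℂ)) i i).re • Measure.dirac (hA.eigenvalues i)

theorem isProbabilityMeasure_spectralMeasure {ι : Type} [Fintype ι] [DecidableEq ι]
    (ρ : DensityMatrix ι) (A : Matrix ι ι ℂ) (hA : A.IsHermitian) :
    IsProbabilityMeasure (spectralMeasure ρ A hA) := by
  constructor
  set U : Matrix ι ι ℂ := (hA.eigenvectorUnitary : Matrix ι ι ℂ) with hU
  have hpos : (star U * ρ.mat * U).PosSemidef :=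
    ρ.posSemidef.conjTranspose_mul_mul_same U
  have hUU : U * star U = 1 := Unitary.mul_star_self_of_mem hA.eigenvectorUnitary.2
  have htr : (star U * ρ.mat * U).trace = 1 := by
    rw [Matrix.trace_mul_comm, ← mul_assoc, hUU, one_mul, ρ.trace_eq_one]
  have hnn : ∀ i ∈ (Finset.univ : Finset ι), 0 ≤ ((star U * ρ.mat * U) i i).re := fun i _ =>
    (Complex.le_def.1 (hpos.diag_nonneg (i := i))).1
  have hsum : ∑ i, ((star U * ρ.mat * U) i i).re = 1 := by
    have := congrArg Complex.re htr
    simpa [Matrix.trace] using this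
  simp only [spectralMeasure, Measure.coe_finsetSum, Finset.sum_apply, Measure.smul_apply,
    measure_univ, smul_eq_mul, mul_one]
  rw [← ENNReal.ofReal_sum_of_nonneg hnn, hsum, ENNReal.ofReal_one]

/-- The law of `A` in the state `ρ`, as a probability measure on `ℝ` (the topology of
`ProbabilityMeasure ℝ` is that of convergence in distribution). -/
noncomputable def observableLaw {ι : Type} [Fintype ι] [DecidableEq ι] (ρ : DensityMatrix ι)
    (A : Matrix ι ι ℂ) (hA : A.IsHermitian) : ProbabilityMeasure ℝ :=
  ⟨spectralMeasure ρ A hA, isProbabilityMeasure_spectralMeasure ρ A hA⟩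

/-- A quantum Markov chain with system space `ℂ^d` and output unit space `ℂ^κ`, given by an
isometry `V : ℂ^d → ℂ^d ⊗ ℂ^κ`. -/
structure QMC (d κ : ℕ) where
  V : Matrix (Fin d × Fin κ) (Fin d) ℂ
  isometry : Vᴴ * V = 1

namespace QMC

variable {d κ : ℕ}

/-- The Kraus operators: `V ψ = ∑ i, K_i ψ ⊗ e_i`. -/
def kraus (M : QMC d κ) (i : Fin κ) : Matrix (Fin d) (Fin d) ℂ :=
  Matrix.of fun a b => M.V (a, i) b

/-- The transition operator in the Schrödinger picture, `ρ ↦ ∑ i, K_i ρ K_i*`. -/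
noncomputable def channel (M : QMC d κ) (ρ : Matrix (Fin d) (Fin d) ℂ) :
    Matrix (Fin d) (Fin d) ℂ :=
  ∑ i, M.kraus i * ρ * (M.kraus i)ᴴ

/-- The channel has a unique faithful invariant state. -/
def IsIrreducible (M : QMC d κ) : Prop :=
  ∃! ρ : DensityMatrix (Fin d), ρ.mat.PosDef ∧ M.channel ρ.mat = ρ.mat

/-- `K_{i_n} ⋯ K_{i_1}` for the word `(i_1, …, i_n)`. -/
def krausWord (M : QMC d κ) : (n : ℕ) → (Fin n → Fin κ) → Matrix (Fin d) (Fin d) ℂ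
  | 0, _ => 1
  | n + 1, i => M.kraus (i (Fin.last n)) * M.krausWord n (Fin.init i)

/-- The iterated isometry `V(n) : ℂ^d → ℂ^d ⊗ (ℂ^κ)^{⊗ n}`,
`V(n) ψ = ∑ K_{i_n} ⋯ K_{i_1} ψ ⊗ e_{i_1} ⊗ ⋯ ⊗ e_{i_n}`. -/
def iterV (M : QMC d κ) (n : ℕ) : Matrix (Fin d × (Fin n → Fin κ)) (Fin d) ℂ :=
  Matrix.of fun x b => M.krausWord n x.2 x.1 b

/-- The output state `Tr_H (V(n) ρ V(n)*)` of the first `n` output units, as a matrix. -/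
noncomputable def outputMat (M : QMC d κ) (n : ℕ) (ρ : Matrix (Fin d) (Fin d) ℂ) :
    Matrix (Fin n → Fin κ) (Fin n → Fin κ) ℂ :=
  Matrix.of fun i j => ∑ a, (M.iterV n * ρ * (M.iterV n)ᴴ) (a, i) (a, j)

theorem sum_kraus (M : QMC d κ) : ∑ i, (M.kraus i)ᴴ * M.kraus i = 1 := by
  rw [← M.isometry]
  ext a b
  simp only [Matrix.sum_apply, Matrix.mul_apply, Matrix.conjTranspose_apply, kraus,
    Matrix.of_apply, Fintype.sum_prod_type]
  exact Finset.sum_comm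

theorem sum_krausWord (M : QMC d κ) (n : ℕ) :
    ∑ i, (M.krausWord n i)ᴴ * M.krausWord n i = 1 := by
  induction n with
  | zero => simp [krausWord]
  | succ n ih =>
    rw [← (Fin.snocEquiv (fun _ : Fin (n + 1) => Fin κ)).sum_comp, Fintype.sum_prod_type,
      Finset.sum_comm]
    have h : ∀ (w : Fin n → Fin κ), ∑ x : Fin κ,
        (M.krausWord (n + 1) (Fin.snocEquiv (fun _ : Fin (n + 1) => Fin κ) (x, w)))ᴴ *
          M.krausWord (n + 1) (Fin.snocEquiv (fun _ : Fin (n + 1) => Fin κ) (x, w)) =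
        (M.krausWord n w)ᴴ * M.krausWord n w := by
      intro w
      have h2 : ∀ x : Fin κ,
          (M.krausWord (n + 1) (Fin.snocEquiv (fun _ : Fin (n + 1) => Fin κ) (x, w)))ᴴ *
          M.krausWord (n + 1) (Fin.snocEquiv (fun _ : Fin (n + 1) => Fin κ) (x, w)) =
          (M.krausWord n w)ᴴ * ((M.kraus x)ᴴ * M.kraus x) * M.krausWord n w := by
        intro x
        simp [krausWord, Fin.snocEquiv, Matrix.conjTranspose_mul, mul_assoc]
      simp only [h2]
      rw [← Finset.sum_mul, ← Finset.mul_sum, M.sum_kraus, mul_one]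
    exact (Finset.sum_congr rfl fun w _ => h w).trans ih

theorem iterV_isometry (M : QMC d κ) (n : ℕ) : (M.iterV n)ᴴ * M.iterV n = 1 := by
  rw [← M.sum_krausWord n]
  ext a b
  simp only [Matrix.sum_apply, Matrix.mul_apply, Matrix.conjTranspose_apply, iterV,
    Matrix.of_apply, Fintype.sum_prod_type]
  exact Finset.sum_comm

/-- The output state of the first `n` output units for the initial system state `ρ`. -/
noncomputable def output (M : QMC d κ) (n : ℕ) (ρ : DensityMatrix (Fin d)) :
    DensityMatrix (Fin n → Fin κ) where
  mat := M.outputMat n ρ.mat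
  posSemidef := by
    have h := ρ.posSemidef.mul_mul_conjTranspose_same (M.iterV n)
    have h2 : M.outputMat n ρ.mat = ∑ a, (M.iterV n * ρ.mat * (M.iterV n)ᴴ).submatrix
        (fun i => (a, i)) (fun i => (a, i)) := by
      ext i j
      simp [outputMat, Matrix.sum_apply]
    rw [h2]
    exact Matrix.posSemidef_sum _ fun a _ => h.submatrix _
  trace_eq_one := by
    have h : (M.outputMat n ρ.mat).trace = (M.iterV n * ρ.mat * (M.iterV n)ᴴ).trace := by
      simp only [Matrix.trace, Matrix.diag_apply, outputMat, Matrix.of_apply,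
        Fintype.sum_prod_type]
      exact Finset.sum_comm
    rw [h, Matrix.trace_mul_comm, ← Matrix.mul_assoc, M.iterV_isometry, Matrix.one_mul, ρ.trace_eq_one]

end QMC

/-- For an operator `Q` on `k` output units, the operator on `n` output units that acts as `Q` on
the units `l + 1, …, l + k` and as the identity on the others. -/
def shiftObs {κ k : ℕ} (n l : ℕ) (hl : l + k ≤ n)
    (Q : Matrix (Fin k → Fin κ) (Fin k → Fin κ) ℂ) :
    Matrix (Fin n → Fin κ) (Fin n → Fin κ) ℂ :=
  Matrix.of fun x y =>
    if ∀ j : Fin n, (j : ℕ) < l ∨ l + k ≤ (j : ℕ) → x j = y j then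
      Q (fun j => x ⟨l + j, by omega⟩) (fun j => y ⟨l + j, by omega⟩)
    else 0

/-- The symmetric product `A ∘ B = (A B + B A) / 2`. -/
noncomputable def symProd {ι : Type} [Fintype ι] (A B : Matrix ι ι ℂ) : Matrix ι ι ℂ :=
  (1 / 2 : ℂ) • (A * B + B * A)

/-- The time average `(n - k + 1)⁻¹ ∑_{l = 1}^{n - k + 1} Q^{(l)}`, for `n ≥ k`
(and `0` for `n < k`). -/
noncomputable def timeAverage {κ k : ℕ} (n : ℕ)
    (Q : Matrix (Fin k → Fin κ) (Fin k → Fin κ) ℂ) :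
    Matrix (Fin n → Fin κ) (Fin n → Fin κ) ℂ :=
  (((n + 1 - k : ℕ) : ℝ)⁻¹) • ∑ l : Fin (n + 1 - k), shiftObs n l (by omega) Q

/-- `√(n - k + 1) (Q̄_n - m 1)`, the time average centred at `m` and rescaled. -/
noncomputable def centredAverage {κ k : ℕ} (n : ℕ)
    (Q : Matrix (Fin k → Fin κ) (Fin k → Fin κ) ℂ) (m : ℝ) :
    Matrix (Fin n → Fin κ) (Fin n → Fin κ) ℂ :=
  (√((n + 1 - k : ℕ) : ℝ)) • (timeAverage n Q - m • (1 : Matrix (Fin n → Fin κ) (Fin n → Fin κ) ℂ))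

theorem shiftObs_isHermitian {κ k : ℕ} (n l : ℕ) (hl : l + k ≤ n)
    {Q : Matrix (Fin k → Fin κ) (Fin k → Fin κ) ℂ} (hQ : Q.IsHermitian) :
    (shiftObs n l hl Q).IsHermitian := by
  ext x y
  simp only [Matrix.conjTranspose_apply, shiftObs, Matrix.of_apply]
  have h : (∀ j : Fin n, (j : ℕ) < l ∨ l + k ≤ (j : ℕ) → y j = x j) ↔
      (∀ j : Fin n, (j : ℕ) < l ∨ l + k ≤ (j : ℕ) → x j = y j) :=
    forall_congr' fun j => imp_congr_right fun _ => eq_comm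
  simp only [h]
  split_ifs
  · exact hQ.apply _ _
  · simp

theorem timeAverage_isHermitian {κ k : ℕ} (n : ℕ)
    {Q : Matrix (Fin k → Fin κ) (Fin k → Fin κ) ℂ} (hQ : Q.IsHermitian) :
    (timeAverage n Q).IsHermitian :=
  IsSelfAdjoint.smul (IsSelfAdjoint.all _)
    (isSelfAdjoint_sum _ fun l _ => shiftObs_isHermitian n l _ hQ)

theorem centredAverage_isHermitian {κ k : ℕ} (n : ℕ)
    {Q : Matrix (Fin k → Fin κ) (Fin k → Fin κ) ℂ} (hQ : Q.IsHermitian) (m : ℝ) :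
    (centredAverage n Q m).IsHermitian :=
  IsSelfAdjoint.smul (IsSelfAdjoint.all _)
    (IsSelfAdjoint.sub (timeAverage_isHermitian n hQ)
      (IsSelfAdjoint.smul (IsSelfAdjoint.all _) (IsSelfAdjoint.one _)))

/-- An irreducible quantum Markov chain. -/
structure IrreducibleQMC (d κ : ℕ) extends QMC d κ where
  irreducible : toQMC.IsIrreducible

namespace IrreducibleQMC

variable {d κ k : ℕ}

/-- The unique faithful invariant state. -/
noncomputable def stationaryState (M : IrreducibleQMC d κ) : DensityMatrix (Fin d) :=
  M.irreducible.choose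

/-- The stationary output state of `n` output units. -/
noncomputable def stationaryOutput (M : IrreducibleQMC d κ) (n : ℕ) :
    DensityMatrix (Fin n → Fin κ) :=
  M.output n M.stationaryState

/-- `Tⁿ(ρ)` tends to the stationary state for every initial state (period one). -/
def IsPrimitive (M : IrreducibleQMC d κ) : Prop :=
  ∀ ρ : DensityMatrix (Fin d),
    Tendsto (fun n : ℕ => M.channel^[n] ρ.mat) atTop (𝓝 M.stationaryState.mat)

/-- The stationary mean `m_V(Q)` of a local observable `Q` on `k` output units. -/
noncomputable def mean (M : IrreducibleQMC d κ)
    (Q : Matrix (Fin k → Fin κ) (Fin k → Fin κ) ℂ) : ℝ :=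
  ((M.stationaryOutput k).mat * Q).trace.re

/-- The stationary time correlation `c_{a,V}(Q)`, the expectation of the symmetric product of
`Q^{(1)} - m_V(Q) 1` and `Q^{(1 + a)} - m_V(Q) 1`. -/
noncomputable def correlation (M : IrreducibleQMC d κ)
    (Q : Matrix (Fin k → Fin κ) (Fin k → Fin κ) ℂ) (a : ℕ) : ℝ :=
  ((M.stationaryOutput (a + k)).mat *
    symProd (shiftObs (a + k) 0 (by omega) Q - M.mean Q • (1 : Matrix _ _ ℂ))
      (shiftObs (a + k) a le_rfl Q - M.mean Q • (1 : Matrix _ _ ℂ))).trace.re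

/-- The partial sums `c_0 + 2 ∑_{l=1}^{N} c_l`. -/
noncomputable def variancePartialSum (M : IrreducibleQMC d κ)
    (Q : Matrix (Fin k → Fin κ) (Fin k → Fin κ) ℂ) (N : ℕ) : ℝ :=
  M.correlation Q 0 + 2 * ∑ l ∈ Finset.range N, M.correlation Q (l + 1)

/-- The Cesàro means `N⁻¹ ∑_{j=0}^{N-1} (c_0 + 2 ∑_{l=1}^{j} c_l)` of these partial sums. -/
noncomputable def varianceCesaroMean (M : IrreducibleQMC d κ)
    (Q : Matrix (Fin k → Fin κ) (Fin k → Fin κ) ℂ) (N : ℕ) : ℝ :=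
  (N : ℝ)⁻¹ * ∑ j ∈ Finset.range N, M.variancePartialSum Q j

/-- The asymptotic variance `σ²_V(Q) = c_0 + 2 ∑_{l ≥ 1} c_l`. The series is summed in the sense of
Cesàro: for a periodic chain `c_l` need not tend to zero. -/
noncomputable def asymptoticVariance (M : IrreducibleQMC d κ)
    (Q : Matrix (Fin k → Fin κ) (Fin k → Fin κ) ℂ) : ℝ :=
  limUnder atTop (M.varianceCesaroMean Q)

/-- The law of the time average `Q̄_n` in the output state for the initial state `ρ`. -/
noncomputable def averageLaw (M : IrreducibleQMC d κ) (ρ : DensityMatrix (Fin d))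
    (Q : Matrix (Fin k → Fin κ) (Fin k → Fin κ) ℂ) (hQ : Q.IsHermitian) (n : ℕ) :
    ProbabilityMeasure ℝ :=
  observableLaw (M.output n ρ) (timeAverage n Q) (timeAverage_isHermitian n hQ)

/-- The law of the fluctuation operator `F_n(Q) = √(n - k + 1) (Q̄_n - m_V(Q))` in the output state
for the initial state `ρ`. -/
noncomputable def fluctuationLaw (M : IrreducibleQMC d κ) (ρ : DensityMatrix (Fin d))
    (Q : Matrix (Fin k → Fin κ) (Fin k → Fin κ) ℂ) (hQ : Q.IsHermitian) (n : ℕ) :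
    ProbabilityMeasure ℝ :=
  observableLaw (M.output n ρ) (centredAverage n Q (M.mean Q))
    (centredAverage_isHermitian n hQ (M.mean Q))

variable {d₁ d₂ : ℕ}

/-- The stationary output states are identical. -/
def StationaryOutputEquiv (M₁ : IrreducibleQMC d₁ κ) (M₂ : IrreducibleQMC d₂ κ) : Prop :=
  ∀ n : ℕ, M₁.stationaryOutput n = M₂.stationaryOutput n

/-- The output states are identical for some pair of initial states. -/
def WeakOutputEquiv (M₁ : IrreducibleQMC d₁ κ) (M₂ : IrreducibleQMC d₂ κ) : Prop :=
  ∃ (ρ₁ : DensityMatrix (Fin d₁)) (ρ₂ : DensityMatrix (Fin d₂)),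
    ∀ n : ℕ, M₁.output n ρ₁ = M₂.output n ρ₂

/-- For every local observable and every pair of initial states, the time averages have the same
limit law, and so do the fluctuation operators. -/
def MacroscopicOutputEquiv (M₁ : IrreducibleQMC d₁ κ) (M₂ : IrreducibleQMC d₂ κ) : Prop :=
  ∀ (k : ℕ), 0 < k → ∀ (Q : Matrix (Fin k → Fin κ) (Fin k → Fin κ) ℂ) (hQ : Q.IsHermitian)
    (ρ₁ : DensityMatrix (Fin d₁)) (ρ₂ : DensityMatrix (Fin d₂)),
    (∃ μ : ProbabilityMeasure ℝ, Tendsto (M₁.averageLaw ρ₁ Q hQ) atTop (𝓝 μ) ∧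
      Tendsto (M₂.averageLaw ρ₂ Q hQ) atTop (𝓝 μ)) ∧
    (∃ μ : ProbabilityMeasure ℝ, Tendsto (M₁.fluctuationLaw ρ₁ Q hQ) atTop (𝓝 μ) ∧
      Tendsto (M₂.fluctuationLaw ρ₂ Q hQ) atTop (𝓝 μ))

/-- Every local observable has the same stationary mean and the same asymptotic variance. -/
def SameMeanAndVariance (M₁ : IrreducibleQMC d₁ κ) (M₂ : IrreducibleQMC d₂ κ) : Prop :=
  ∀ (k : ℕ), 0 < k → ∀ (Q : Matrix (Fin k → Fin κ) (Fin k → Fin κ) ℂ), Q.IsHermitian →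
    M₁.mean Q = M₂.mean Q ∧ M₁.asymptoticVariance Q = M₂.asymptoticVariance Q

end IrreducibleQMC

/-! All output expectations are computed on the fixed finite-dimensional system algebra through
`QMC.transfer`, and observables on consecutive units give products of transfer operators
(`QMC.transfer_tens`). The observable 1 gives powers of the Heisenberg transition operator T, a
contraction fixing 1. Irreducibility makes the stationary expectation φ its only invariant
functional up to scalars (`isErgodic_heis`), so y - T y = x is solvable on ker φ and the sums of T^i
x stay bounded there, even when a periodic chain keeps T^i x from converging.

The Cesàro mean of the S_j over j < N is 1/N times the stationary variance of the sum of N centred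
translates (`norm_sq_sum_localObs`), hence nonnegative. It converges because correlations at lags at
least k are matrix coefficients of powers of T. The same bounded sums give mean-square estimates of
order N for every initial state, and from them the law of large numbers.

For the central limit theorem, overlapping translates do not commute, so the units are cut into
blocks of length p and the translates straddling a boundary are dropped. A Duhamel estimate bounds
the effect on the characteristic function by a commutator norm plus a mean-square norm; both are
O(p^(-1/2)) (`norm_expect_exp_sub_blockSum_le`). Blocks act on disjoint units, so the remaining
characteristic function is a power of one perturbed transfer operator, handled by second order
perturbation of the eigenvalue 1 (`tendsto_pow_apply_of_perturbation`). The second order coefficient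
is -1/2 times the block variance up to a bounded error (`exists_block_eigenvalue`), so division by p
gives -σ²/2 in the limit.

These estimates need 1 - T^p to be invertible on ker φ uniformly in p, which fails when p is a
multiple of the period. `IsErgodic.exists_resolvent_bound` finds good p: if P is an idempotent limit
point of the powers and T^n is close to P, then p = n + 1 works, since TP has no more invariant
functionals than T.

For the equivalences, bounded sums make shifted outputs forget the initial state in Cesàro mean, so
weak equivalence gives equality of stationary outputs. Means of all local observables already
determine the output states, which in turn determine correlations and variances. The macroscopic
version follows from the limit theorems and uniqueness of limits. -/

/-! ### Ergodic contractions: Poisson equation and eigenvalue perturbation -/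

section PowerBounded

variable {E : Type*} [NormedAddCommGroup E] [NormedSpace ℂ E]

/-- A contraction with an invariant vector `u` and, up to scalars, a unique invariant
functional `φ`, normalised by `φ u = 1`. -/
structure IsErgodic (T : E →L[ℂ] E) (u : E) (φ : E →L[ℂ] ℂ) : Prop where
  norm_pow_le (n : ℕ) : ‖T ^ n‖ ≤ 1
  map_unit : T u = u
  map_state (x : E) : φ (T x) = φ x
  state_unit : φ u = 1
  unique (f : E →L[ℂ] ℂ) : (∀ x, f (T x) = f x) → ∀ x, f x = f u * φ x

/-- A power-bounded operator on a finite-dimensional space has an idempotent among the limit points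
of its powers. -/
theorem exists_idempotent_mapClusterPt [FiniteDimensional ℂ E] (T : E →L[ℂ] E)
    (hT : ∀ n : ℕ, ‖T ^ n‖ ≤ 1) :
    ∃ P : E →L[ℂ] E, P * P = P ∧ MapClusterPt P atTop (fun n : ℕ => T ^ n) := by
  have : ProperSpace (E →L[ℂ] E) := FiniteDimensional.proper ℂ _
  set S : Set (E →L[ℂ] E) := {A | MapClusterPt A atTop (fun n : ℕ => T ^ n)} with hS
  have hball : ∀ n : ℕ, T ^ n ∈ Metric.closedBall (0 : E →L[ℂ] E) 1 := fun n => by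
    simpa using hT n
  have hcpt : IsCompact (Metric.closedBall (0 : E →L[ℂ] E) 1) := isCompact_closedBall _ _
  have hSsub : S ⊆ Metric.closedBall (0 : E →L[ℂ] E) 1 := fun A hA => by
    have h : A ∈ closure (Metric.closedBall (0 : E →L[ℂ] E) 1) := by
      exact ClusterPt.mem_closure_of_mem hA _ (mem_map.2 (Eventually.of_forall hball))
    rwa [Metric.isClosed_closedBall.closure_eq] at h
  have hSc : IsClosed S := isClosed_setOfPred_clusterPt
  have hne : S.Nonempty := by
    obtain ⟨A, -, hA⟩ := hcpt.exists_mapClusterPt (f := atTop) (u := fun n : ℕ => T ^ n)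
      (tendsto_principal.2 (Eventually.of_forall hball))
    exact ⟨A, hA⟩
  -- The limit points form a nonempty compact semigroup under multiplication, so the Ellis–Numakura
  -- lemma applies. Closure under products holds because T^n T^m = T^(n+m), with n taken arbitrarily
  -- large.
  obtain ⟨P, hP, hPP⟩ := exists_idempotent_in_compact_subsemigroup (M := E →L[ℂ] E)
    (fun r => by fun_prop) S hne (hcpt.of_isClosed_subset hSc hSsub) (by
      intro A hA B hB
      rw [hS, Set.mem_ofPred_eq, mapClusterPt_iff_frequently] at *
      intro U hU
      have hc : Tendsto (fun p : (E →L[ℂ] E) × (E →L[ℂ] E) => p.1 * p.2) (𝓝 (A, B)) (𝓝 (A * B)) :=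
        continuous_mul.continuousAt
      obtain ⟨V, hV, W, hW, hVW⟩ := mem_nhds_prod_iff.1 (hc hU)
      rw [frequently_atTop]
      intro N
      obtain ⟨n, hn, hnV⟩ := frequently_atTop.1 (hA V hV) N
      obtain ⟨m, -, hmW⟩ := frequently_atTop.1 (hB W hW) 0
      refine ⟨n + m, by omega, ?_⟩
      rw [pow_add]
      exact hVW (Set.mk_mem_prod hnV hmW))
  exact ⟨P, hPP, hP⟩

namespace IsErgodic

variable {T : E →L[ℂ] E} {u : E} {φ : E →L[ℂ] ℂ}

theorem pow_unit (h : IsErgodic T u φ) (n : ℕ) : (T ^ n) u = u := by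
  induction n with
  | zero => simp
  | succ n ih => rw [pow_succ, mul_apply_eq_comp, h.map_unit, ih]

theorem state_pow (h : IsErgodic T u φ) (n : ℕ) (x : E) : φ ((T ^ n) x) = φ x := by
  induction n with
  | zero => simp
  | succ n ih => rw [pow_succ', mul_apply_eq_comp, h.map_state, ih]

theorem norm_pow_apply_le (h : IsErgodic T u φ) (n : ℕ) (x : E) : ‖(T ^ n) x‖ ≤ ‖x‖ := by
  simpa using (T ^ n).le_of_opNorm_le (h.norm_pow_le n) x

/-- If every functional invariant under `S` is a multiple of `φ`, then `1 - S + φ(·) u` is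
invertible. -/
theorem isUnit_one_sub_add [FiniteDimensional ℂ E] {S : E →L[ℂ] E} (hu : S u = u)
    (h1 : φ u = 1) (hS : ∀ f : E →L[ℂ] ℂ, (∀ x, f (S x) = f x) → ∀ x, f x = f u * φ x) :
    IsUnit (1 - S + φ.smulRight u) := by
  rw [ContinuousLinearMap.isUnit_iff_bijective]
  set Z : E →L[ℂ] E := 1 - S + φ.smulRight u with hZ
  have hsurj : Function.Surjective (Z : E →ₗ[ℂ] E) := by
    -- Let f annihilate the range. Evaluation at u gives f u = 0, after which f is S-invariant, so f
    -- = f u · φ = 0.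
    rw [← LinearMap.dualMap_injective_iff, injective_iff_map_eq_zero]
    intro f hf
    have hf' : ∀ x, f x - f (S x) + φ x * f u = 0 := fun x => by
      have := LinearMap.congr_fun hf x
      simpa [hZ] using this
    have hfu : f u = 0 := by
      have := hf' u
      rw [hu, h1] at this
      simpa using this
    ext x
    have := hS (LinearMap.toContinuousLinearMap f) (fun x => by
      have := hf' x
      rw [hfu, mul_zero, add_zero, sub_eq_zero] at this
      simpa using this.symm) x
    simpa [hfu] using this
  exact ⟨LinearMap.injective_iff_surjective.2 hsurj, hsurj⟩

/-- Applying φ to (1 - S + φ(·) u) y = x gives φ y = φ x = 0, so the rank-one correction disappears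
from the equation. -/
theorem exists_sub_map_eq_of_isUnit {S : E →L[ℂ] E} (hS : ∀ x, φ (S x) = φ x)
    (h1 : φ u = 1) (hunit : IsUnit (1 - S + φ.smulRight u)) (x : E) (hx : φ x = 0) :
    ∃ y, φ y = 0 ∧ y - S y = x ∧ ‖y‖ ≤ ‖Ring.inverse (1 - S + φ.smulRight u)‖ * ‖x‖ := by
  obtain ⟨y, hy⟩ : ∃ y, y = Ring.inverse (1 - S + φ.smulRight u) x := ⟨_, rfl⟩
  have hWy : (1 - S + φ.smulRight u) y = x := by
    rw [hy, ← mul_apply_eq_comp, Ring.mul_inverse_cancel _ hunit, one_apply_eq_self]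
  have hφ : φ y = 0 := by
    have := congrArg φ hWy
    simpa [hS, h1, hx] using this
  refine ⟨y, hφ, ?_, ?_⟩
  · simpa [hφ] using hWy
  · rw [hy]
    exact ContinuousLinearMap.le_opNorm _ x

/-- For arbitrarily large exponents `p`, the equation `h - T ^ p h = x` can be solved on the kernel
of `φ` with a bound that is uniform in `p`. -/
theorem exists_resolvent_bound [FiniteDimensional ℂ E] (h : IsErgodic T u φ) :
    ∃ C : ℝ, 0 ≤ C ∧ ∀ N : ℕ, ∃ p ≥ N, ∀ x, φ x = 0 →
      ∃ y, φ y = 0 ∧ y - (T ^ p) y = x ∧ ‖y‖ ≤ C * ‖x‖ := by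
  obtain ⟨P, hPP, hP⟩ := exists_idempotent_mapClusterPt T h.norm_pow_le
  have hclosed : ∀ s : Set (E →L[ℂ] E), IsClosed s → (∀ n : ℕ, T ^ n ∈ s) → P ∈ s := by
    intro s hs hn
    have : P ∈ closure s := by
      exact ClusterPt.mem_closure_of_mem hP _ (mem_map.2 (Eventually.of_forall hn))
    rwa [hs.closure_eq] at this
  have hTP : T * P = P * T := hclosed {A | T * A = A * T}
    (isClosed_eq (by fun_prop) (by fun_prop)) fun n => (pow_succ' T n).symm.trans (pow_succ T n)
  have hPu : P u = u := hclosed {A | A u = u} (isClosed_eq (by fun_prop) (by fun_prop)) h.pow_unit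
  -- The factor T is essential: for a periodic chain P alone has further invariant functionals. If f
  -- is TP-invariant, then f ∘ P = f because P is idempotent, and commuting P past T makes f
  -- invariant under T.
  have hunit : IsUnit (1 - T * P + φ.smulRight u) := by
    refine isUnit_one_sub_add (by simp [hPu, h.map_unit]) h.state_unit fun f hf => h.unique f ?_
    have hfP : ∀ x, f (P x) = f x := fun x => by
      rw [← hf (P x), ← hf x]
      simp only [mul_apply_eq_comp]
      rw [← mul_apply_eq_comp P P, hPP]
    intro x
    rw [← hfP (T x), ← mul_apply_eq_comp, ← hTP, hf]
  obtain ⟨Z, hZ⟩ := hunit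
  -- The added 1 makes the bound strict at P, so by continuity of inversion it persists for all
  -- operators near P.
  set C : ℝ := ‖((Z⁻¹ : (E →L[ℂ] E)ˣ) : E →L[ℂ] E)‖ + 1 with hC
  refine ⟨C, by positivity, fun N => ?_⟩
  have hcont : ContinuousAt (fun A : E →L[ℂ] E => Ring.inverse (1 - T * A + φ.smulRight u)) P := by
    have h1 : ContinuousAt Ring.inverse (1 - T * P + φ.smulRight u) := by
      rw [← hZ]; exact NormedRing.inverse_continuousAt Z
    exact ContinuousAt.comp (f := fun A : E →L[ℂ] E => 1 - T * A + φ.smulRight u) h1 (by fun_prop)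
  have hnear : ∀ᶠ A in 𝓝 P, IsUnit (1 - T * A + φ.smulRight u) ∧
      ‖Ring.inverse (1 - T * A + φ.smulRight u)‖ < C := by
    refine Eventually.and ?_ ?_
    · have : ContinuousAt (fun A : E →L[ℂ] E => 1 - T * A + φ.smulRight u) P := by fun_prop
      refine this.eventually (p := IsUnit) ?_
      change ∀ᶠ y in 𝓝 (1 - T * P + φ.smulRight u), IsUnit y
      rw [← hZ]; exact Units.nhds Z
    · refine hcont.norm.eventually_lt_const ?_
      change ‖Ring.inverse (1 - T * P + φ.smulRight u)‖ < C
      rw [← hZ, Ring.inverse_unit, hC]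
      exact lt_add_one _
  obtain ⟨n, hn, hA, hAC⟩ := frequently_atTop.1 (hP.frequently hnear) N
  refine ⟨n + 1, by omega, fun x hx => ?_⟩
  rw [← pow_succ'] at hA hAC
  obtain ⟨y, hy0, hy, hyx⟩ := exists_sub_map_eq_of_isUnit (h.state_pow (n + 1)) h.state_unit hA x hx
  exact ⟨y, hy0, hy, hyx.trans (by gcongr)⟩

theorem exists_sub_map_eq [FiniteDimensional ℂ E] (h : IsErgodic T u φ) :
    ∃ C : ℝ, 0 ≤ C ∧ ∀ x, φ x = 0 → ∃ y, φ y = 0 ∧ y - T y = x ∧ ‖y‖ ≤ C * ‖x‖ := by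
  exact ⟨_, norm_nonneg _, exists_sub_map_eq_of_isUnit h.map_state h.state_unit
    (isUnit_one_sub_add h.map_unit h.state_unit h.unique)⟩

/-- The sum telescopes to y - T^(pn) y. Convergence of the powers is not needed. -/
theorem norm_sum_pow_le (h : IsErgodic T u φ) {p : ℕ} {C : ℝ} {x y : E}
    (hy : y - (T ^ p) y = x) (hC : ‖y‖ ≤ C * ‖x‖) (n : ℕ) :
    ‖∑ i ∈ Finset.range n, (T ^ (p * i)) x‖ ≤ 2 * C * ‖x‖ := by
  have : ∑ i ∈ Finset.range n, (T ^ (p * i)) x = y - (T ^ (p * n)) y := by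
    induction n with
    | zero => simp
    | succ n ih =>
      rw [Finset.sum_range_succ, ih, ← hy, map_sub, ← mul_apply_eq_comp, ← pow_add,
        mul_add_one]
      abel
  rw [this]
  calc _ ≤ ‖y‖ + ‖(T ^ (p * n)) y‖ := norm_sub_le _ _
    _ ≤ ‖y‖ + ‖y‖ := by gcongr; exact h.norm_pow_apply_le _ _
    _ ≤ _ := by linarith

end IsErgodic

/-- An approximate eigenvector stays one under iteration: each application of M adds one defect,
transported by a contraction. The factor K^r allows |z| slightly above 1. -/
theorem norm_pow_apply_sub_smul_le {M : E →L[ℂ] E} (hM : ‖M‖ ≤ 1) {z : ℂ} {K : ℝ} (hK : 1 ≤ K)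
    (hz : ‖z‖ ≤ K) (x : E) (r : ℕ) :
    ‖(M ^ r) x - z ^ r • x‖ ≤ r * K ^ r * ‖M x - z • x‖ := by
  induction r with
  | zero => simp
  | succ r ih =>
    have h : (M ^ (r + 1)) x - z ^ (r + 1) • x =
        M ((M ^ r) x - z ^ r • x) + z ^ r • (M x - z • x) := by
      rw [pow_succ' M, mul_apply_eq_comp, map_sub, map_smul, smul_sub, smul_smul, pow_succ]
      abel
    rw [h]
    calc _ ≤ ‖M ((M ^ r) x - z ^ r • x)‖ + ‖z ^ r • (M x - z • x)‖ := norm_add_le _ _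
      _ ≤ 1 * ‖(M ^ r) x - z ^ r • x‖ + ‖z ^ r‖ * ‖M x - z • x‖ := by
        rw [norm_smul]
        gcongr
        exact M.le_of_opNorm_le hM _
      _ ≤ 1 * (r * K ^ r * ‖M x - z • x‖) + K ^ r * ‖M x - z • x‖ := by
        rw [norm_pow]; gcongr
      _ = (r + 1) * K ^ r * ‖M x - z • x‖ := by ring
      _ ≤ (r + 1) * K ^ (r + 1) * ‖M x - z • x‖ := by
        gcongr ?_ * ?_ * _
        exact pow_le_pow_right₀ hK (Nat.le_succ r)
      _ = _ := by push_cast; ring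

/-- The central limit theorem for products of transfer operators: if `M n = S + ε A + ε² B + o(ε²)`
with `ε = ε n → 0`, then `M n ^ r n` acts on the invariant vector `u` like `exp (r ε² λ)`, where
`λ` is the second order perturbation of the eigenvalue `1`. -/
theorem tendsto_pow_apply_of_perturbation {S A B : E →L[ℂ] E} {M : ℕ → E →L[ℂ] E} {u v w : E}
    {ε : ℕ → ℝ} {r : ℕ → ℕ} {c : ℝ} {l : ℂ} (hS : S u = u) (hM : ∀ n, ‖M n‖ ≤ 1)
    (hε : Tendsto ε atTop (𝓝 0)) (hr : Tendsto (fun n => (r n : ℝ) * ε n ^ 2) atTop (𝓝 c))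
    (hMo : Tendsto (fun n => (r n : ℝ) *
      ‖M n - S - (ε n : ℂ) • A - ((ε n : ℂ) ^ 2) • B‖) atTop (𝓝 0))
    (hv : v - S v = A u) (hw : w - S w = A v + B u - l • u) :
    Tendsto (fun n => (M n ^ r n) u) atTop (𝓝 (Complex.exp (c * l) • u)) := by
  -- Approximate eigenvector and eigenvalue to second order: `hv` cancels the terms of order ε in M
  -- x - z x and `hw` those of order ε².
  set x : ℕ → E := fun n => u + (ε n : ℂ) • v + ((ε n : ℂ) ^ 2) • w with hx
  set z : ℕ → ℂ := fun n => Complex.exp ((ε n : ℂ) ^ 2 * l) with hz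
  have hεC : Tendsto (fun n => (ε n : ℂ)) atTop (𝓝 0) := by
    have h := (Complex.continuous_ofReal.tendsto 0).comp hε
    rwa [Complex.ofReal_zero] at h
  have hxu : Tendsto x atTop (𝓝 u) := by
    have h : Tendsto x atTop (𝓝 (u + (0 : ℂ) • v + ((0 : ℂ) ^ 2) • w)) :=
      (tendsto_const_nhds.add (hεC.smul tendsto_const_nhds)).add
        ((hεC.pow 2).smul tendsto_const_nhds)
    simpa using h
  have hrl : Tendsto (fun n => ((r n : ℂ) * (ε n : ℂ) ^ 2) * l) atTop (𝓝 (c * l)) := by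
    have h := (Complex.continuous_ofReal.tendsto c).comp hr
    refine Tendsto.mul_const l (h.congr fun n => ?_)
    simp
  have hzr : Tendsto (fun n => z n ^ r n) atTop (𝓝 (Complex.exp (c * l))) := by
    refine ((Complex.continuous_exp.tendsto _).comp hrl).congr fun n => ?_
    simp only [hz, Function.comp_apply, ← Complex.exp_nat_mul]
    ring_nf
  set K : ℕ → ℝ := fun n => Real.exp (ε n ^ 2 * ‖l‖) with hK
  have hK1 : ∀ n, 1 ≤ K n := fun n => Real.one_le_exp (by positivity)
  have hzK : ∀ n, ‖z n‖ ≤ K n := fun n => by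
    refine (Complex.norm_exp_le_exp_norm _).trans_eq ?_
    simp [hK]
  have hKr : Tendsto (fun n => K n ^ r n) atTop (𝓝 (Real.exp (c * ‖l‖))) := by
    refine ((Real.continuous_exp.tendsto _).comp (hr.mul_const ‖l‖)).congr fun n => ?_
    simp only [hK, Function.comp_apply, ← Real.exp_nat_mul]
    ring_nf
  have herr : ∀ n, M n (x n) - z n • x n =
      (M n - S - (ε n : ℂ) • A - ((ε n : ℂ) ^ 2) • B) (x n) +
      ((ε n : ℂ) ^ 3 • (A w + B v - l • v) + (ε n : ℂ) ^ 4 • (B w - l • w)) -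
      (z n - 1 - (ε n : ℂ) ^ 2 * l) • x n := by
    intro n
    have hv' : S v = v - A u := by rw [← hv]; abel
    have hw' : S w = w - (A v + B u - l • u) := by rw [← hw]; abel
    simp only [hx, sub_apply, smul_apply, map_add,
      map_smul, hS, hv', hw']
    module
  -- The defect is o(ε²) while r ε² stays bounded, so the r accumulated defects vanish in the limit.
  have hMerr : Tendsto (fun n => (r n : ℝ) * ‖M n (x n) - z n • x n‖) atTop (𝓝 0) := by
    have hbound : ∀ᶠ n in atTop, (r n : ℝ) * ‖M n (x n) - z n • x n‖ ≤
        ((r n : ℝ) * ‖M n - S - (ε n : ℂ) • A - ((ε n : ℂ) ^ 2) • B‖) * ‖x n‖ +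
        ((r n : ℝ) * ε n ^ 2) * (|ε n| * ‖A w + B v - l • v‖ + ε n ^ 2 * ‖B w - l • w‖) +
        ((r n : ℝ) * ε n ^ 2) * (ε n ^ 2 * ‖l‖ ^ 2 * ‖x n‖) := by
      have hsmall : ∀ᶠ n in atTop, ‖(ε n : ℂ) ^ 2 * l‖ ≤ 1 := by
        have h : Tendsto (fun n => ‖(ε n : ℂ) ^ 2 * l‖) atTop (𝓝 0) := by
          simpa using ((hεC.pow 2).mul_const l).norm
        exact (h.eventually_lt_const one_pos).mono fun n hn => hn.le
      filter_upwards [hsmall] with n hn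
      have h1 := Complex.norm_exp_sub_one_sub_id_le hn
      have e3 : ‖(ε n : ℂ) ^ 3‖ = ε n ^ 2 * |ε n| := by
        rw [norm_pow, Complex.norm_real, Real.norm_eq_abs, pow_succ, sq_abs]
      have e4 : ‖(ε n : ℂ) ^ 4‖ = ε n ^ 2 * ε n ^ 2 := by
        rw [norm_pow, Complex.norm_real, Real.norm_eq_abs, ← sq_abs (ε n)]; ring
      have e2 : ‖(ε n : ℂ) ^ 2 * l‖ ^ 2 = ε n ^ 2 * ε n ^ 2 * ‖l‖ ^ 2 := by
        rw [norm_mul, norm_pow, Complex.norm_real, Real.norm_eq_abs, sq_abs]; ring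
      have : ‖M n (x n) - z n • x n‖ ≤
          ‖M n - S - (ε n : ℂ) • A - ((ε n : ℂ) ^ 2) • B‖ * ‖x n‖ +
          (ε n ^ 2 * |ε n| * ‖A w + B v - l • v‖ + ε n ^ 2 * ε n ^ 2 * ‖B w - l • w‖) +
          ε n ^ 2 * ε n ^ 2 * ‖l‖ ^ 2 * ‖x n‖ := by
        rw [herr n]
        refine (norm_sub_le _ _).trans (add_le_add ((norm_add_le _ _).trans (add_le_add
          (ContinuousLinearMap.le_opNorm _ _) ((norm_add_le _ _).trans ?_))) ?_)
        · rw [norm_smul, norm_smul, e3, e4]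
        · rw [norm_smul, ← e2]
          gcongr
      exact (mul_le_mul_of_nonneg_left this (Nat.cast_nonneg (r n))).trans_eq (by ring)
    have hlim : Tendsto (fun n =>
        ((r n : ℝ) * ‖M n - S - (ε n : ℂ) • A - ((ε n : ℂ) ^ 2) • B‖) * ‖x n‖ +
        ((r n : ℝ) * ε n ^ 2) * (|ε n| * ‖A w + B v - l • v‖ + ε n ^ 2 * ‖B w - l • w‖) +
        ((r n : ℝ) * ε n ^ 2) * (ε n ^ 2 * ‖l‖ ^ 2 * ‖x n‖)) atTop
        (𝓝 (0 * ‖u‖ + c * (|0| * ‖A w + B v - l • v‖ + 0 ^ 2 * ‖B w - l • w‖) +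
          c * (0 ^ 2 * ‖l‖ ^ 2 * ‖u‖))) :=
      ((hMo.mul hxu.norm).add (hr.mul ((hε.abs.mul_const _).add ((hε.pow 2).mul_const _)))).add
        (hr.mul (((hε.pow 2).mul_const _).mul hxu.norm))
    refine squeeze_zero' (Eventually.of_forall fun n => by positivity) hbound ?_
    simpa using hlim
  have h1 : Tendsto (fun n => (M n ^ r n) (x n) - z n ^ r n • x n) atTop (𝓝 0) := by
    refine squeeze_zero_norm (fun n => norm_pow_apply_sub_smul_le (hM n) (hK1 n) (hzK n) (x n) (r n)) ?_
    have := hKr.mul hMerr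
    rw [mul_zero] at this
    refine this.congr fun n => by ring
  have h2 : Tendsto (fun n => (M n ^ r n) (u - x n)) atTop (𝓝 0) := by
    have h : Tendsto (fun n => ‖u - x n‖) atTop (𝓝 0) := by
      simpa using (tendsto_const_nhds (x := u)).sub hxu |>.norm
    refine squeeze_zero_norm (fun n => ?_) h
    have : ‖M n ^ r n‖ ≤ 1 := by
      rcases Nat.eq_zero_or_pos (r n) with h0 | h0
      · rw [h0, pow_zero]; exact ContinuousLinearMap.norm_id_le
      · exact (norm_pow_le' _ h0).trans (pow_le_one₀ (norm_nonneg _) (hM n))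
    simpa using (M n ^ r n).le_of_opNorm_le this (u - x n)
  have h3 := (h1.add h2).add (hzr.smul hxu)
  rw [add_zero, zero_add] at h3
  refine h3.congr fun n => ?_
  rw [map_sub]
  abel

end PowerBounded

/-! ### Duhamel estimates for unitary exponentials -/

section SkewAdjoint

variable {A : Type*} [CStarAlgebra A]

theorem exp_smul_mem_unitary {x : A} (hx : x ∈ skewAdjoint A) (s : ℝ) :
    NormedSpace.exp (s • x) ∈ unitary A := by
  let _ : NormedAlgebra ℚ A := .restrictScalars ℚ ℝ A
  have h : star (s • x) = -(s • x) := by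
    rw [star_smul, skewAdjoint.mem_iff.1 hx]; simp
  have h1 : star (NormedSpace.exp (s • x)) = NormedSpace.exp (-(s • x)) := by
    rw [← h, NormedSpace.star_exp]
  rw [Unitary.mem_iff, h1, ← NormedSpace.exp_add_of_commute (Commute.neg_left (Commute.refl _)),
    ← NormedSpace.exp_add_of_commute (Commute.neg_right (Commute.refl _))]
  simp [NormedSpace.exp_zero]

theorem exp_mem_unitary_of_mem_skewAdjoint {x : A} (hx : x ∈ skewAdjoint A) :
    NormedSpace.exp x ∈ unitary A := by
  simpa using exp_smul_mem_unitary hx 1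

theorem exp_neg_mul_exp (x : A) : NormedSpace.exp (-x) * NormedSpace.exp x = 1 := by
  let _ : NormedAlgebra ℚ A := .restrictScalars ℚ ℝ A
  rw [← NormedSpace.exp_add_of_commute (Commute.neg_left (Commute.refl _)), neg_add_cancel,
    NormedSpace.exp_zero]

theorem exp_mul_exp_neg (x : A) : NormedSpace.exp x * NormedSpace.exp (-x) = 1 := by
  simpa using exp_neg_mul_exp (-x)

/-- Duhamel: the derivative of exp(-sx) b exp(sx) is the commutator [b, x] conjugated by unitaries,
so its norm is constant in s. -/
theorem norm_exp_mul_sub_mul_exp_le {x : A} (hx : x ∈ skewAdjoint A) (b : A) :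
    ‖NormedSpace.exp x * b - b * NormedSpace.exp x‖ ≤ ‖x * b - b * x‖ := by
  have hnx : -x ∈ skewAdjoint A := neg_mem hx
  have hd : ∀ s ∈ Set.Icc (0 : ℝ) 1, HasDerivWithinAt
      (fun s : ℝ => NormedSpace.exp (s • (-x)) * b * NormedSpace.exp (s • x))
      (NormedSpace.exp (s • (-x)) * (b * x - x * b) * NormedSpace.exp (s • x))
      (Set.Icc 0 1) s := by
    intro s _
    have h := (((hasDerivAt_exp_smul_const (-x) s).mul_const b).mul
      (hasDerivAt_exp_smul_const' x s)).hasDerivWithinAt (s := Set.Icc 0 1)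
    refine h.congr_deriv ?_
    noncomm_ring
  have h := norm_image_sub_le_of_norm_deriv_le_segment_01' (C := ‖x * b - b * x‖) hd fun s _ => by
    rw [CStarRing.norm_mul_mem_unitary _ (exp_smul_mem_unitary hx s),
      CStarRing.norm_mem_unitary_mul _ (exp_smul_mem_unitary hnx s), norm_sub_rev]
  simp only [one_smul, zero_smul, NormedSpace.exp_zero, one_mul, mul_one] at h
  rw [← CStarRing.norm_mem_unitary_mul _ (exp_mem_unitary_of_mem_skewAdjoint hx), mul_sub,
    mul_assoc, ← mul_assoc, exp_mul_exp_neg, one_mul, norm_sub_rev] at h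
  exact h

/-- A first order Trotter estimate with the commutator as error. -/
theorem norm_exp_add_sub_exp_mul_exp_le {x y : A} (hx : x ∈ skewAdjoint A)
    (hy : y ∈ skewAdjoint A) :
    ‖NormedSpace.exp (x + y) - NormedSpace.exp x * NormedSpace.exp y‖ ≤ ‖x * y - y * x‖ := by
  have hz : x + y ∈ skewAdjoint A := add_mem hx hy
  have hnz : -(x + y) ∈ skewAdjoint A := neg_mem hz
  -- This interpolates from 1 to exp(-(x+y)) exp(x) exp(y). Only [exp(sx), y] survives in the
  -- derivative, and the preceding lemma bounds it by s‖[x, y]‖.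
  have hd : ∀ s ∈ Set.Icc (0 : ℝ) 1, HasDerivWithinAt
      (fun s : ℝ => NormedSpace.exp (s • (-(x + y))) * NormedSpace.exp (s • x) *
        NormedSpace.exp (s • y))
      (NormedSpace.exp (s • (-(x + y))) *
        (NormedSpace.exp (s • x) * y - y * NormedSpace.exp (s • x)) * NormedSpace.exp (s • y))
      (Set.Icc 0 1) s := by
    intro s _
    have h := (((hasDerivAt_exp_smul_const (-(x + y)) s).mul
      (hasDerivAt_exp_smul_const' x s)).mul
      (hasDerivAt_exp_smul_const' y s)).hasDerivWithinAt (s := Set.Icc 0 1)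
    refine h.congr_deriv ?_
    rw [Pi.mul_apply]
    noncomm_ring
  have h := norm_image_sub_le_of_norm_deriv_le_segment_01' (C := ‖x * y - y * x‖) hd fun s hs => by
    rw [CStarRing.norm_mul_mem_unitary _ (exp_smul_mem_unitary hy s),
      CStarRing.norm_mem_unitary_mul _ (exp_smul_mem_unitary hnz s)]
    have hsx : s • x ∈ skewAdjoint A := skewAdjoint.smul_mem s hx
    refine (norm_exp_mul_sub_mul_exp_le hsx y).trans ?_
    rw [smul_mul_assoc, mul_smul_comm, ← smul_sub, norm_smul, Real.norm_eq_abs,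
      abs_of_nonneg hs.1]
    exact mul_le_of_le_one_left (norm_nonneg _) hs.2.le
  simp only [one_smul, zero_smul, NormedSpace.exp_zero, mul_one] at h
  rw [← CStarRing.norm_mem_unitary_mul _ (exp_mem_unitary_of_mem_skewAdjoint hz), mul_sub,
    mul_assoc, ← mul_assoc, exp_mul_exp_neg, one_mul, mul_one, norm_sub_rev] at h
  exact h

/-- For a seminorm `‖L ·‖` that is invariant under left multiplication by unitaries, `exp x - 1` is
bounded by `x`. -/
theorem norm_map_exp_sub_one_le {F : Type*} [NormedAddCommGroup F] [NormedSpace ℝ F]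
    (L : A →L[ℝ] F) (hL : ∀ U ∈ unitary A, ∀ B, ‖L (U * B)‖ = ‖L B‖) {x : A}
    (hx : x ∈ skewAdjoint A) : ‖L (NormedSpace.exp x - 1)‖ ≤ ‖L x‖ := by
  have hd : ∀ s ∈ Set.Icc (0 : ℝ) 1, HasDerivWithinAt (fun s : ℝ => L (NormedSpace.exp (s • x)))
      (L (NormedSpace.exp (s • x) * x)) (Set.Icc 0 1) s := fun s _ =>
    (L.hasFDerivAt.comp_hasDerivAt s (hasDerivAt_exp_smul_const x s)).hasDerivWithinAt
  have h := norm_image_sub_le_of_norm_deriv_le_segment_01' (C := ‖L x‖) hd fun s _ =>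
    (hL _ (exp_smul_mem_unitary hx s) x).le
  simpa using h

/-- The second order Taylor expansion of the exponential. -/
theorem isBigO_exp_sub_taylor :
    (fun x : A => NormedSpace.exp x - 1 - x - (1 / 2 : ℝ) • x ^ 2) =O[𝓝 0] fun x => ‖x‖ ^ 3 := by
  have h := (NormedSpace.exp_hasFPowerSeriesAt_zero (𝕂 := ℝ) (𝔸 := A)).isBigO_sub_partialSum_pow 3
  refine h.congr_left fun x => ?_
  simp [FormalMultilinearSeries.partialSum, Finset.sum_range_succ, NormedSpace.expSeries_apply_eq]
  abel

end SkewAdjoint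

/-! ### States, mean-square norms and characteristic functions -/

open scoped Matrix.Norms.L2Operator MatrixOrder

namespace DensityMatrix

variable {ι : Type} [Fintype ι] [DecidableEq ι]

/-- The expectation of `A` in the state `ρ`. -/
noncomputable def expect (ρ : DensityMatrix ι) : Matrix ι ι ℂ →ₗ[ℂ] ℂ :=
  Matrix.traceLinearMap ι ℂ ℂ ∘ₗ LinearMap.mulLeft ℂ ρ.mat

theorem expect_apply (ρ : DensityMatrix ι) (A : Matrix ι ι ℂ) :
    ρ.expect A = (ρ.mat * A).trace := rfl

@[simp] theorem expect_one (ρ : DensityMatrix ι) : ρ.expect 1 = 1 := by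
  rw [expect_apply, mul_one, ρ.trace_eq_one]

theorem expect_nonneg (ρ : DensityMatrix ι) {A : Matrix ι ι ℂ} (hA : A.PosSemidef) :
    0 ≤ ρ.expect A := by
  obtain ⟨B, hB⟩ := CStarAlgebra.nonneg_iff_eq_star_mul_self.1 (Matrix.nonneg_iff_posSemidef.2 ρ.posSemidef)
  rw [expect_apply, hB, mul_assoc, Matrix.trace_mul_comm]
  exact (hA.mul_mul_conjTranspose_same B).trace_nonneg

theorem expect_conjTranspose (ρ : DensityMatrix ι) (A : Matrix ι ι ℂ) :
    ρ.expect Aᴴ = star (ρ.expect A) := by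
  rw [expect_apply, expect_apply, ← Matrix.trace_conjTranspose, Matrix.conjTranspose_mul,
    ρ.posSemidef.isHermitian.eq, Matrix.trace_mul_comm]

/-- The Gelfand–Naimark–Segal representation of a state. -/
theorem exists_gns (ρ : DensityMatrix ι) :
    ∃ L : Matrix ι ι ℂ →ₗ[ℂ] EuclideanSpace ℂ (ι × ι),
      ∀ A B, inner ℂ (L A) (L B) = ρ.expect (Aᴴ * B) := by
  -- With ρ = C*C the vector of A is A C* with the Hilbert–Schmidt inner product.
  obtain ⟨C, hC⟩ := CStarAlgebra.nonneg_iff_eq_star_mul_self.1 (Matrix.nonneg_iff_posSemidef.2 ρ.posSemidef)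
  refine ⟨{ toFun := fun A => WithLp.toLp 2 fun x => (A * Cᴴ) x.1 x.2
            map_add' := fun A B => by ext x; simp [add_mul]
            map_smul' := fun c A => by ext x; simp }, fun A B => ?_⟩
  have h : ρ.expect (Aᴴ * B) = ((A * Cᴴ)ᴴ * (B * Cᴴ)).trace := by
    rw [expect_apply, hC, Matrix.conjTranspose_mul, Matrix.conjTranspose_conjTranspose,
      Matrix.star_eq_conjTranspose, mul_assoc, Matrix.trace_mul_comm]
    simp only [mul_assoc]
  rw [h]
  simp only [PiLp.inner_apply, LinearMap.coe_mk, AddHom.coe_mk, RCLike.inner_apply,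
    Fintype.sum_prod_type, Matrix.trace, Matrix.diag_apply, Matrix.mul_apply (M := (A * Cᴴ)ᴴ),
    Matrix.conjTranspose_apply]
  rw [Finset.sum_comm]
  refine Finset.sum_congr rfl fun i _ => Finset.sum_congr rfl fun j _ => ?_
  rw [mul_comm]; rfl

theorem norm_sq_gns {ρ : DensityMatrix ι} {L : Matrix ι ι ℂ →ₗ[ℂ] EuclideanSpace ℂ (ι × ι)}
    (hL : ∀ A B, inner ℂ (L A) (L B) = ρ.expect (Aᴴ * B)) (A : Matrix ι ι ℂ) :
    ((‖L A‖ ^ 2 : ℝ) : ℂ) = ρ.expect (Aᴴ * A) := by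
  rw [← hL, inner_self_eq_norm_sq_to_K]
  simp

theorem norm_gns_le {ρ : DensityMatrix ι} {L : Matrix ι ι ℂ →ₗ[ℂ] EuclideanSpace ℂ (ι × ι)}
    (hL : ∀ A B, inner ℂ (L A) (L B) = ρ.expect (Aᴴ * B)) (A : Matrix ι ι ℂ) : ‖L A‖ ≤ ‖A‖ := by
  have h1 : (algebraMap ℝ (Matrix ι ι ℂ) (‖A‖ ^ 2) - star A * A).PosSemidef :=
    Matrix.le_iff.1 CStarAlgebra.star_mul_le_algebraMap_norm_sq
  have h2 := ρ.expect_nonneg h1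
  rw [map_sub, Matrix.star_eq_conjTranspose, ← norm_sq_gns hL, Algebra.algebraMap_eq_smul_one,
    ← Complex.coe_smul, map_smul, expect_one, smul_eq_mul, mul_one, sub_nonneg,
    Complex.real_le_real] at h2
  exact le_of_sq_le_sq h2 (norm_nonneg _)

theorem norm_gns_unitary_mul {ρ : DensityMatrix ι}
    {L : Matrix ι ι ℂ →ₗ[ℂ] EuclideanSpace ℂ (ι × ι)}
    (hL : ∀ A B, inner ℂ (L A) (L B) = ρ.expect (Aᴴ * B)) {U : Matrix ι ι ℂ}
    (hU : U ∈ unitary (Matrix ι ι ℂ)) (A : Matrix ι ι ℂ) : ‖L (U * A)‖ = ‖L A‖ := by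
  have h : ((‖L (U * A)‖ ^ 2 : ℝ) : ℂ) = ((‖L A‖ ^ 2 : ℝ) : ℂ) := by
    rw [norm_sq_gns hL, norm_sq_gns hL, Matrix.conjTranspose_mul, mul_assoc, ← mul_assoc Uᴴ,
      ← Matrix.star_eq_conjTranspose U, Unitary.star_mul_self_of_mem hU, one_mul]
  exact (sq_eq_sq₀ (norm_nonneg _) (norm_nonneg _)).1 (Complex.ofReal_injective h)

/-- Cauchy–Schwarz against `L 1`, a unit vector. -/
theorem norm_expect_le_norm_gns {ρ : DensityMatrix ι}
    {L : Matrix ι ι ℂ →ₗ[ℂ] EuclideanSpace ℂ (ι × ι)}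
    (hL : ∀ A B, inner ℂ (L A) (L B) = ρ.expect (Aᴴ * B)) (A : Matrix ι ι ℂ) :
    ‖ρ.expect A‖ ≤ ‖L A‖ := by
  have h1 : ‖L 1‖ = 1 := by
    have h := norm_sq_gns hL 1
    rw [Matrix.conjTranspose_one, one_mul, expect_one] at h
    exact (sq_eq_sq₀ (norm_nonneg _) zero_le_one).1 (by rw [one_pow]; exact_mod_cast h)
  have h := norm_inner_le_norm (𝕜 := ℂ) (L 1) (L A)
  rwa [hL, Matrix.conjTranspose_one, one_mul, h1, one_mul] at h

theorem norm_expect_le (ρ : DensityMatrix ι) (A : Matrix ι ι ℂ) : ‖ρ.expect A‖ ≤ ‖A‖ := by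
  obtain ⟨L, hL⟩ := ρ.exists_gns
  exact (norm_expect_le_norm_gns hL A).trans (norm_gns_le hL A)

theorem _root_.Matrix.IsHermitian.I_smul_mem_skewAdjoint {A : Matrix ι ι ℂ} (hA : A.IsHermitian) :
    Complex.I • A ∈ skewAdjoint (Matrix ι ι ℂ) := by
  rw [skewAdjoint.mem_iff, star_smul, Matrix.star_eq_conjTranspose, hA.eq]
  simp

/-- If `R` is small in mean square and almost commutes with `B`, then `B + R` and `B` have almost
the same characteristic function. -/
theorem norm_expect_exp_add_sub_le {ρ : DensityMatrix ι}
    {L : Matrix ι ι ℂ →ₗ[ℂ] EuclideanSpace ℂ (ι × ι)}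
    (hL : ∀ A B, inner ℂ (L A) (L B) = ρ.expect (Aᴴ * B)) {B R : Matrix ι ι ℂ}
    (hB : B.IsHermitian) (hR : R.IsHermitian) :
    ‖ρ.expect (NormedSpace.exp (Complex.I • (B + R))) -
      ρ.expect (NormedSpace.exp (Complex.I • B))‖ ≤ ‖B * R - R * B‖ + ‖L R‖ := by
  set x := Complex.I • B with hx
  set y := Complex.I • R with hy
  have hxs := hB.I_smul_mem_skewAdjoint
  have hys := hR.I_smul_mem_skewAdjoint
  have hT := norm_exp_add_sub_exp_mul_exp_le hxs hys
  have hxy : ‖x * y - y * x‖ = ‖B * R - R * B‖ := by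
    rw [hx, hy, smul_mul_smul_comm, smul_mul_smul_comm, ← smul_sub, norm_smul]
    simp
  have hLy : ‖L y‖ = ‖L R‖ := by rw [hy, map_smul, norm_smul]; simp
  have hexp := norm_map_exp_sub_one_le
    ((LinearMap.toContinuousLinearMap L).restrictScalars ℝ)
    (fun U hU A => norm_gns_unitary_mul hL hU A) hys
  rw [smul_add]
  -- The first term is the Trotter error, controlled in operator norm by the commutator. The second
  -- needs only the mean square of R, because exp x is a unitary standing on the left.
  have h1 : ρ.expect (NormedSpace.exp (x + y)) - ρ.expect (NormedSpace.exp x) =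
      ρ.expect (NormedSpace.exp (x + y) - NormedSpace.exp x * NormedSpace.exp y) +
      ρ.expect (NormedSpace.exp x * (NormedSpace.exp y - 1)) := by
    rw [← map_sub, ← map_add]
    congr 1
    noncomm_ring
  rw [h1]
  refine (norm_add_le _ _).trans (add_le_add ?_ ?_)
  · rw [← hxy]
    exact (ρ.norm_expect_le _).trans hT
  · rw [← hLy]
    refine (norm_expect_le_norm_gns hL _).trans ?_
    rw [norm_gns_unitary_mul hL (exp_mem_unitary_of_mem_skewAdjoint hxs)]
    exact hexp

end DensityMatrix

/-- In an eigenbasis of A both sides are Σ (U*ρU)_ii exp(i t λ_i). This turns convergence in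
distribution into convergence of expectations of unitaries. -/
theorem charFun_observableLaw {ι : Type} [Fintype ι] [DecidableEq ι] (ρ : DensityMatrix ι)
    (A : Matrix ι ι ℂ) (hA : A.IsHermitian) (t : ℝ) :
    charFun (observableLaw ρ A hA : Measure ℝ) t =
      ρ.expect (NormedSpace.exp (Complex.I • (t • A))) := by
  set U : Matrix ι ι ℂ := (hA.eigenvectorUnitary : Matrix ι ι ℂ) with hU
  have hUU : U * star U = 1 := Unitary.mul_star_self_of_mem hA.eigenvectorUnitary.2
  have hUU' : star U * U = 1 := Unitary.star_mul_self_of_mem hA.eigenvectorUnitary.2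
  have hA' : Complex.I • (t • A) =
      U * Matrix.diagonal (fun i => Complex.I * (t * hA.eigenvalues i)) * star U := by
    conv_lhs => rw [hA.spectral_theorem]
    rw [Unitary.conjStarAlgAut_apply, ← hU]
    have : Matrix.diagonal (fun i => Complex.I * (t * hA.eigenvalues i)) =
        Complex.I • (t : ℂ) • Matrix.diagonal (RCLike.ofReal ∘ hA.eigenvalues) := by
      ext i j
      by_cases hij : i = j <;> simp [hij, Matrix.diagonal]
    rw [this, Matrix.mul_smul, Matrix.mul_smul, Matrix.smul_mul, Matrix.smul_mul, Complex.coe_smul]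
  have hexp : NormedSpace.exp (Complex.I • (t • A)) =
      U * Matrix.diagonal (fun i => Complex.exp (Complex.I * (t * hA.eigenvalues i))) * star U := by
    have h := Matrix.exp_units_conj (𝔸 := ℂ) ⟨U, star U, hUU, hUU'⟩
      (Matrix.diagonal (fun i => Complex.I * (t * hA.eigenvalues i)))
    rw [hA']
    refine h.trans ?_
    rw [Matrix.exp_diagonal, Pi.exp_def]
    simp only [Complex.exp_eq_exp_ℂ]
    rfl
  have hpos : (star U * ρ.mat * U).PosSemidef := ρ.posSemidef.conjTranspose_mul_mul_same U
  have hre : ∀ i, (((star U * ρ.mat * U) i i).re : ℂ) = (star U * ρ.mat * U) i i := fun i =>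
    Complex.ext rfl (Complex.le_def.1 (hpos.diag_nonneg (i := i))).2
  rw [hexp, DensityMatrix.expect_apply, ← mul_assoc, Matrix.trace_mul_comm, ← mul_assoc,
    ← mul_assoc, charFun_apply_real]
  change ∫ x, _ ∂(spectralMeasure ρ A hA) = _
  rw [spectralMeasure, integral_finsetSum_measure fun i _ =>
    (integrable_dirac (by finiteness)).smul_measure ENNReal.ofReal_ne_top]
  simp only [Matrix.trace, Matrix.diag_apply, Matrix.mul_diagonal]
  refine Finset.sum_congr rfl fun i _ => ?_
  rw [integral_smul_measure, integral_dirac, ← hU, ENNReal.toReal_ofReal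
    (Complex.le_def.1 (hpos.diag_nonneg (i := i))).1, Complex.real_smul, hre]
  congr 2
  ring

/-! ### Tensor products and translates of local observables -/

open scoped Matrix.Norms.L2Operator MatrixOrder Kronecker

/-- The operators on `n` output units. -/
abbrev UnitAlg (κ n : ℕ) := Matrix (Fin n → Fin κ) (Fin n → Fin κ) ℂ

section Kronecker

variable {m n : Type} [Fintype m] [DecidableEq m] [Fintype n] [DecidableEq n]

/-- A ↦ A ⊗ 1 is a star homomorphism of C*-algebras, hence contractive. -/
theorem norm_kronecker_one_le (A : Matrix m m ℂ) : ‖A ⊗ₖ (1 : Matrix n n ℂ)‖ ≤ ‖A‖ := by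
  let f : Matrix m m ℂ →⋆ₐ[ℂ] Matrix (m × n) (m × n) ℂ :=
    { toFun := fun A => A ⊗ₖ (1 : Matrix n n ℂ)
      map_one' := Matrix.one_kronecker_one
      map_mul' := fun A B => by rw [← Matrix.mul_kronecker_mul, mul_one]
      map_zero' := Matrix.zero_kronecker _
      map_add' := fun A B => Matrix.add_kronecker _ _ _
      commutes' := fun c => by
        rw [Algebra.algebraMap_eq_smul_one, Algebra.algebraMap_eq_smul_one, Matrix.smul_kronecker,
          Matrix.one_kronecker_one]
      map_star' := fun A => by
        simp only [Matrix.star_eq_conjTranspose, Matrix.conjTranspose_kronecker,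
          Matrix.conjTranspose_one] }
  exact NonUnitalStarAlgHom.norm_apply_le f A

theorem norm_one_kronecker_le (A : Matrix m m ℂ) : ‖(1 : Matrix n n ℂ) ⊗ₖ A‖ ≤ ‖A‖ := by
  let f : Matrix m m ℂ →⋆ₐ[ℂ] Matrix (n × m) (n × m) ℂ :=
    { toFun := fun A => (1 : Matrix n n ℂ) ⊗ₖ A
      map_one' := Matrix.one_kronecker_one
      map_mul' := fun A B => by rw [← Matrix.mul_kronecker_mul, mul_one]
      map_zero' := Matrix.kronecker_zero _
      map_add' := fun A B => Matrix.kronecker_add _ _ _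
      commutes' := fun c => by
        rw [Algebra.algebraMap_eq_smul_one, Algebra.algebraMap_eq_smul_one, Matrix.kronecker_smul,
          Matrix.one_kronecker_one]
      map_star' := fun A => by
        simp only [Matrix.star_eq_conjTranspose, Matrix.conjTranspose_kronecker,
          Matrix.conjTranspose_one] }
  exact NonUnitalStarAlgHom.norm_apply_le f A

theorem norm_kronecker_le (A : Matrix m m ℂ) (B : Matrix n n ℂ) : ‖A ⊗ₖ B‖ ≤ ‖A‖ * ‖B‖ := by
  have h : A ⊗ₖ B = (A ⊗ₖ (1 : Matrix n n ℂ)) * ((1 : Matrix m m ℂ) ⊗ₖ B) := by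
    rw [← Matrix.mul_kronecker_mul, mul_one, one_mul]
  rw [h]
  exact (norm_mul_le _ _).trans (mul_le_mul (norm_kronecker_one_le A) (norm_one_kronecker_le B)
    (norm_nonneg _) (norm_nonneg _))

end Kronecker

section Tens

variable {κ a b : ℕ}

/-- The tensor product of operators on `a` and on the following `b` output units. -/
def tens (A : UnitAlg κ a) (B : UnitAlg κ b) : UnitAlg κ (a + b) :=
  (A ⊗ₖ B).submatrix (Fin.appendEquiv a b).symm (Fin.appendEquiv a b).symm

theorem tens_apply (A : UnitAlg κ a) (B : UnitAlg κ b) (x y : Fin (a + b) → Fin κ) :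
    tens A B x y = A (fun i => x (Fin.castAdd b i)) (fun i => y (Fin.castAdd b i)) *
      B (fun i => x (Fin.natAdd a i)) (fun i => y (Fin.natAdd a i)) := rfl

theorem tens_mul_tens (A A' : UnitAlg κ a) (B B' : UnitAlg κ b) :
    tens A B * tens A' B' = tens (A * A') (B * B') := by
  rw [tens, tens, Matrix.submatrix_mul_equiv, ← Matrix.mul_kronecker_mul, tens]

@[simp] theorem tens_one_one : tens (1 : UnitAlg κ a) (1 : UnitAlg κ b) = 1 := by
  rw [tens, Matrix.one_kronecker_one, Matrix.submatrix_one_equiv]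

/-- `A ↦ A ⊗ 1`. -/
def tensLeft (κ a b : ℕ) : UnitAlg κ a →⋆ₐ[ℂ] UnitAlg κ (a + b) where
  toFun A := tens A 1
  map_one' := tens_one_one
  map_mul' A B := by rw [tens_mul_tens, mul_one]
  map_zero' := by ext; simp [tens_apply]
  map_add' A B := by ext; simp [tens_apply, add_mul]
  commutes' c := by
    rw [Algebra.algebraMap_eq_smul_one, Algebra.algebraMap_eq_smul_one]
    ext x y
    simp only [tens_apply, Matrix.smul_apply, smul_mul_assoc]
    exact congrArg (c • ·) (congrFun (congrFun tens_one_one x) y)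
  map_star' A := by
    rw [Matrix.star_eq_conjTranspose, Matrix.star_eq_conjTranspose, tens, tens,
      Matrix.conjTranspose_submatrix, Matrix.conjTranspose_kronecker, Matrix.conjTranspose_one]

/-- `B ↦ 1 ⊗ B`. -/
def tensRight (κ a b : ℕ) : UnitAlg κ b →⋆ₐ[ℂ] UnitAlg κ (a + b) where
  toFun A := tens 1 A
  map_one' := tens_one_one
  map_mul' A B := by rw [tens_mul_tens, mul_one]
  map_zero' := by ext; simp [tens_apply]
  map_add' A B := by ext; simp [tens_apply, mul_add]
  commutes' c := by
    rw [Algebra.algebraMap_eq_smul_one, Algebra.algebraMap_eq_smul_one]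
    ext x y
    simp only [tens_apply, Matrix.smul_apply, mul_smul_comm]
    exact congrArg (c • ·) (congrFun (congrFun tens_one_one x) y)
  map_star' A := by
    rw [Matrix.star_eq_conjTranspose, Matrix.star_eq_conjTranspose, tens, tens,
      Matrix.conjTranspose_submatrix, Matrix.conjTranspose_kronecker, Matrix.conjTranspose_one]

theorem tensLeft_apply (A : UnitAlg κ a) : tensLeft κ a b A = tens A 1 := rfl

theorem tensRight_apply (A : UnitAlg κ b) : tensRight κ a b A = tens 1 A := rfl

theorem tensLeft_mul_tensRight (A : UnitAlg κ a) (B : UnitAlg κ b) :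
    tensLeft κ a b A * tensRight κ a b B = tens A B := by
  rw [tensLeft_apply, tensRight_apply, tens_mul_tens, mul_one, one_mul]

theorem tensRight_mul_tensLeft (A : UnitAlg κ a) (B : UnitAlg κ b) :
    tensRight κ a b B * tensLeft κ a b A = tens A B := by
  rw [tensLeft_apply, tensRight_apply, tens_mul_tens, mul_one, one_mul]

/-- The exponential of a sum of operators on disjoint sets of units factorises. -/
theorem exp_tensLeft_add_tensRight (A : UnitAlg κ a) (B : UnitAlg κ b) :
    NormedSpace.exp (tensLeft κ a b A + tensRight κ a b B) =
      tens (NormedSpace.exp A) (NormedSpace.exp B) := by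
  have hc : Commute (tensLeft κ a b A) (tensRight κ a b B) := by
    rw [Commute, SemiconjBy, tensLeft_mul_tensRight, tensRight_mul_tensLeft]
  rw [Matrix.exp_add_of_commute _ _ hc]
  let _ : NormedAlgebra ℚ (UnitAlg κ a) := .restrictScalars ℚ ℂ _
  let _ : NormedAlgebra ℚ (UnitAlg κ b) := .restrictScalars ℚ ℂ _
  rw [← NormedSpace.map_exp (tensLeft κ a b)
      (LinearMap.continuous_of_finiteDimensional (tensLeft κ a b).toLinearMap),
    ← NormedSpace.map_exp (tensRight κ a b)
      (LinearMap.continuous_of_finiteDimensional (tensRight κ a b).toLinearMap),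
    tensLeft_mul_tensRight]

theorem norm_tensLeft_le (A : UnitAlg κ a) : ‖tensLeft κ a b A‖ ≤ ‖A‖ :=
  NonUnitalStarAlgHom.norm_apply_le _ A

theorem norm_tensRight_le (B : UnitAlg κ b) : ‖tensRight κ a b B‖ ≤ ‖B‖ :=
  NonUnitalStarAlgHom.norm_apply_le _ B

end Tens

section ShiftObs

variable {κ k : ℕ}

theorem shiftObs_add_eq_tensLeft (m r l : ℕ) (hl : l + k ≤ m) (Q : UnitAlg κ k) :
    shiftObs (m + r) l (by omega) Q = tensLeft κ m r (shiftObs m l hl Q) := by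
  ext x y
  rw [tensLeft_apply, tens_apply, Matrix.one_apply]
  simp only [shiftObs, Matrix.of_apply]
  have hiff : (∀ j : Fin (m + r), (j : ℕ) < l ∨ l + k ≤ (j : ℕ) → x j = y j) ↔
      (∀ j : Fin m, (j : ℕ) < l ∨ l + k ≤ (j : ℕ) → x (Fin.castAdd r j) = y (Fin.castAdd r j)) ∧
      (fun i => x (Fin.natAdd m i)) = fun i => y (Fin.natAdd m i) := by
    constructor
    · intro h
      exact ⟨fun j hj => h _ hj, funext fun i => h _ (Or.inr (by simp; omega))⟩
    · rintro ⟨h1, h2⟩ j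
      refine Fin.addCases (fun i hi => h1 i (by simpa using hi)) (fun i _ => congrFun h2 i) j
  by_cases h1 : ∀ j : Fin m, (j : ℕ) < l ∨ l + k ≤ (j : ℕ) →
      x (Fin.castAdd r j) = y (Fin.castAdd r j)
  · by_cases h2 : (fun i => x (Fin.natAdd m i)) = fun i => y (Fin.natAdd m i)
    · rw [if_pos (hiff.2 ⟨h1, h2⟩), if_pos h1, if_pos h2, mul_one]
      rfl
    · rw [if_neg fun h => h2 (hiff.1 h).2, if_neg h2, mul_zero]
  · rw [if_neg fun h => h1 (hiff.1 h).1, if_neg h1, zero_mul]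

theorem shiftObs_add_eq_tensRight (m r l : ℕ) (hl : l + k ≤ r) (Q : UnitAlg κ k) :
    shiftObs (m + r) (m + l) (by omega) Q = tensRight κ m r (shiftObs r l hl Q) := by
  ext x y
  rw [tensRight_apply, tens_apply, Matrix.one_apply]
  simp only [shiftObs, Matrix.of_apply]
  have hiff : (∀ j : Fin (m + r), (j : ℕ) < m + l ∨ m + l + k ≤ (j : ℕ) → x j = y j) ↔
      (fun i => x (Fin.castAdd r i)) = (fun i => y (Fin.castAdd r i)) ∧
      (∀ j : Fin r, (j : ℕ) < l ∨ l + k ≤ (j : ℕ) → x (Fin.natAdd m j) = y (Fin.natAdd m j)) := by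
    constructor
    · intro h
      exact ⟨funext fun i => h _ (Or.inl (by simp; omega)), fun j hj => h _ (by simp; omega)⟩
    · rintro ⟨h1, h2⟩ j
      refine Fin.addCases (fun i _ => congrFun h1 i) (fun i hi => h2 i (by simp at hi; omega)) j
  by_cases h1 : (fun i => x (Fin.castAdd r i)) = (fun i => y (Fin.castAdd r i))
  · by_cases h2 : ∀ j : Fin r, (j : ℕ) < l ∨ l + k ≤ (j : ℕ) →
        x (Fin.natAdd m j) = y (Fin.natAdd m j)
    · rw [if_pos (hiff.2 ⟨h1, h2⟩), if_pos h1, if_pos h2, one_mul]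
      congr 1 <;> funext j <;> congr 1 <;> ext <;> simp [add_assoc]
    · rw [if_neg fun h => h2 (hiff.1 h).2, if_neg h2, mul_zero]
  · rw [if_neg fun h => h1 (hiff.1 h).1, if_neg h1, zero_mul]

theorem shiftObs_self (Q : UnitAlg κ k) : shiftObs k 0 (by omega) Q = Q := by
  ext x y
  simp only [shiftObs, Matrix.of_apply]
  rw [if_pos fun j hj => by omega]
  congr 1 <;> funext j <;> congr 1 <;> ext <;> simp

/-- A translate is 1 ⊗ Q ⊗ 1. Linearity, norm bounds and transfer operators of translates are read
off from this form. -/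
theorem shiftObs_eq_tens (l r : ℕ) (Q : UnitAlg κ k) :
    shiftObs (l + k + r) l (by omega) Q = tensLeft κ (l + k) r (tensRight κ l k Q) := by
  rw [shiftObs_add_eq_tensLeft (l + k) r l le_rfl]
  congr 1
  have := shiftObs_add_eq_tensRight l k 0 (by omega) Q
  rw [shiftObs_self] at this
  exact this

theorem shiftObs_sub_smul_one (n l : ℕ) (hl : l + k ≤ n) (Q : UnitAlg κ k) (c : ℝ) :
    shiftObs n l hl (Q - c • 1) = shiftObs n l hl Q - c • 1 := by
  obtain ⟨r, rfl⟩ := Nat.exists_eq_add_of_le hl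
  rw [shiftObs_eq_tens, shiftObs_eq_tens, map_sub, map_sub, ← Complex.coe_smul, map_smul, map_smul,
    map_one, map_one, Complex.coe_smul]

theorem norm_shiftObs_le (n l : ℕ) (hl : l + k ≤ n) (Q : UnitAlg κ k) :
    ‖shiftObs n l hl Q‖ ≤ ‖Q‖ := by
  obtain ⟨r, rfl⟩ := Nat.exists_eq_add_of_le hl
  rw [shiftObs_eq_tens]
  exact (norm_tensLeft_le _).trans (norm_tensRight_le _)

theorem shiftObs_mul_eq_tens (m r l j : ℕ) (hl : l + k ≤ m) (hj : j + k ≤ r) (Q R : UnitAlg κ k) :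
    shiftObs (m + r) l (by omega) Q * shiftObs (m + r) (m + j) (by omega) R =
      tens (shiftObs m l hl Q) (shiftObs r j hj R) := by
  rw [shiftObs_add_eq_tensLeft m r l hl, shiftObs_add_eq_tensRight m r j hj,
    tensLeft_mul_tensRight]

theorem commute_shiftObs (n l l' : ℕ) (hl : l + k ≤ l') (hl' : l' + k ≤ n) (Q R : UnitAlg κ k) :
    Commute (shiftObs n l (by omega) Q) (shiftObs n l' hl' R) := by
  obtain ⟨j, rfl⟩ := Nat.exists_eq_add_of_le hl
  obtain ⟨r, rfl⟩ := Nat.exists_eq_add_of_le (show l + k ≤ n by omega)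
  rw [shiftObs_add_eq_tensLeft (l + k) r l le_rfl, shiftObs_add_eq_tensRight (l + k) r j (by omega),
    Commute, SemiconjBy, tensLeft_mul_tensRight, tensRight_mul_tensLeft]

end ShiftObs

/-! ### Transfer operators -/

namespace QMC

variable {d κ : ℕ}

theorem norm_iterV_le (M : QMC d κ) (n : ℕ) : ‖M.iterV n‖ ≤ 1 := by
  have h := Matrix.l2_opNorm_conjTranspose_mul_self (M.iterV n)
  rw [M.iterV_isometry] at h
  have h1 : ‖(1 : Matrix (Fin d) (Fin d) ℂ)‖ ≤ 1 := by
    rcases subsingleton_or_nontrivial (Matrix (Fin d) (Fin d) ℂ) with hs | hn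
    · rw [Subsingleton.elim (1 : Matrix (Fin d) (Fin d) ℂ) 0, norm_zero]; exact zero_le_one
    · exact CStarRing.norm_one.le
  nlinarith [norm_nonneg (M.iterV n)]

/-- The transition operator in the Heisenberg picture that measures `A` on the next `n` output
units: `X ↦ V(n)* (X ⊗ A) V(n)`. -/
noncomputable def transfer (M : QMC d κ) (n : ℕ) :
    UnitAlg κ n →ₗ[ℂ] Matrix (Fin d) (Fin d) ℂ →L[ℂ] Matrix (Fin d) (Fin d) ℂ where
  toFun A := LinearMap.toContinuousLinearMap
    { toFun := fun X => (M.iterV n)ᴴ * (X ⊗ₖ A) * M.iterV n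
      map_add' := fun X Y => by rw [Matrix.add_kronecker, Matrix.mul_add, Matrix.add_mul]
      map_smul' := fun c X => by
        rw [Matrix.smul_kronecker, Matrix.mul_smul, Matrix.smul_mul, RingHom.id_apply] }
  map_add' A B := by
    ext1 X
    change (M.iterV n)ᴴ * (X ⊗ₖ (A + B)) * M.iterV n =
      (M.iterV n)ᴴ * (X ⊗ₖ A) * M.iterV n + (M.iterV n)ᴴ * (X ⊗ₖ B) * M.iterV n
    rw [Matrix.kronecker_add, Matrix.mul_add, Matrix.add_mul]
  map_smul' c A := by
    ext1 X
    change (M.iterV n)ᴴ * (X ⊗ₖ (c • A)) * M.iterV n = c • ((M.iterV n)ᴴ * (X ⊗ₖ A) * M.iterV n)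
    rw [Matrix.kronecker_smul, Matrix.mul_smul, Matrix.smul_mul]

theorem transfer_apply (M : QMC d κ) (n : ℕ) (A : UnitAlg κ n) (X : Matrix (Fin d) (Fin d) ℂ) :
    M.transfer n A X = (M.iterV n)ᴴ * (X ⊗ₖ A) * M.iterV n := rfl

theorem transfer_apply_eq_sum (M : QMC d κ) (n : ℕ) (A : UnitAlg κ n)
    (X : Matrix (Fin d) (Fin d) ℂ) :
    M.transfer n A X = ∑ i, ∑ j, A i j • ((M.krausWord n i)ᴴ * X * M.krausWord n j) := by
  rw [transfer_apply]
  ext a b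
  simp only [Matrix.mul_apply, Matrix.sum_apply, Matrix.smul_apply, Matrix.conjTranspose_apply,
    Fintype.sum_prod_type, Matrix.kroneckerMap_apply, iterV, Matrix.of_apply, Finset.sum_mul,
    smul_eq_mul, Finset.mul_sum]
  refine Finset.sum_comm.trans (Eq.trans ?_ Finset.sum_comm)
  refine Finset.sum_congr rfl fun j _ => Eq.trans ?_ Finset.sum_comm
  refine Finset.sum_congr rfl fun c' _ => Finset.sum_comm.trans ?_
  refine Finset.sum_congr rfl fun i _ => Finset.sum_congr rfl fun c _ => ?_
  ring

theorem norm_transfer_le (M : QMC d κ) (n : ℕ) (A : UnitAlg κ n) : ‖M.transfer n A‖ ≤ ‖A‖ := by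
  refine ContinuousLinearMap.opNorm_le_bound _ (norm_nonneg _) fun X => ?_
  rw [transfer_apply]
  calc _ ≤ ‖(M.iterV n)ᴴ‖ * ‖X ⊗ₖ A‖ * ‖M.iterV n‖ :=
        (Matrix.l2_opNorm_mul _ _).trans (by gcongr; exact Matrix.l2_opNorm_mul _ _)
    _ ≤ 1 * (‖X‖ * ‖A‖) * 1 := by
      gcongr
      · rw [Matrix.l2_opNorm_conjTranspose]; exact M.norm_iterV_le n
      · exact norm_kronecker_le X A
      · exact M.norm_iterV_le n
    _ = _ := by ring

theorem krausWord_append (M : QMC d κ) (a b : ℕ) (i : Fin a → Fin κ) (j : Fin b → Fin κ) :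
    M.krausWord (a + b) (Fin.append i j) = M.krausWord b j * M.krausWord a i := by
  induction b with
  | zero =>
    rw [krausWord, one_mul, Fin.append_right_nil _ _ rfl]
    rfl
  | succ b ih =>
    have h1 : (Fin.append i j : Fin (a + (b + 1)) → Fin κ) (Fin.last (a + b)) = j (Fin.last b) := Fin.append_right i j (Fin.last b)
    have h2 : Fin.init (n := a + b) (α := fun _ => Fin κ)
        (Fin.append i j : Fin (a + (b + 1)) → Fin κ) =
        Fin.append i (Fin.init (α := fun _ => Fin κ) j) := by
      funext x
      refine Fin.addCases (fun x => ?_) (fun x => ?_) x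
      · rw [Fin.append_left]
        exact Fin.append_left i j x
      · rw [Fin.append_right]
        exact Fin.append_right i j x.castSucc
    change M.kraus ((Fin.append i j : Fin (a + (b + 1)) → Fin κ) (Fin.last (a + b))) *
      M.krausWord (a + b) (Fin.init (n := a + b) (α := fun _ => Fin κ)
        (Fin.append i j : Fin (a + (b + 1)) → Fin κ)) = _
    rw [h1, h2, ih, krausWord, mul_assoc]

/-- The Markov property. Kraus words of concatenated outputs multiply with the later word on the
left, so the later units act first on a system observable in the Heisenberg picture. -/
theorem transfer_tens (M : QMC d κ) {a b : ℕ} (A : UnitAlg κ a) (B : UnitAlg κ b) :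
    M.transfer (a + b) (tens A B) = M.transfer a A * M.transfer b B := by
  ext1 X
  rw [mul_apply_eq_comp, transfer_apply_eq_sum, transfer_apply_eq_sum, transfer_apply_eq_sum]
  simp only [← (Fin.appendEquiv a b).sum_comp, Fintype.sum_prod_type]
  have h : ∀ (i i' : Fin a → Fin κ) (j j' : Fin b → Fin κ),
      tens A B (Fin.appendEquiv a b (i, j)) (Fin.appendEquiv a b (i', j')) •
        ((M.krausWord (a + b) (Fin.appendEquiv a b (i, j)))ᴴ * X *
          M.krausWord (a + b) (Fin.appendEquiv a b (i', j'))) =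
      A i i' • ((M.krausWord a i)ᴴ * (B j j' • ((M.krausWord b j)ᴴ * X * M.krausWord b j')) *
        M.krausWord a i') := by
    intro i i' j j'
    have e : ∀ (i : Fin a → Fin κ) (j : Fin b → Fin κ), M.krausWord (a + b)
        (Fin.appendEquiv a b (i, j)) = M.krausWord b j * M.krausWord a i := M.krausWord_append a b
    rw [e, e, tens, Matrix.submatrix_apply, Equiv.symm_apply_apply, Equiv.symm_apply_apply,
      Matrix.kronecker_apply, Matrix.conjTranspose_mul, Matrix.mul_smul, Matrix.smul_mul, smul_smul]
    simp only [mul_assoc]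
  simp only [h, Matrix.mul_sum, Matrix.sum_mul, Finset.smul_sum]
  refine Finset.sum_congr rfl fun i _ => ?_
  rw [Finset.sum_comm]

/-- The transition operator in the Heisenberg picture. -/
noncomputable def heis (M : QMC d κ) : Matrix (Fin d) (Fin d) ℂ →L[ℂ] Matrix (Fin d) (Fin d) ℂ :=
  M.transfer 1 1

theorem transfer_one (M : QMC d κ) (n : ℕ) : M.transfer n 1 = M.heis ^ n := by
  induction n with
  | zero =>
    ext1 X
    rw [transfer_apply_eq_sum, pow_zero]
    simp [krausWord]
  | succ n ih =>
    rw [pow_succ, ← ih, heis, ← transfer_tens, tens_one_one]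

theorem heis_pow_one (M : QMC d κ) (n : ℕ) : (M.heis ^ n) 1 = 1 := by
  rw [← transfer_one, transfer_apply, Matrix.one_kronecker_one, Matrix.mul_one, M.iterV_isometry]

theorem norm_heis_pow_le (M : QMC d κ) (n : ℕ) : ‖M.heis ^ n‖ ≤ 1 := by
  rw [← transfer_one]
  refine (M.norm_transfer_le n 1).trans ?_
  rcases subsingleton_or_nontrivial (UnitAlg κ n) with hs | hn
  · rw [Subsingleton.elim (1 : UnitAlg κ n) 0, norm_zero]; exact zero_le_one
  · exact CStarRing.norm_one.le

theorem transfer_shiftObs (M : QMC d κ) {k : ℕ} (n l : ℕ) (hl : l + k ≤ n) (Q : UnitAlg κ k) :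
    M.transfer n (shiftObs n l hl Q) = M.heis ^ l * M.transfer k Q * M.heis ^ (n - (l + k)) := by
  obtain ⟨r, rfl⟩ := Nat.exists_eq_add_of_le hl
  rw [shiftObs_eq_tens, tensLeft_apply, tensRight_apply, transfer_tens, transfer_tens,
    transfer_one, transfer_one, Nat.add_sub_cancel_left]

theorem transfer_shiftObs_mul (M : QMC d κ) {k : ℕ} (n l j : ℕ) (hn : l + k + j + k ≤ n)
    (Q R : UnitAlg κ k) :
    M.transfer n (shiftObs n l (by omega) Q * shiftObs n (l + k + j) hn R) =
      M.heis ^ l * M.transfer k Q * (M.heis ^ j * M.transfer k R *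
        M.heis ^ (n - (l + k + j + k))) := by
  obtain ⟨r, rfl⟩ := Nat.exists_eq_add_of_le (show l + k ≤ n by omega)
  rw [shiftObs_mul_eq_tens (l + k) r l j le_rfl (by omega), transfer_tens, transfer_shiftObs,
    transfer_shiftObs, Nat.sub_self, pow_zero, mul_one]
  congr 3
  omega

theorem _root_.Matrix.trace_mul_one_kronecker {m n : Type} [Fintype m] [DecidableEq m] [Fintype n]
    (G : Matrix (m × n) (m × n) ℂ) (A : Matrix n n ℂ) :
    (G * ((1 : Matrix m m ℂ) ⊗ₖ A)).trace =
      ((Matrix.of fun i j => ∑ a, G (a, i) (a, j)) * A).trace := by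
  simp only [Matrix.trace, Matrix.diag_apply, Matrix.mul_apply, Fintype.sum_prod_type,
    Matrix.of_apply, Matrix.kroneckerMap_apply, Matrix.one_apply, ite_mul, one_mul, zero_mul,
    mul_ite, mul_zero, Finset.sum_mul]
  refine Finset.sum_comm.trans (Finset.sum_congr rfl fun i _ => ?_)
  refine Eq.trans (Finset.sum_congr rfl fun a _ => ?_) Finset.sum_comm
  refine Finset.sum_comm.trans ?_
  simp

/-- Schrödinger–Heisenberg duality: asymptotics in n become questions about operators on an algebra
whose dimension does not depend on n. -/
theorem expect_output (M : QMC d κ) (n : ℕ) (ρ : DensityMatrix (Fin d)) (A : UnitAlg κ n) :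
    (M.output n ρ).expect A = ρ.expect (M.transfer n A 1) := by
  have h : ρ.expect (M.transfer n A 1) =
      (M.iterV n * ρ.mat * (M.iterV n)ᴴ * ((1 : Matrix (Fin d) (Fin d) ℂ) ⊗ₖ A)).trace := by
    rw [DensityMatrix.expect_apply, transfer_apply, ← Matrix.mul_assoc, Matrix.trace_mul_comm]
    simp only [Matrix.mul_assoc]
  rw [h, Matrix.trace_mul_one_kronecker, DensityMatrix.expect_apply]
  rfl

end QMC

/-! ### From irreducibility to ergodicity of the transition operator -/

/-- A lies above r · 1 for some r > 0, and δ‖H‖ ≤ r/2 leaves at least r/2. -/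
theorem Matrix.PosDef.exists_add_smul_posDef {n : Type} [Fintype n] [DecidableEq n]
    {A H : Matrix n n ℂ} (hA : A.PosDef) (hH : H.IsHermitian) :
    ∃ δ : ℝ, 0 < δ ∧ (A + δ • H).PosDef := by
  rcases subsingleton_or_nontrivial (Matrix n n ℂ) with hs | hn
  · exact ⟨1, one_pos, by rwa [Subsingleton.elim (A + (1 : ℝ) • H) A]⟩
  have hA' := hA.isStrictlyPositive
  obtain ⟨r, hr, hrA⟩ := (CFC.exists_pos_algebraMap_le_iff hA'.isSelfAdjoint).2
    fun x hx => hA'.spectrum_pos hx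
  have hHn : -algebraMap ℝ (Matrix n n ℂ) ‖H‖ ≤ H :=
    IsSelfAdjoint.neg_algebraMap_norm_le_self (a := H) hH
  set δ : ℝ := r / 2 / (‖H‖ + 1) with hδ
  have hδ0 : 0 < δ := by positivity
  have hδH : δ * ‖H‖ ≤ r / 2 := by
    rw [hδ, div_mul_eq_mul_div]
    exact div_le_of_le_mul₀ (by positivity) (by positivity) (by nlinarith [norm_nonneg H])
  refine ⟨δ, hδ0, Matrix.IsStrictlyPositive.posDef ?_⟩
  have h1 : IsStrictlyPositive (algebraMap ℝ (Matrix n n ℂ) (r / 2)) := by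
    rw [Matrix.isStrictlyPositive_iff_posDef, Algebra.algebraMap_eq_smul_one]
    exact Matrix.PosDef.one.smul (by positivity)
  refine h1.of_le ?_
  have h2 : -algebraMap ℝ (Matrix n n ℂ) (δ * ‖H‖) ≤ δ • H := by
    have := smul_le_smul_of_nonneg_left hHn hδ0.le
    rwa [smul_neg, Algebra.smul_def, ← map_mul] at this
  have h3 : algebraMap ℝ (Matrix n n ℂ) (δ * ‖H‖) ≤ algebraMap ℝ (Matrix n n ℂ) (r / 2) :=
    algebraMap_mono _ hδH
  calc algebraMap ℝ (Matrix n n ℂ) (r / 2)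
      = algebraMap ℝ (Matrix n n ℂ) r + -algebraMap ℝ (Matrix n n ℂ) (r / 2) := by
        rw [← map_neg, ← map_add]; congr 1; ring
    _ ≤ _ := add_le_add hrA ((neg_le_neg h3).trans h2)

namespace QMC

variable {d κ : ℕ}

theorem heis_apply (M : QMC d κ) (X : Matrix (Fin d) (Fin d) ℂ) :
    M.heis X = ∑ i, (M.kraus i)ᴴ * X * M.kraus i := by
  rw [heis, transfer_apply_eq_sum]
  refine Fintype.sum_equiv (Equiv.funUnique (Fin 1) (Fin κ)) _ _ fun i => ?_
  rw [Finset.sum_eq_single i (fun j _ hj => by rw [Matrix.one_apply_ne hj.symm, zero_smul])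
    (by simp), Matrix.one_apply_eq, one_smul]
  simp only [krausWord, mul_one]
  rfl

theorem trace_mul_heis (M : QMC d κ) (σ X : Matrix (Fin d) (Fin d) ℂ) :
    (σ * M.heis X).trace = (M.channel σ * X).trace := by
  rw [heis_apply, channel, Finset.mul_sum, Finset.sum_mul, Matrix.trace_sum, Matrix.trace_sum]
  refine Finset.sum_congr rfl fun i _ => ?_
  rw [← mul_assoc, Matrix.trace_mul_comm]
  simp only [mul_assoc]

theorem trace_mul_heis_pow (M : QMC d κ) (n : ℕ) (σ X : Matrix (Fin d) (Fin d) ℂ) :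
    (σ * (M.heis ^ n) X).trace = (M.channel^[n] σ * X).trace := by
  induction n generalizing σ with
  | zero => simp
  | succ n ih =>
    rw [pow_succ', mul_apply_eq_comp, trace_mul_heis, ih, Function.iterate_succ_apply]

theorem channel_add (M : QMC d κ) (σ τ : Matrix (Fin d) (Fin d) ℂ) :
    M.channel (σ + τ) = M.channel σ + M.channel τ := by
  simp only [channel, Matrix.mul_add, Matrix.add_mul, Finset.sum_add_distrib]

theorem channel_smul (M : QMC d κ) (c : ℂ) (σ : Matrix (Fin d) (Fin d) ℂ) :
    M.channel (c • σ) = c • M.channel σ := by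
  simp only [channel, Matrix.mul_smul, Matrix.smul_mul, Finset.smul_sum]

theorem channel_conjTranspose (M : QMC d κ) (σ : Matrix (Fin d) (Fin d) ℂ) :
    M.channel σᴴ = (M.channel σ)ᴴ := by
  simp only [channel, Matrix.conjTranspose_sum, Matrix.conjTranspose_mul,
    Matrix.conjTranspose_conjTranspose, mul_assoc]

end QMC

namespace IrreducibleQMC

variable {d κ : ℕ}

theorem posDef_stationaryState (M : IrreducibleQMC d κ) : M.stationaryState.mat.PosDef :=
  M.irreducible.choose_spec.1.1

theorem channel_stationaryState (M : IrreducibleQMC d κ) :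
    M.channel M.stationaryState.mat = M.stationaryState.mat :=
  M.irreducible.choose_spec.1.2

theorem nonempty_fin (M : IrreducibleQMC d κ) : Nonempty (Fin d) := by
  by_contra h
  rw [not_nonempty_iff] at h
  have := M.stationaryState.trace_eq_one
  simp [Matrix.trace] at this

/-- Irreducibility gives uniqueness only among faithful states. A small multiple of H added to the
stationary state leaves it positive definite and fixed; normalised, it must be the stationary state
again, which forces H to be a multiple. -/
theorem eq_smul_stationaryState_of_isHermitian (M : IrreducibleQMC d κ)
    {H : Matrix (Fin d) (Fin d) ℂ} (hH : H.IsHermitian) (hfix : M.channel H = H) :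
    H = H.trace • M.stationaryState.mat := by
  obtain ⟨δ, hδ, hpos⟩ := M.posDef_stationaryState.exists_add_smul_posDef hH
  have := M.nonempty_fin
  set A := M.stationaryState.mat + δ • H with hA
  have ht : A.trace = 1 + δ * H.trace := by
    rw [hA, Matrix.trace_add, M.stationaryState.trace_eq_one, ← Complex.coe_smul,
      Matrix.trace_smul, smul_eq_mul]
  have htpos : 0 < A.trace := hpos.trace_pos
  have hAfix : M.channel A = A := by
    rw [hA, M.channel_add, ← Complex.coe_smul, M.channel_smul, hfix, M.channel_stationaryState]
  have hpos' : (A.trace⁻¹ • A).PosDef := hpos.smul (by positivity)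
  have heq := M.irreducible.choose_spec.2
    ⟨A.trace⁻¹ • A, hpos'.posSemidef, by
      rw [Matrix.trace_smul, smul_eq_mul, inv_mul_cancel₀ htpos.ne']⟩
    ⟨hpos', by change M.channel (A.trace⁻¹ • A) = A.trace⁻¹ • A; rw [M.channel_smul, hAfix]⟩
  have heq' : A.trace⁻¹ • A = M.stationaryState.mat := congrArg DensityMatrix.mat heq
  have h2 : A = A.trace • M.stationaryState.mat := by
    rw [← heq', smul_smul, mul_inv_cancel₀ htpos.ne', one_smul]
  have h3 : δ • H = δ • (H.trace • M.stationaryState.mat) := by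
    have : M.stationaryState.mat + δ • H =
        (1 + δ * H.trace) • M.stationaryState.mat := by rw [← ht, ← h2]
    rw [add_smul, one_smul, add_right_inj] at this
    rw [this, mul_smul, Complex.coe_smul]
  exact (smul_right_injective _ hδ.ne') h3

theorem eq_smul_stationaryState (M : IrreducibleQMC d κ) {X : Matrix (Fin d) (Fin d) ℂ}
    (hfix : M.channel X = X) : X = X.trace • M.stationaryState.mat := by
  have h1 := M.eq_smul_stationaryState_of_isHermitian (H := X + Xᴴ)
    (by rw [Matrix.IsHermitian, Matrix.conjTranspose_add, Matrix.conjTranspose_conjTranspose,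
      add_comm])
    (by rw [M.channel_add, M.channel_conjTranspose, hfix])
  have h2 := M.eq_smul_stationaryState_of_isHermitian (H := Complex.I • (X + (-1 : ℂ) • Xᴴ))
    (by
      rw [Matrix.IsHermitian, Matrix.conjTranspose_smul, Matrix.conjTranspose_add,
        Matrix.conjTranspose_smul, Matrix.conjTranspose_conjTranspose]
      simp
      abel)
    (by rw [M.channel_smul, M.channel_add, M.channel_smul, M.channel_conjTranspose, hfix])
  have h3 : X = (1 / 2 : ℂ) • ((X + Xᴴ) + (-Complex.I) • (Complex.I • (X + (-1 : ℂ) • Xᴴ))) := by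
    rw [smul_smul, neg_mul, Complex.I_mul_I]
    module
  have h4 : (X + Xᴴ) + (-Complex.I) • (Complex.I • (X + (-1 : ℂ) • Xᴴ)) =
    ((X + Xᴴ) + (-Complex.I) • (Complex.I • (X + (-1 : ℂ) • Xᴴ))).trace •
      M.stationaryState.mat := by
    conv_lhs => rw [h1, h2]
    simp only [Matrix.trace_add, Matrix.trace_smul, smul_eq_mul]
    module
  conv_lhs => rw [h3, h4, smul_smul, ← smul_eq_mul, ← Matrix.trace_smul, ← h3]

/-- The stationary expectation, as a functional on the system observables. -/
noncomputable def statFun (M : IrreducibleQMC d κ) : Matrix (Fin d) (Fin d) ℂ →L[ℂ] ℂ :=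
  LinearMap.toContinuousLinearMap M.stationaryState.expect

theorem statFun_apply (M : IrreducibleQMC d κ) (X : Matrix (Fin d) (Fin d) ℂ) :
    M.statFun X = M.stationaryState.expect X := rfl

theorem exists_trace_mul_eq {n : Type} [Fintype n] [DecidableEq n] (f : Matrix n n ℂ →ₗ[ℂ] ℂ) :
    ∃ σ : Matrix n n ℂ, ∀ X, f X = (σ * X).trace := by
  refine ⟨Matrix.of fun j i => f (Matrix.single i j 1), fun X => ?_⟩
  conv_lhs => rw [Matrix.matrix_eq_sum_single X]
  simp only [map_sum, Matrix.trace, Matrix.diag_apply, Matrix.mul_apply, Matrix.of_apply]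
  rw [Finset.sum_comm]
  refine Finset.sum_congr rfl fun j _ => Finset.sum_congr rfl fun i _ => ?_
  rw [← mul_one (X i j), ← smul_eq_mul, ← Matrix.smul_single, map_smul, smul_eq_mul, mul_comm,
    smul_eq_mul, mul_one]

/-- An invariant functional is X ↦ tr(σX) with σ fixed by the channel, hence a multiple of the
stationary expectation. -/
theorem isErgodic_heis (M : IrreducibleQMC d κ) : IsErgodic M.heis 1 M.statFun where
  norm_pow_le := M.norm_heis_pow_le
  map_unit := by simpa using M.heis_pow_one 1
  map_state X := by
    rw [statFun_apply, statFun_apply, DensityMatrix.expect_apply, M.trace_mul_heis,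
      M.channel_stationaryState, DensityMatrix.expect_apply]
  state_unit := M.stationaryState.expect_one
  unique f hf X := by
    obtain ⟨σ, hσ⟩ := exists_trace_mul_eq (f : Matrix (Fin d) (Fin d) ℂ →ₗ[ℂ] ℂ)
    have hσ' : ∀ X, f X = (σ * X).trace := hσ
    have hfix : M.channel σ = σ := by
      rw [Matrix.ext_iff_trace_mul_right]
      intro X
      rw [← M.trace_mul_heis, ← hσ', hf, hσ']
    rw [hσ', hσ', mul_one, statFun_apply, DensityMatrix.expect_apply]
    conv_lhs => rw [M.eq_smul_stationaryState hfix]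
    rw [Matrix.smul_mul, Matrix.trace_smul, smul_eq_mul]

end IrreducibleQMC

/-! ### Cesàro summation and exponential decay -/

theorem Finset.sum_range_mul_eq {α : Type*} [AddCommMonoid α] (f : ℕ → α) (a b : ℕ) :
    ∑ i ∈ Finset.range (a * b), f i =
      ∑ j ∈ Finset.range a, ∑ i ∈ Finset.range b, f (j * b + i) := by
  induction a with
  | zero => simp
  | succ a ih => rw [add_mul, one_mul, Finset.sum_range_add, ih, Finset.sum_range_succ]

/-- Cesàro convergence of a sequence whose deviations from the limit have bounded sums. -/
theorem tendsto_cesaro_of_bounded_sum {S : ℕ → ℝ} {s K : ℝ} {m : ℕ}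
    (h : ∀ N, |∑ j ∈ Finset.range N, (S (m + j) - s)| ≤ K) :
    Tendsto (fun N : ℕ => (N : ℝ)⁻¹ * ∑ j ∈ Finset.range N, S j) atTop (𝓝 s) := by
  set K' : ℝ := |∑ j ∈ Finset.range m, (S j - s)| + K with hK'
  rw [tendsto_iff_norm_sub_tendsto_zero]
  refine squeeze_zero' (g := fun N : ℕ => (N : ℝ)⁻¹ * K') (Eventually.of_forall fun _ => norm_nonneg _) ?_ ?_
  · filter_upwards [eventually_ge_atTop (m + 1)] with N hN
    obtain ⟨r, rfl⟩ := Nat.exists_eq_add_of_le (show m ≤ N by omega)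
    have hN0 : ((m + r : ℕ) : ℝ) ≠ 0 := by
      have : 0 < m + r := by omega
      positivity
    have h1 : (((m + r : ℕ) : ℝ))⁻¹ * ∑ j ∈ Finset.range (m + r), S j - s =
        (((m + r : ℕ) : ℝ))⁻¹ * ∑ j ∈ Finset.range (m + r), (S j - s) := by
      rw [Finset.sum_sub_distrib, Finset.sum_const, Finset.card_range, nsmul_eq_mul]
      field_simp
    rw [h1, norm_mul, norm_inv, Real.norm_natCast, Real.norm_eq_abs, Finset.sum_range_add]
    gcongr
    exact (abs_add_le _ _).trans (add_le_add le_rfl (h r))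
  · have := ((tendsto_inv_atTop_zero (𝕜 := ℝ)).comp tendsto_natCast_atTop_atTop).mul_const K'
    simpa using this

namespace IsErgodic

variable {E : Type*} [NormedAddCommGroup E] [NormedSpace ℂ E] {T : E →L[ℂ] E} {u : E}
  {φ : E →L[ℂ] ℂ}

/-- If the powers of `T` converge, then they converge exponentially fast. -/
theorem summable_norm_pow [FiniteDimensional ℂ E] (h : IsErgodic T u φ)
    (hlim : ∀ x, Tendsto (fun n : ℕ => (T ^ n) x) atTop (𝓝 (φ x • u))) {x : E} (hx : φ x = 0) :
    Summable fun n : ℕ => ‖(T ^ n) x‖ := by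
  let b := Module.finBasis ℂ E
  obtain ⟨C, hC0, hC⟩ := b.exists_opNorm_le (F := E)
  have hR : ∀ (n : ℕ) (y : E), (T ^ n * (1 - φ.smulRight u)) y = (T ^ n) (y - φ y • u) :=
    fun _ _ => rfl
  -- Smallness on a finite basis suffices: the basis constant C turns 1/(2C) into an operator norm
  -- of at most 1/2 on the complement of u.
  have hev : ∀ᶠ n : ℕ in atTop, ∀ i, ‖(T ^ n * (1 - φ.smulRight u)) (b i)‖ ≤ 1 / (2 * C) := by
    rw [eventually_all]
    intro i
    have h0 : Tendsto (fun n : ℕ => ‖(T ^ n * (1 - φ.smulRight u)) (b i)‖) atTop (𝓝 0) := by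
      have := (hlim (b i - φ (b i) • u)).norm
      rw [map_sub, map_smul, h.state_unit, smul_eq_mul, mul_one, sub_self, zero_smul,
        norm_zero] at this
      simpa only [hR] using this
    exact (h0.eventually_lt_const (by positivity)).mono fun n hn => hn.le
  obtain ⟨n₀, hn₀, hn₀pos⟩ := (hev.and (eventually_ge_atTop 1)).exists
  have hhalf : ‖T ^ n₀ * (1 - φ.smulRight u)‖ ≤ 1 / 2 := by
    refine (hC (by positivity) hn₀).trans_eq ?_
    field_simp
  -- The iterates of x stay in ker φ, where the projection 1 - φ(·) u acts as the identity, so the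
  -- factor 1/2 can be iterated.
  have hstep : ∀ j : ℕ, ‖(T ^ (j * n₀)) x‖ ≤ (1 / 2) ^ j * ‖x‖ := by
    intro j
    induction j with
    | zero => simp
    | succ j ih =>
      have h1 : (T ^ ((j + 1) * n₀)) x =
          (T ^ n₀ * (1 - φ.smulRight u)) ((T ^ (j * n₀)) x) := by
        rw [add_mul, one_mul, add_comm, pow_add]
        rw [hR, h.state_pow, hx, zero_smul, sub_zero, mul_apply_eq_comp]
      rw [h1]
      refine (ContinuousLinearMap.le_of_opNorm_le _ hhalf _).trans ?_
      rw [pow_succ', mul_assoc]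
      gcongr
  refine summable_of_sum_range_le (c := n₀ * (2 * ‖x‖)) (fun _ => norm_nonneg _) fun n => ?_
  calc ∑ i ∈ Finset.range n, ‖(T ^ i) x‖ ≤ ∑ i ∈ Finset.range (n * n₀), ‖(T ^ i) x‖ :=
        Finset.sum_le_sum_of_subset_of_nonneg
          (Finset.range_subset_range.2 (Nat.le_mul_of_pos_right n hn₀pos))
          fun _ _ _ => norm_nonneg _
    _ = ∑ j ∈ Finset.range n, ∑ i ∈ Finset.range n₀, ‖(T ^ (j * n₀ + i)) x‖ :=
        Finset.sum_range_mul_eq _ _ _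
    _ ≤ ∑ j ∈ Finset.range n, ∑ i ∈ Finset.range n₀, (1 / 2) ^ j * ‖x‖ := by
        gcongr with j _ i _
        rw [add_comm, pow_add, mul_apply_eq_comp]
        exact (h.norm_pow_apply_le _ _).trans (hstep j)
    _ = n₀ * ((∑ j ∈ Finset.range n, (1 / 2 : ℝ) ^ j) * ‖x‖) := by
        simp only [Finset.sum_const, Finset.card_range, nsmul_eq_mul, ← Finset.mul_sum,
          ← Finset.sum_mul]
    _ ≤ n₀ * (2 * ‖x‖) := by
        gcongr
        exact sum_geometric_two_le n

end IsErgodic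

/-! ### Correlations and the asymptotic variance -/

/-- The operator `shiftObs n l Q`, extended by zero to the values of `l` for which `Q` does not fit
on the units `l + 1, …, l + k`. -/
def localObs {κ k : ℕ} (n : ℕ) (Q : UnitAlg κ k) (l : ℕ) : UnitAlg κ n :=
  if h : l + k ≤ n then shiftObs n l h Q else 0

section LocalObs

variable {κ k : ℕ}

theorem localObs_of_le {n l : ℕ} (h : l + k ≤ n) (Q : UnitAlg κ k) :
    localObs n Q l = shiftObs n l h Q := dif_pos h

theorem localObs_of_not_le {n l : ℕ} (h : ¬ l + k ≤ n) (Q : UnitAlg κ k) :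
    localObs n Q l = 0 := dif_neg h

theorem norm_localObs_le (n : ℕ) (Q : UnitAlg κ k) (l : ℕ) : ‖localObs n Q l‖ ≤ ‖Q‖ := by
  by_cases h : l + k ≤ n
  · rw [localObs_of_le h]; exact norm_shiftObs_le n l h Q
  · rw [localObs_of_not_le h, norm_zero]; exact norm_nonneg _

theorem localObs_isHermitian (n : ℕ) {Q : UnitAlg κ k} (hQ : Q.IsHermitian) (l : ℕ) :
    (localObs n Q l).IsHermitian := by
  by_cases h : l + k ≤ n
  · rw [localObs_of_le h]; exact shiftObs_isHermitian n l h hQ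
  · rw [localObs_of_not_le h]; exact Matrix.isHermitian_zero

theorem commute_localObs (n : ℕ) (Q : UnitAlg κ k) {l l' : ℕ} (h : l + k ≤ l') :
    Commute (localObs n Q l) (localObs n Q l') := by
  by_cases h' : l' + k ≤ n
  · rw [localObs_of_le h', localObs_of_le (show l + k ≤ n by omega)]
    exact commute_shiftObs n l l' h h' Q Q
  · rw [localObs_of_not_le h']; exact Commute.zero_right _

theorem sum_isHermitian {ι α : Type*} (s : Finset α) {A : α → Matrix ι ι ℂ}
    (h : ∀ i ∈ s, (A i).IsHermitian) : (∑ i ∈ s, A i).IsHermitian :=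
  isSelfAdjoint_sum s h

theorem timeAverage_sub_smul_one (n : ℕ) (hn : k ≤ n) (Q : UnitAlg κ k) (m : ℝ) :
    timeAverage n Q - m • 1 = (((n + 1 - k : ℕ) : ℝ)⁻¹) •
      ∑ l ∈ Finset.range (n + 1 - k), localObs n (Q - m • 1) l := by
  have h1 : ∀ l : Fin (n + 1 - k), localObs n (Q - m • 1) l =
      shiftObs n l (by omega) Q - m • (1 : UnitAlg κ n) := fun l => by
    rw [localObs_of_le (by omega), shiftObs_sub_smul_one]
  rw [← Fin.sum_univ_eq_sum_range (fun l => localObs n (Q - m • 1) l)]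
  simp only [h1]
  rw [Finset.sum_sub_distrib, Finset.sum_const, Finset.card_univ, Fintype.card_fin, smul_sub,
    timeAverage, ← Nat.cast_smul_eq_nsmul ℝ, smul_smul (_⁻¹), inv_mul_cancel₀, one_smul]
  have : 0 < n + 1 - k := by omega
  positivity

theorem QMC.transfer_localObs {d : ℕ} (M : QMC d κ) {n l : ℕ} (hl : l + k ≤ n) (Q : UnitAlg κ k) :
    M.transfer n (localObs n Q l) = M.heis ^ l * M.transfer k Q * M.heis ^ (n - (l + k)) := by
  rw [localObs_of_le hl, M.transfer_shiftObs]

theorem QMC.transfer_localObs_mul {d : ℕ} (M : QMC d κ) (n l l' j : ℕ) (hl' : l' = l + k + j)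
    (hn : l' + k ≤ n) (Q R : UnitAlg κ k) :
    M.transfer n (localObs n Q l * localObs n R l') =
      M.heis ^ l * M.transfer k Q * (M.heis ^ j * M.transfer k R * M.heis ^ (n - (l' + k))) := by
  subst hl'
  rw [localObs_of_le (by omega), localObs_of_le hn, M.transfer_shiftObs_mul n l j hn]

end LocalObs

namespace IrreducibleQMC

variable {d κ k : ℕ}

/-- The observable `Q` centred at its stationary mean. -/
noncomputable def centred (M : IrreducibleQMC d κ) (Q : UnitAlg κ k) : UnitAlg κ k :=
  Q - M.mean Q • 1

theorem centred_isHermitian (M : IrreducibleQMC d κ) {Q : UnitAlg κ k} (hQ : Q.IsHermitian) :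
    (M.centred Q).IsHermitian :=
  IsSelfAdjoint.sub hQ (IsSelfAdjoint.smul (IsSelfAdjoint.all _) (IsSelfAdjoint.one _))

theorem expect_stationaryOutput (M : IrreducibleQMC d κ) (n : ℕ) (A : UnitAlg κ n) :
    (M.stationaryOutput n).expect A = M.statFun (M.transfer n A 1) :=
  M.expect_output n M.stationaryState A

theorem statFun_transfer_centred (M : IrreducibleQMC d κ) {Q : UnitAlg κ k}
    (hQ : Q.IsHermitian) : M.statFun (M.transfer k (M.centred Q) 1) = 0 := by
  have him : ((M.stationaryOutput k).expect Q).im = 0 := by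
    have h := (M.stationaryOutput k).expect_conjTranspose Q
    rw [hQ.eq] at h
    exact Complex.conj_eq_iff_im.1 h.symm
  have hm : (M.stationaryOutput k).expect Q = (M.mean Q : ℂ) := Complex.ext rfl (by simpa using him)
  rw [← expect_stationaryOutput, centred, map_sub, hm, ← Complex.coe_smul, map_smul,
    DensityMatrix.expect_one, smul_eq_mul, mul_one, sub_self]

theorem expect_mul_re_comm {ι : Type} [Fintype ι] [DecidableEq ι] (ρ : DensityMatrix ι)
    {A B : Matrix ι ι ℂ} (hA : A.IsHermitian) (hB : B.IsHermitian) :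
    (ρ.expect (B * A)).re = (ρ.expect (A * B)).re := by
  have h := ρ.expect_conjTranspose (A * B)
  rw [Matrix.conjTranspose_mul, hA.eq, hB.eq] at h
  rw [h]
  exact Complex.conj_re _

/-- Symmetrisation only takes a real part: for Hermitian A and B the expectations of AB and BA are
complex conjugates. -/
theorem correlation_eq (M : IrreducibleQMC d κ) {Q : UnitAlg κ k} (hQ : Q.IsHermitian) (a : ℕ) :
    M.correlation Q a = (M.statFun (M.transfer (a + k)
      (shiftObs (a + k) 0 (by omega) (M.centred Q) *
        shiftObs (a + k) a le_rfl (M.centred Q)) 1)).re := by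
  rw [← expect_stationaryOutput, correlation]
  have h0 := shiftObs_isHermitian (a + k) 0 (by omega) (M.centred_isHermitian hQ)
  have ha := shiftObs_isHermitian (a + k) a le_rfl (M.centred_isHermitian hQ)
  rw [← shiftObs_sub_smul_one, ← shiftObs_sub_smul_one]
  change ((M.stationaryOutput (a + k)).expect (symProd (shiftObs (a + k) 0 _ (M.centred Q))
    (shiftObs (a + k) a _ (M.centred Q)))).re = _
  rw [symProd, map_smul, map_add, smul_eq_mul, show (1 / 2 : ℂ) = ((1 / 2 : ℝ) : ℂ) by simp,
    Complex.re_ofReal_mul, Complex.add_re, expect_mul_re_comm _ h0 ha]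
  ring

/-- From lag k on the two translates do not overlap, and the correlation becomes a matrix
coefficient of a power of the transition operator. -/
theorem correlation_add (M : IrreducibleQMC d κ) {Q : UnitAlg κ k} (hQ : Q.IsHermitian) (a : ℕ) :
    M.correlation Q (k + a) = (M.statFun (M.transfer k (M.centred Q)
      ((M.heis ^ a) (M.transfer k (M.centred Q) 1)))).re := by
  rw [correlation_eq M hQ]
  rw [← localObs_of_le, ← localObs_of_le,
    M.transfer_localObs_mul (k + a + k) 0 (k + a) a (by omega) le_rfl, Nat.sub_self, pow_zero,
    mul_one, one_mul, mul_apply_eq_comp, mul_apply_eq_comp]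

/-- Stationarity: the units before are absorbed by invariance of the state, the units after by
invariance of 1. -/
theorem expect_localObs_mul (M : IrreducibleQMC d κ) {Q : UnitAlg κ k} (hQ : Q.IsHermitian)
    (n l a : ℕ) (hn : l + a + k ≤ n) :
    ((M.stationaryOutput n).expect
      (localObs n (M.centred Q) l * localObs n (M.centred Q) (l + a))).re = M.correlation Q a := by
  obtain ⟨r, rfl⟩ := Nat.exists_eq_add_of_le (show l + (a + k) ≤ n by omega)
  rw [localObs_of_le (by omega), localObs_of_le (by omega), correlation_eq M hQ]
  have e1 := shiftObs_add_eq_tensLeft (l + (a + k)) r l (by omega) (M.centred Q)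
  have e2 := shiftObs_add_eq_tensLeft (l + (a + k)) r (l + a) (by omega) (M.centred Q)
  have e3 : shiftObs (l + (a + k)) l (by omega) (M.centred Q) = _ := shiftObs_add_eq_tensRight l (a + k) 0 (by omega) (M.centred Q)
  have e4 := shiftObs_add_eq_tensRight l (a + k) a (by omega) (M.centred Q)
  rw [e1, e2, e3, e4, ← map_mul, ← map_mul, tensLeft_apply, tensRight_apply,
    expect_stationaryOutput, M.transfer_tens, M.transfer_tens, M.transfer_one, M.transfer_one,
    mul_apply_eq_comp, mul_apply_eq_comp, M.isErgodic_heis.pow_unit, M.isErgodic_heis.state_pow]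

/-- Appending translate number N adds c_0 plus twice its correlations with the earlier ones, which
is S_N. Thus the Cesàro means of the S_j are normalised variances. -/
theorem norm_sq_sum_localObs (M : IrreducibleQMC d κ) {Q : UnitAlg κ k} (hQ : Q.IsHermitian)
    {n : ℕ} {L : UnitAlg κ n →ₗ[ℂ] EuclideanSpace ℂ ((Fin n → Fin κ) × (Fin n → Fin κ))}
    (hL : ∀ A B, inner ℂ (L A) (L B) = (M.stationaryOutput n).expect (Aᴴ * B)) (N : ℕ)
    (hN : N + k ≤ n + 1) :
    ‖∑ l ∈ Finset.range N, L (localObs n (M.centred Q) l)‖ ^ 2 =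
      ∑ j ∈ Finset.range N, M.variancePartialSum Q j := by
  have hre : ∀ l a, l + a + k ≤ n → RCLike.re (inner ℂ (L (localObs n (M.centred Q) l))
      (L (localObs n (M.centred Q) (l + a)))) = M.correlation Q a := fun l a h => by
    rw [hL, (localObs_isHermitian n (M.centred_isHermitian hQ) l).eq]
    exact M.expect_localObs_mul hQ n l a h
  induction N with
  | zero => simp
  | succ N ih =>
    rw [Finset.sum_range_succ, norm_add_sq (𝕜 := ℂ), ih (by omega), Finset.sum_range_succ, add_assoc,
      sum_inner, map_sum]
    have h1 : ∑ l ∈ Finset.range N, RCLike.re (inner ℂ (L (localObs n (M.centred Q) l))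
        (L (localObs n (M.centred Q) N))) = ∑ l ∈ Finset.range N, M.correlation Q (l + 1) := by
      rw [← Finset.sum_range_reflect (fun l => M.correlation Q (l + 1))]
      refine Finset.sum_congr rfl fun l hl => ?_
      have hl' := Finset.mem_range.1 hl
      rw [← hre l (N - 1 - l + 1) (by omega)]
      congr 5
      omega
    have h2 : ‖L (localObs n (M.centred Q) N)‖ ^ 2 = M.correlation Q 0 := by
      rw [← hre N 0 (by omega), add_zero, inner_self_eq_norm_sq]
    rw [h1, h2, variancePartialSum]
    ring

theorem varianceCesaroMean_nonneg (M : IrreducibleQMC d κ) {Q : UnitAlg κ k}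
    (hQ : Q.IsHermitian) (N : ℕ) : 0 ≤ M.varianceCesaroMean Q N := by
  obtain ⟨L, hL⟩ := (M.stationaryOutput (N + k)).exists_gns
  rw [varianceCesaroMean, ← M.norm_sq_sum_localObs hQ hL N (by omega)]
  positivity

/-- With G = h - T h the correlations sum to S_(k-1+j) = S_(k-1) + 2 Re f(h - T^j h). The term T^j h
may oscillate, but solving h = g - T g as well bounds its sums, which is enough for Cesàro
convergence. -/
theorem exists_tendsto_varianceCesaroMean (M : IrreducibleQMC d κ) (hk : 0 < k) {Q : UnitAlg κ k}
    (hQ : Q.IsHermitian) : ∃ s, Tendsto (M.varianceCesaroMean Q) atTop (𝓝 s) := by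
  have hE := M.isErgodic_heis
  set G := M.transfer k (M.centred Q) 1 with hG
  have hG0 : M.statFun G = 0 := M.statFun_transfer_centred hQ
  set f : Matrix (Fin d) (Fin d) ℂ →L[ℂ] ℂ := M.statFun ∘L M.transfer k (M.centred Q) with hf
  obtain ⟨C, hC0, hC⟩ := hE.exists_sub_map_eq
  obtain ⟨h, hh0, hh, -⟩ := hC G hG0
  obtain ⟨g, -, hg, hgC⟩ := hC h hh0
  have hsum : ∀ j, ∑ i ∈ Finset.range j, (M.heis ^ i) G = h - (M.heis ^ j) h := by
    intro j
    induction j with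
    | zero => simp
    | succ j ih =>
      rw [Finset.sum_range_succ, ih, ← hh, map_sub, ← mul_apply_eq_comp, ← pow_succ]
      abel
  have hps : ∀ j, M.variancePartialSum Q (k - 1 + j) =
      M.variancePartialSum Q (k - 1) + 2 * (f (h - (M.heis ^ j) h)).re := by
    intro j
    have h1 : ∀ i, M.correlation Q (k - 1 + i + 1) = (f ((M.heis ^ i) G)).re := fun i => by
      rw [show k - 1 + i + 1 = k + i by omega, M.correlation_add hQ]
      rfl
    rw [variancePartialSum, variancePartialSum, Finset.sum_range_add]
    simp only [h1]
    rw [← Complex.re_sum, ← map_sum, hsum]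
    ring
  refine ⟨M.variancePartialSum Q (k - 1) + 2 * (f h).re,
    tendsto_cesaro_of_bounded_sum (K := 2 * (‖f‖ * (2 * C * ‖h‖))) (m := k - 1) fun N => ?_⟩
  have h2 : ∑ j ∈ Finset.range N, (M.variancePartialSum Q (k - 1 + j) -
      (M.variancePartialSum Q (k - 1) + 2 * (f h).re)) =
      -(2 * (f (∑ j ∈ Finset.range N, (M.heis ^ (1 * j)) h)).re) := by
    rw [map_sum, Complex.re_sum, Finset.mul_sum, ← Finset.sum_neg_distrib]
    refine Finset.sum_congr rfl fun j _ => ?_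
    rw [hps, map_sub, Complex.sub_re, one_mul]
    ring
  rw [h2, abs_neg, abs_mul, abs_two]
  gcongr
  refine (Complex.abs_re_le_norm _).trans ((f.le_opNorm _).trans ?_)
  gcongr
  exact hE.norm_sum_pow_le (p := 1) (by rwa [pow_one]) hgC N

theorem tendsto_varianceCesaroMean (M : IrreducibleQMC d κ) (hk : 0 < k) {Q : UnitAlg κ k}
    (hQ : Q.IsHermitian) :
    Tendsto (M.varianceCesaroMean Q) atTop (𝓝 (M.asymptoticVariance Q)) :=
  tendsto_nhds_limUnder (M.exists_tendsto_varianceCesaroMean hk hQ)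

/-- Primitivity concerns states in the Schrödinger picture. Positive matrices span all matrices, so
duality gives convergence of every tr(σ T^n X), in particular of the entries. -/
theorem tendsto_heis_pow (M : IrreducibleQMC d κ) (hM : M.IsPrimitive)
    (X : Matrix (Fin d) (Fin d) ℂ) :
    Tendsto (fun n : ℕ => (M.heis ^ n) X) atTop (𝓝 (M.statFun X • 1)) := by
  have hσ : ∀ σ : Matrix (Fin d) (Fin d) ℂ, Tendsto (fun n : ℕ => (σ * (M.heis ^ n) X).trace) atTop
      (𝓝 (σ.trace * M.statFun X)) := by
    intro σ
    have hmem : σ ∈ Submodule.span ℂ {A : Matrix (Fin d) (Fin d) ℂ | 0 ≤ A} := by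
      rw [CStarAlgebra.span_nonneg]; trivial
    induction hmem using Submodule.span_induction with
    | mem σ hσ =>
      have hpos : σ.PosSemidef := Matrix.nonneg_iff_posSemidef.1 hσ
      by_cases h0 : σ = 0
      · simp [h0]
      have ht : σ.trace ≠ 0 := fun h => h0 (hpos.trace_eq_zero_iff.1 h)
      let ρ : DensityMatrix (Fin d) := ⟨σ.trace⁻¹ • σ, hpos.smul (by
        have := hpos.trace_nonneg; positivity), by
          rw [Matrix.trace_smul, smul_eq_mul, inv_mul_cancel₀ ht]⟩
      have h1 : Tendsto (fun n : ℕ => (M.channel^[n] ρ.mat * X).trace) atTop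
          (𝓝 ((M.stationaryState.mat * X).trace)) := by
        have hc : Continuous fun A : Matrix (Fin d) (Fin d) ℂ => (A * X).trace := by fun_prop
        exact (hc.tendsto _).comp (hM ρ)
      refine (h1.const_mul σ.trace).congr fun n => ?_
      rw [← M.trace_mul_heis_pow, ← smul_eq_mul, ← Matrix.trace_smul, ← Matrix.smul_mul, smul_smul,
        mul_inv_cancel₀ ht, one_smul]
    | zero => simp
    | add σ τ _ _ h1 h2 =>
      simp only [Matrix.trace_add, add_mul]
      exact h1.add h2
    | smul c σ _ h1 =>
      simp only [Matrix.smul_mul, Matrix.trace_smul, smul_eq_mul, mul_assoc]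
      exact h1.const_mul c
  refine tendsto_pi_nhds.2 fun i => tendsto_pi_nhds.2 fun j => ?_
  have h := hσ (Matrix.single j i 1)
  simp only [Matrix.trace_single_mul, one_smul] at h
  convert h using 2
  by_cases hij : i = j
  · simp [hij]
  · simp [hij, Matrix.trace_single_eq_of_ne _ _ _ (Ne.symm hij)]

theorem summable_correlation (M : IrreducibleQMC d κ) (hM : M.IsPrimitive) {Q : UnitAlg κ k}
    (hQ : Q.IsHermitian) : Summable (M.correlation Q) := by
  have hE := M.isErgodic_heis
  have hs := hE.summable_norm_pow (M.tendsto_heis_pow hM) (M.statFun_transfer_centred hQ)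
  set f : Matrix (Fin d) (Fin d) ℂ →L[ℂ] ℂ := M.statFun ∘L M.transfer k (M.centred Q) with hf
  rw [← summable_nat_add_iff k]
  refine Summable.of_norm_bounded (hs.mul_left ‖f‖) fun a => ?_
  rw [add_comm, M.correlation_add hQ, Real.norm_eq_abs]
  exact (Complex.abs_re_le_norm _).trans (f.le_opNorm _)

end IrreducibleQMC

/-! ### Mean-square bounds and the law of large numbers -/

/-- Prepending v_j to the tail costs at most K + 2K. Each vector is paired with the whole later tail
because such sums will be bounded by telescoping, not term by term. -/
theorem norm_sq_sum_range_le {H : Type*} [NormedAddCommGroup H] [InnerProductSpace ℂ H]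
    {v : ℕ → H} {K : ℝ} {J : ℕ} (hv : ∀ j < J, ‖v j‖ ^ 2 ≤ K)
    (hK : ∀ j < J, ‖(inner ℂ (v j) (∑ i ∈ Finset.Ico (j + 1) J, v i) : ℂ)‖ ≤ K) :
    ‖∑ j ∈ Finset.range J, v j‖ ^ 2 ≤ 3 * K * J := by
  have h : ∀ m ≤ J, ‖∑ j ∈ Finset.Ico (J - m) J, v j‖ ^ 2 ≤ 3 * K * m := by
    intro m
    induction m with
    | zero => simp
    | succ m ih =>
      intro hm
      have h1 : J - (m + 1) + 1 = J - m := by omega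
      have h2 := hK (J - (m + 1)) (by omega)
      rw [Finset.sum_eq_sum_Ico_succ_bot (by omega), norm_add_sq (𝕜 := ℂ)]
      have h3 := (RCLike.re_le_norm (K := ℂ) _).trans h2
      have h4 := ih (by omega)
      rw [← h1] at h4
      have h5 := hv (J - (m + 1)) (by omega)
      push_cast
      linarith
  simpa using h J le_rfl

theorem exp_I_smul_smul_one {n : Type} [Fintype n] [DecidableEq n] (c : ℝ) :
    NormedSpace.exp (Complex.I • (c • (1 : Matrix n n ℂ))) =
      Complex.exp (c * Complex.I) • (1 : Matrix n n ℂ) := by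
  have h := NormedSpace.algebraMap_exp_comm (𝕂 := ℂ) (𝔸 := Matrix n n ℂ) (c * Complex.I)
  rw [← Complex.exp_eq_exp_ℂ, Algebra.algebraMap_eq_smul_one, Algebra.algebraMap_eq_smul_one] at h
  rw [h, mul_comm, mul_smul, Complex.coe_smul]

namespace IrreducibleQMC

variable {d κ k : ℕ}

/-- The next k translates are estimated crudely. All later ones are disjoint from the given
translate, and their sum involves Σ T^(pi) G, which the resolvent of T^p bounds. The spacing p
enters only through C. -/
theorem norm_sq_sum_spaced_le (M : IrreducibleQMC d κ) {Q : UnitAlg κ k} (hQ : Q.IsHermitian)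
    {p : ℕ} (hp : 0 < p) {C : ℝ} (hC0 : 0 ≤ C)
    (hC : ∀ x, M.statFun x = 0 → ∃ y, M.statFun y = 0 ∧ y - (M.heis ^ p) y = x ∧ ‖y‖ ≤ C * ‖x‖)
    (ρ : DensityMatrix (Fin d)) {n : ℕ}
    {L : UnitAlg κ n →ₗ[ℂ] EuclideanSpace ℂ ((Fin n → Fin κ) × (Fin n → Fin κ))}
    (hL : ∀ A B, inner ℂ (L A) (L B) = (M.output n ρ).expect (Aᴴ * B)) (s J : ℕ)
    (hJ : ∀ j < J, s + p * j + k ≤ n) :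
    ‖∑ j ∈ Finset.range J, L (localObs n (M.centred Q) (s + p * j))‖ ^ 2 ≤
      3 * ((1 + k + 2 * C) * ‖M.centred Q‖ ^ 2) * J := by
  set q := M.centred Q with hq
  have hnv : ∀ l, ‖L (localObs n q l)‖ ≤ ‖q‖ := fun l =>
    (DensityMatrix.norm_gns_le hL _).trans (norm_localObs_le n q l)
  refine norm_sq_sum_range_le (fun j _ => ?_) fun j hj => ?_
  · have h1 : ‖L (localObs n q (s + p * j))‖ ^ 2 ≤ ‖q‖ ^ 2 := by gcongr; exact hnv _
    nlinarith [sq_nonneg ‖q‖, mul_nonneg hC0 (sq_nonneg ‖q‖),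
      mul_nonneg (Nat.cast_nonneg (α := ℝ) k) (sq_nonneg ‖q‖)]
  set m := min (j + 1 + k) J with hm
  have hnear : ‖(inner ℂ (L (localObs n q (s + p * j)))
      (∑ i ∈ Finset.Ico (j + 1) m, L (localObs n q (s + p * i))) : ℂ)‖ ≤ k * ‖q‖ ^ 2 := by
    have hcard : ((Finset.Ico (j + 1) m).card : ℝ) ≤ k := by
      rw [Nat.card_Ico]; exact_mod_cast (by omega : m - (j + 1) ≤ k)
    calc _ ≤ ‖L (localObs n q (s + p * j))‖ *
          ‖∑ i ∈ Finset.Ico (j + 1) m, L (localObs n q (s + p * i))‖ := norm_inner_le_norm _ _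
      _ ≤ ‖q‖ * ((Finset.Ico (j + 1) m).card • ‖q‖) := by
        gcongr
        · exact hnv _
        · exact norm_sum_le_of_le _ (fun i _ => hnv _) |>.trans_eq (by rw [Finset.sum_const])
      _ ≤ ‖q‖ * (k * ‖q‖) := by rw [nsmul_eq_mul]; gcongr
      _ = _ := by ring
  have hfar : ‖(inner ℂ (L (localObs n q (s + p * j)))
      (∑ i ∈ Finset.Ico m J, L (localObs n q (s + p * i))) : ℂ)‖ ≤ 2 * C * ‖q‖ ^ 2 := by
    rcases le_or_gt J (j + 1 + k) with hle | hlt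
    · rw [hm, min_eq_right hle]
      simp only [Finset.Ico_self, Finset.sum_empty, inner_zero_right, norm_zero]
      positivity
    rw [hm, min_eq_left hlt.le, Finset.sum_Ico_eq_sum_range, inner_sum]
    set G := M.transfer k q 1 with hG
    -- The number of units between translate j and the first far translate j + 1 + k; it is not
    -- truncated since p ≥ 1.
    set e := p + p * k - k with he
    have hterm : ∀ i ∈ Finset.range (J - (j + 1 + k)),
        (inner ℂ (L (localObs n q (s + p * j))) (L (localObs n q (s + p * (j + 1 + k + i)))) : ℂ) =
        ρ.expect ((M.heis ^ (s + p * j)) (M.transfer k q ((M.heis ^ e) ((M.heis ^ (p * i)) G)))) := by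
      intro i hi
      have hi' := Finset.mem_range.1 hi
      have hpk : k ≤ p * k := Nat.le_mul_of_pos_left k hp
      have hl' : s + p * (j + 1 + k + i) = s + p * j + k + (e + p * i) := by
        have : p * (j + 1 + k + i) = p * j + p + p * k + p * i := by ring
        omega
      rw [hL, (localObs_isHermitian n (M.centred_isHermitian hQ) _).eq, M.expect_output,
        M.transfer_localObs_mul n _ _ _ hl' (hJ _ (by omega)), pow_add M.heis e]
      simp only [mul_apply_eq_comp]
      rw [M.heis_pow_one]
    rw [Finset.sum_congr rfl hterm]
    simp only [← map_sum]
    obtain ⟨y, -, hy, hyC⟩ := hC G (M.statFun_transfer_centred hQ)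
    have hE := M.isErgodic_heis
    have hGn : ‖G‖ ≤ ‖q‖ := by
      refine ((M.transfer k q).le_of_opNorm_le (M.norm_transfer_le k q) 1).trans ?_
      have : ‖(1 : Matrix (Fin d) (Fin d) ℂ)‖ = 1 := by
        have := M.nonempty_fin
        exact CStarRing.norm_one
      rw [this, mul_one]
    calc _ ≤ ‖(M.heis ^ (s + p * j)) (M.transfer k q ((M.heis ^ e)
            (∑ i ∈ Finset.range (J - (j + 1 + k)), (M.heis ^ (p * i)) G)))‖ := ρ.norm_expect_le _
      _ ≤ ‖M.transfer k q ((M.heis ^ e)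
            (∑ i ∈ Finset.range (J - (j + 1 + k)), (M.heis ^ (p * i)) G))‖ :=
          hE.norm_pow_apply_le _ _
      _ ≤ ‖q‖ * ‖(M.heis ^ e) (∑ i ∈ Finset.range (J - (j + 1 + k)), (M.heis ^ (p * i)) G)‖ :=
          ContinuousLinearMap.le_of_opNorm_le _ (M.norm_transfer_le k q) _
      _ ≤ ‖q‖ * (2 * C * ‖G‖) := by
          gcongr
          exact (hE.norm_pow_apply_le _ _).trans (hE.norm_sum_pow_le hy hyC _)
      _ ≤ ‖q‖ * (2 * C * ‖q‖) := by gcongr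
      _ = _ := by ring
  rw [← Finset.sum_Ico_consecutive _ (show j + 1 ≤ m by omega) (show m ≤ J by omega),
    inner_add_right]
  refine (norm_add_le _ _).trans ?_
  nlinarith [sq_nonneg ‖q‖]

/-- The law of large numbers. -/
theorem tendsto_averageLaw (M : IrreducibleQMC d κ) {Q : UnitAlg κ k} (hQ : Q.IsHermitian)
    (ρ : DensityMatrix (Fin d)) :
    Tendsto (M.averageLaw ρ Q hQ) atTop (𝓝 ⟨Measure.dirac (M.mean Q), inferInstance⟩) := by
  refine ProbabilityMeasure.tendsto_iff_tendsto_charFun.2 fun t => ?_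
  obtain ⟨C, hC0, hC⟩ := M.isErgodic_heis.exists_sub_map_eq
  set K : ℝ := 3 * ((1 + k + 2 * C) * ‖M.centred Q‖ ^ 2) with hK
  have hlim : charFun (Measure.dirac (M.mean Q)) t = Complex.exp ((t * M.mean Q : ℝ) * Complex.I) := by
    rw [charFun_dirac]
    simp [mul_comm]
  change Tendsto _ _ (𝓝 (charFun (Measure.dirac (M.mean Q)) t))
  rw [hlim, tendsto_iff_norm_sub_tendsto_zero]
  have hdecay : Tendsto (fun n : ℕ => |t| * √(K * ((n + 1 - k : ℕ) : ℝ)⁻¹)) atTop (𝓝 0) := by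
    have h1 : Tendsto (fun n : ℕ => ((n + 1 - k : ℕ) : ℝ)⁻¹) atTop (𝓝 0) :=
      (tendsto_inv_atTop_zero (𝕜 := ℝ)).comp (tendsto_natCast_atTop_atTop.comp
        ((tendsto_sub_atTop_nat k).comp (tendsto_add_atTop_nat 1)))
    have h2 := ((Real.continuous_sqrt.tendsto _).comp (h1.const_mul K)).const_mul |t|
    simpa using h2
  refine squeeze_zero' (Eventually.of_forall fun _ => norm_nonneg _) ?_ hdecay
  filter_upwards [eventually_ge_atTop k] with n hn
  obtain ⟨L, hL⟩ := (M.output n ρ).exists_gns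
  have hN : 0 < n + 1 - k := by omega
  -- The spaced bound with p = 1 makes the mean square of the centred average O(1/N).
  have hLR : ‖L (timeAverage n Q - M.mean Q • 1)‖ ≤ √(K * ((n + 1 - k : ℕ) : ℝ)⁻¹) := by
    have h1 := M.norm_sq_sum_spaced_le hQ one_pos hC0 (by simpa only [pow_one] using hC) ρ hL 0
      (n + 1 - k) (fun j hj => by omega)
    simp only [zero_add, one_mul] at h1
    rw [timeAverage_sub_smul_one n hn, ← Complex.coe_smul, map_smul, map_sum, norm_smul,
      Complex.norm_real, norm_inv, Real.norm_natCast]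
    apply Real.le_sqrt_of_sq_le
    rw [mul_pow]
    calc _ ≤ (((n + 1 - k : ℕ) : ℝ)⁻¹) ^ 2 * (K * ((n + 1 - k : ℕ) : ℝ)) := by gcongr; exact h1
      _ = _ := by field_simp
  have hB : ((t * M.mean Q) • (1 : UnitAlg κ n)).IsHermitian :=
    IsSelfAdjoint.smul (IsSelfAdjoint.all _) (IsSelfAdjoint.one _)
  have hR0 : (timeAverage n Q - M.mean Q • (1 : UnitAlg κ n)).IsHermitian :=
    IsSelfAdjoint.sub (timeAverage_isHermitian n hQ)
      (IsSelfAdjoint.smul (IsSelfAdjoint.all _) (IsSelfAdjoint.one _))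
  have hR : (t • (timeAverage n Q - M.mean Q • (1 : UnitAlg κ n))).IsHermitian :=
    IsSelfAdjoint.smul (IsSelfAdjoint.all _) hR0
  have hcomm : ∀ R : UnitAlg κ n, ((t * M.mean Q) • (1 : UnitAlg κ n)) * R -
      R * ((t * M.mean Q) • (1 : UnitAlg κ n)) = 0 := fun R => by
    rw [smul_mul_assoc, one_mul, mul_smul_comm, mul_one, sub_self]
  -- The main part is the scalar t m · 1, so the commutator error vanishes and only the mean-square
  -- term remains.
  have hmain := DensityMatrix.norm_expect_exp_add_sub_le hL hB hR
  rw [exp_I_smul_smul_one, map_smul, DensityMatrix.expect_one, smul_eq_mul, mul_one,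
    show (t * M.mean Q) • (1 : UnitAlg κ n) + t • (timeAverage n Q - M.mean Q • (1 : UnitAlg κ n)) =
      t • timeAverage n Q by module, hcomm, norm_zero, zero_add] at hmain
  rw [averageLaw, charFun_observableLaw]
  refine hmain.trans ?_
  rw [← Complex.coe_smul, map_smul, norm_smul, Complex.norm_real, Real.norm_eq_abs]
  gcongr

end IrreducibleQMC

/-! ### Decomposition into blocks -/

theorem norm_le_one_of_mem_unitary {n : Type} [Fintype n] [DecidableEq n] {U : Matrix n n ℂ}
    (hU : U ∈ unitary (Matrix n n ℂ)) : ‖U‖ ≤ 1 := by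
  rcases subsingleton_or_nontrivial (Matrix n n ℂ) with hs | hn
  · rw [Subsingleton.elim U 0, norm_zero]; exact zero_le_one
  · exact (CStarRing.norm_of_mem_unitary hU).le

section Blocks

variable {κ k : ℕ}

/-- The sum of all translates of `Q` inside a block of `p` units. -/
def blockObs (p : ℕ) (Q : UnitAlg κ k) : UnitAlg κ p :=
  ∑ i ∈ Finset.range (p + 1 - k), localObs p Q i

/-- The sum over the first `r` consecutive blocks of length `p` of the operators `blockObs p Q`. -/
def blockSum (n p r : ℕ) (Q : UnitAlg κ k) : UnitAlg κ n :=
  ∑ j ∈ Finset.range r, ∑ i ∈ Finset.range (p + 1 - k), localObs n Q (j * p + i)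

/-- The translates of `Q` among the first `N` that do not fit into one of the first `r` blocks. -/
def restSum (n p r N : ℕ) (Q : UnitAlg κ k) : UnitAlg κ n :=
  (∑ i ∈ Finset.range (k - 1), ∑ j ∈ Finset.range r, localObs n Q ((p + 1 - k + i) + p * j)) +
    ∑ i ∈ Finset.range (N - r * p), localObs n Q (r * p + i)

theorem localObs_add_eq_tensLeft (m r : ℕ) {l : ℕ} (hl : l + k ≤ m) (Q : UnitAlg κ k) :
    localObs (m + r) Q l = tensLeft κ m r (localObs m Q l) := by
  rw [localObs_of_le (by omega), localObs_of_le hl, shiftObs_add_eq_tensLeft m r l hl]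

theorem localObs_add_eq_tensRight (m r l : ℕ) (Q : UnitAlg κ k) :
    localObs (m + r) Q (m + l) = tensRight κ m r (localObs r Q l) := by
  by_cases h : l + k ≤ r
  · rw [localObs_of_le (by omega), localObs_of_le h, shiftObs_add_eq_tensRight m r l h]
  · rw [localObs_of_not_le (by omega), localObs_of_not_le h, map_zero]

/-- Translates inside the first block do not touch the remaining units, so the exponential
factorises block by block. -/
theorem blockSum_succ (p r n : ℕ) (hp : k ≤ p) (Q : UnitAlg κ k) :
    blockSum (p + n) p (r + 1) Q =
      tensLeft κ p n (blockObs p Q) + tensRight κ p n (blockSum n p r Q) := by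
  rw [blockSum, Finset.sum_range_succ', blockObs, blockSum, map_sum, map_sum]
  refine (add_comm _ _).trans ?_
  congr 1
  · refine Finset.sum_congr rfl fun i hi => ?_
    have := Finset.mem_range.1 hi
    rw [zero_mul, zero_add, localObs_add_eq_tensLeft p n (by omega)]
  · refine Finset.sum_congr rfl fun j _ => ?_
    rw [map_sum]
    refine Finset.sum_congr rfl fun i _ => ?_
    rw [← localObs_add_eq_tensRight]
    congr 1
    ring

/-- The characteristic function of a sum over blocks is a power of a transfer operator. -/
theorem QMC.transfer_exp_blockSum {d : ℕ} (M : QMC d κ) (p r s n : ℕ) (hn : n = r * p + s)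
    (hp : k ≤ p) (Q : UnitAlg κ k) (c : ℂ) :
    M.transfer n (NormedSpace.exp (c • blockSum n p r Q)) =
      M.transfer p (NormedSpace.exp (c • blockObs p Q)) ^ r * M.heis ^ s := by
  induction r generalizing n with
  | zero =>
    have : n = s := by omega
    subst this
    rw [blockSum, Finset.range_zero, Finset.sum_empty, smul_zero, NormedSpace.exp_zero,
      M.transfer_one, pow_zero, one_mul]
  | succ r ih =>
    obtain rfl : n = p + (r * p + s) := by rw [hn]; ring
    rw [blockSum_succ p r (r * p + s) hp, smul_add, ← map_smul, ← map_smul,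
      exp_tensLeft_add_tensRight, M.transfer_tens, ih _ rfl, pow_succ', mul_assoc]

/-- Of the p translates starting in a block the first p + 1 - k fit inside it and the last k - 1
cross its end. The latter are grouped by offset, so that each group is evenly spaced by p. -/
theorem blockSum_add_restSum (n p r N : ℕ) (hp : k ≤ p) (hk : 0 < k) (hr : r * p ≤ N)
    (Q : UnitAlg κ k) :
    ∑ l ∈ Finset.range N, localObs n Q l = blockSum n p r Q + restSum n p r N Q := by
  obtain ⟨s, rfl⟩ := Nat.exists_eq_add_of_le hr
  rw [Finset.sum_range_add, Finset.sum_range_mul_eq, blockSum, restSum, Nat.add_sub_cancel_left,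
    ← add_assoc]
  congr 1
  rw [Finset.sum_comm (s := Finset.range (k - 1)), ← Finset.sum_add_distrib]
  refine Finset.sum_congr rfl fun j _ => ?_
  have hpk : p = (p + 1 - k) + (k - 1) := by omega
  conv_lhs => rw [show Finset.range p = Finset.range ((p + 1 - k) + (k - 1)) by rw [← hpk]]
  rw [Finset.sum_range_add]
  congr 1
  refine Finset.sum_congr rfl fun i _ => ?_
  congr 1
  ring

theorem blockObs_isHermitian (p : ℕ) {Q : UnitAlg κ k} (hQ : Q.IsHermitian) :
    (blockObs p Q).IsHermitian :=
  sum_isHermitian _ fun _ _ => localObs_isHermitian _ hQ _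

theorem blockSum_isHermitian (n p r : ℕ) {Q : UnitAlg κ k} (hQ : Q.IsHermitian) :
    (blockSum n p r Q).IsHermitian :=
  sum_isHermitian _ fun _ _ => sum_isHermitian _ fun _ _ => localObs_isHermitian _ hQ _

theorem restSum_isHermitian (n p r N : ℕ) {Q : UnitAlg κ k} (hQ : Q.IsHermitian) :
    (restSum n p r N Q).IsHermitian :=
  (sum_isHermitian _ fun _ _ => sum_isHermitian _ fun _ _ => localObs_isHermitian _ hQ _).add
    (sum_isHermitian _ fun _ _ => localObs_isHermitian _ hQ _)

/-- At most 2k translates overlap a given one, each with commutator norm at most 2‖Q‖². The bound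
does not depend on the number of units. -/
theorem sum_norm_commutator_localObs_le (n m l : ℕ) (Q : UnitAlg κ k) :
    ∑ i ∈ Finset.range m, ‖localObs n Q i * localObs n Q l - localObs n Q l * localObs n Q i‖ ≤
      4 * k * ‖Q‖ ^ 2 := by
  have hzero : ∀ i ∈ Finset.range m, i ∉ (Finset.range m).filter (fun i => l < i + k ∧ i < l + k) →
      ‖localObs n Q i * localObs n Q l - localObs n Q l * localObs n Q i‖ = 0 := by
    intro i hi hi'
    have h : i + k ≤ l ∨ l + k ≤ i := by
      by_contra hcon
      exact hi' (Finset.mem_filter.2 ⟨hi, by omega, by omega⟩)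
    rcases h with h | h
    · rw [(commute_localObs n Q h).eq, sub_self, norm_zero]
    · rw [(commute_localObs n Q h).eq, sub_self, norm_zero]
  rw [← Finset.sum_subset (Finset.filter_subset _ _) hzero]
  have hterm : ∀ i, ‖localObs n Q i * localObs n Q l - localObs n Q l * localObs n Q i‖ ≤
      2 * ‖Q‖ ^ 2 := fun i => by
    have h1 : ∀ a b, ‖localObs n Q a * localObs n Q b‖ ≤ ‖Q‖ * ‖Q‖ := fun a b =>
      (norm_mul_le _ _).trans (mul_le_mul (norm_localObs_le n Q a) (norm_localObs_le n Q b)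
        (norm_nonneg _) (norm_nonneg _))
    refine (norm_sub_le _ _).trans ((add_le_add (h1 i l) (h1 l i)).trans_eq (by ring))
  have hcard : (((Finset.range m).filter (fun i => l < i + k ∧ i < l + k)).card : ℝ) ≤ 2 * k := by
    have h : (Finset.range m).filter (fun i => l < i + k ∧ i < l + k) ⊆
        Finset.Ico (l + 1 - k) (l + k) := fun i hi => by
      have := (Finset.mem_filter.1 hi).2
      exact Finset.mem_Ico.2 ⟨by omega, by omega⟩
    have h2 := Finset.card_le_card h
    rw [Nat.card_Ico] at h2
    exact_mod_cast (by omega : _ ≤ 2 * k)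
  refine (Finset.sum_le_card_nsmul _ _ _ fun i _ => hterm i).trans ?_
  rw [nsmul_eq_mul]
  calc _ ≤ (2 * k : ℝ) * (2 * ‖Q‖ ^ 2) := by gcongr
    _ = _ := by ring

theorem norm_commutator_blockSum_localObs_le (n p r l : ℕ) (hk : 0 < k) (Q : UnitAlg κ k) :
    ‖blockSum n p r Q * localObs n Q l - localObs n Q l * blockSum n p r Q‖ ≤
      4 * k * ‖Q‖ ^ 2 := by
  refine le_trans ?_ (sum_norm_commutator_localObs_le n (r * p) l Q)
  rw [Finset.sum_range_mul_eq, blockSum, Finset.sum_mul, Finset.mul_sum, ← Finset.sum_sub_distrib]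
  refine norm_sum_le_of_le _ fun j _ => ?_
  rw [Finset.sum_mul, Finset.mul_sum, ← Finset.sum_sub_distrib]
  refine (norm_sum_le _ _).trans (Finset.sum_le_sum_of_subset_of_nonneg ?_ fun _ _ _ => norm_nonneg _)
  exact Finset.range_subset_range.2 (by omega)

theorem norm_commutator_blockSum_restSum_le (n p r N : ℕ) (hk : 0 < k) (Q : UnitAlg κ k) :
    ‖blockSum n p r Q * restSum n p r N Q - restSum n p r N Q * blockSum n p r Q‖ ≤
      (k * r + (N - r * p : ℕ)) * (4 * k * ‖Q‖ ^ 2) := by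
  set B := blockSum n p r Q
  have hB := fun l => norm_commutator_blockSum_localObs_le n p r l hk Q
  have h1 : ‖B * (∑ i ∈ Finset.range (k - 1), ∑ j ∈ Finset.range r,
        localObs n Q ((p + 1 - k + i) + p * j)) -
      (∑ i ∈ Finset.range (k - 1), ∑ j ∈ Finset.range r,
        localObs n Q ((p + 1 - k + i) + p * j)) * B‖ ≤ (k * r) * (4 * k * ‖Q‖ ^ 2) := by
    rw [Finset.sum_mul, Finset.mul_sum, ← Finset.sum_sub_distrib]
    have h : ∀ i ∈ Finset.range (k - 1), ‖B * (∑ j ∈ Finset.range r,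
        localObs n Q ((p + 1 - k + i) + p * j)) - (∑ j ∈ Finset.range r,
        localObs n Q ((p + 1 - k + i) + p * j)) * B‖ ≤ r * (4 * k * ‖Q‖ ^ 2) := fun i _ => by
      rw [Finset.sum_mul, Finset.mul_sum, ← Finset.sum_sub_distrib]
      refine (norm_sum_le_of_le _ fun j _ => hB _).trans_eq ?_
      rw [Finset.sum_const, Finset.card_range, nsmul_eq_mul]
    refine (norm_sum_le_of_le _ h).trans ?_
    rw [Finset.sum_const, Finset.card_range, nsmul_eq_mul]
    calc _ ≤ (k : ℝ) * (r * (4 * k * ‖Q‖ ^ 2)) := by gcongr; omega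
      _ = _ := by ring
  have h2 : ‖B * (∑ i ∈ Finset.range (N - r * p), localObs n Q (r * p + i)) -
      (∑ i ∈ Finset.range (N - r * p), localObs n Q (r * p + i)) * B‖ ≤
      (N - r * p : ℕ) * (4 * k * ‖Q‖ ^ 2) := by
    rw [Finset.sum_mul, Finset.mul_sum, ← Finset.sum_sub_distrib]
    refine (norm_sum_le_of_le _ fun j _ => hB _).trans_eq ?_
    rw [Finset.sum_const, Finset.card_range, nsmul_eq_mul]
  rw [restSum, mul_add, add_mul, add_sub_add_comm, add_mul]
  exact (norm_add_le _ _).trans (add_le_add h1 h2)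

end Blocks

/-! ### Error of the block approximation -/

namespace IrreducibleQMC

variable {d κ k : ℕ}

/-- Each of the k - 1 straddling families is evenly spaced and contributes order √r; the tail after
the last block is estimated term by term. -/
theorem norm_gns_restSum_le (M : IrreducibleQMC d κ) {Q : UnitAlg κ k} (hQ : Q.IsHermitian)
    {p : ℕ} (hp : 0 < p) {C : ℝ} (hC0 : 0 ≤ C)
    (hC : ∀ x, M.statFun x = 0 → ∃ y, M.statFun y = 0 ∧ y - (M.heis ^ p) y = x ∧ ‖y‖ ≤ C * ‖x‖)
    (ρ : DensityMatrix (Fin d)) {n r N : ℕ} (hN : N + k ≤ n + 1) (hr : r * p ≤ N) (hkp : k ≤ p)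
    {L : UnitAlg κ n →ₗ[ℂ] EuclideanSpace ℂ ((Fin n → Fin κ) × (Fin n → Fin κ))}
    (hL : ∀ A B, inner ℂ (L A) (L B) = (M.output n ρ).expect (Aᴴ * B)) :
    ‖L (restSum n p r N (M.centred Q))‖ ≤
      k * √(3 * ((1 + k + 2 * C) * ‖M.centred Q‖ ^ 2) * r) + (N - r * p : ℕ) * ‖M.centred Q‖ := by
  rw [restSum, map_add]
  refine (norm_add_le _ _).trans (add_le_add ?_ ?_)
  · rw [map_sum]
    have h : ∀ i ∈ Finset.range (k - 1),
        ‖L (∑ j ∈ Finset.range r, localObs n (M.centred Q) ((p + 1 - k + i) + p * j))‖ ≤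
          √(3 * ((1 + k + 2 * C) * ‖M.centred Q‖ ^ 2) * r) := fun i hi => by
      rw [map_sum]
      refine Real.le_sqrt_of_sq_le (M.norm_sq_sum_spaced_le hQ hp hC0 hC ρ hL _ r fun j hj => ?_)
      have h1 := Finset.mem_range.1 hi
      have h2 : p * j + p ≤ r * p := by
        rw [← mul_add_one, mul_comm]; exact Nat.mul_le_mul_right p hj
      omega
    refine (norm_sum_le_of_le _ h).trans ?_
    rw [Finset.sum_const, Finset.card_range, nsmul_eq_mul]
    gcongr
    omega
  · refine (DensityMatrix.norm_gns_le hL _).trans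
      ((norm_sum_le_of_le _ fun i _ => norm_localObs_le n (M.centred Q) _).trans_eq ?_)
    rw [Finset.sum_const, Finset.card_range, nsmul_eq_mul]

/-- Replacing the sum of all translates by the sum over blocks changes the characteristic function
by a term of the order `p ^ (-1 / 2)`. -/
theorem norm_expect_exp_sub_blockSum_le (M : IrreducibleQMC d κ) (hk : 0 < k) {Q : UnitAlg κ k}
    (hQ : Q.IsHermitian) {p : ℕ} (hkp : k ≤ p) {C : ℝ} (hC0 : 0 ≤ C)
    (hC : ∀ x, M.statFun x = 0 → ∃ y, M.statFun y = 0 ∧ y - (M.heis ^ p) y = x ∧ ‖y‖ ≤ C * ‖x‖)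
    (ρ : DensityMatrix (Fin d)) (t : ℝ) {n N : ℕ} (hN : N + k ≤ n + 1) (hpN : p ^ 3 ≤ N) :
    ‖(M.output n ρ).expect (NormedSpace.exp (Complex.I • ((t / √N) •
        ∑ l ∈ Finset.range N, localObs n (M.centred Q) l))) -
      (M.output n ρ).expect (NormedSpace.exp (Complex.I • ((t / √N) •
        blockSum n p (N / p) (M.centred Q))))‖ ≤
    (t ^ 2 * ((k + 1) * (4 * k * ‖M.centred Q‖ ^ 2)) +
      |t| * (k * √(3 * ((1 + k + 2 * C) * ‖M.centred Q‖ ^ 2)) + ‖M.centred Q‖)) / √p := by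
  set q := M.centred Q with hq
  set r := N / p with hr
  have hp0 : 0 < p := by omega
  have hN0 : 0 < N := lt_of_lt_of_le (by positivity) hpN
  have hrp : r * p ≤ N := Nat.div_mul_le_self N p
  have hrest : N - r * p ≤ p := by
    have : r * p + N % p = N := Nat.div_add_mod' N p
    have h2 := Nat.mod_lt N hp0
    omega
  obtain ⟨L, hL⟩ := (M.output n ρ).exists_gns
  have hq' := M.centred_isHermitian hQ
  have hmain := DensityMatrix.norm_expect_exp_add_sub_le hL
    (B := (t / √N) • blockSum n p r q) (R := (t / √N) • restSum n p r N q)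
    (IsSelfAdjoint.smul (IsSelfAdjoint.all _) (blockSum_isHermitian n p r hq'))
    (IsSelfAdjoint.smul (IsSelfAdjoint.all _) (restSum_isHermitian n p r N hq'))
  rw [← smul_add, ← blockSum_add_restSum n p r N hkp hk hrp] at hmain
  refine hmain.trans ?_
  have hNR : (0 : ℝ) < N := by exact_mod_cast hN0
  have hpR : (1 : ℝ) ≤ p := by exact_mod_cast hp0
  have hpNR : (p : ℝ) ^ 3 ≤ N := by exact_mod_cast hpN
  have hrR : (r : ℝ) ≤ N / p := Nat.cast_div_le
  have hrestR : ((N - r * p : ℕ) : ℝ) ≤ p := by exact_mod_cast hrest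
  have hsp : √(p : ℝ) ≤ p := by
    rw [Real.sqrt_le_left (by positivity)]; nlinarith
  have hsp0 : 0 < √(p : ℝ) := Real.sqrt_pos.2 (by linarith)
  have hsN0 : 0 < √(N : ℝ) := Real.sqrt_pos.2 hNR
  -- This is the purpose of p³ ≤ N: the tail has at most p terms, and p ≤ √N/√p makes its normalised
  -- contribution O(p^(-1/2)).
  have hpsN : (p : ℝ) * √p ≤ √N := by
    apply Real.le_sqrt_of_sq_le
    rw [mul_pow, Real.sq_sqrt (by linarith)]
    linarith [hpNR, pow_succ (p : ℝ) 2]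
  rw [add_div]
  refine add_le_add ?_ ?_
  · rw [smul_mul_smul_comm, smul_mul_smul_comm, ← smul_sub, norm_smul, Real.norm_eq_abs,
      abs_mul_self]
    have e1 : t / √N * (t / √N) = t ^ 2 / N := by
      rw [div_mul_div_comm, Real.mul_self_sqrt hNR.le, sq]
    rw [e1]
    calc t ^ 2 / N * ‖blockSum n p r q * restSum n p r N q - restSum n p r N q * blockSum n p r q‖
        ≤ t ^ 2 / N * ((k * r + (N - r * p : ℕ)) * (4 * k * ‖q‖ ^ 2)) := by
          gcongr; exact norm_commutator_blockSum_restSum_le n p r N hk q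
      _ ≤ t ^ 2 / N * ((k * (N / p) + N / p) * (4 * k * ‖q‖ ^ 2)) := by
          gcongr
          refine hrestR.trans ?_
          rw [le_div_iff₀ (by linarith)]
          nlinarith
      _ = t ^ 2 * ((k + 1) * (4 * k * ‖q‖ ^ 2)) / p := by field_simp
      _ ≤ _ := by gcongr
  · rw [← Complex.coe_smul, map_smul, norm_smul, Complex.norm_real, Real.norm_eq_abs, abs_div,
      abs_of_pos hsN0]
    have h1 := M.norm_gns_restSum_le hQ hp0 hC0 hC ρ hN hrp hkp hL
    set K : ℝ := 3 * ((1 + k + 2 * C) * ‖q‖ ^ 2) with hK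
    have hK0 : 0 ≤ K := by positivity
    calc |t| / √N * ‖L (restSum n p r N q)‖
        ≤ |t| / √N * (k * √(K * r) + (N - r * p : ℕ) * ‖q‖) := by gcongr
      _ ≤ |t| / √N * (k * √(K * (N / p)) + (√N / √p) * ‖q‖) := by
          gcongr
          refine hrestR.trans ?_
          rwa [le_div_iff₀ hsp0]
      _ = _ := by
          rw [Real.sqrt_mul hK0, Real.sqrt_div hNR.le]
          field_simp

end IrreducibleQMC

/-! ### The central limit theorem -/

theorem tendsto_natDiv_mul_div (p : ℕ) (t : ℝ) :
    Tendsto (fun N : ℕ => ((N / p : ℕ) : ℝ) * (t / √N) ^ 2) atTop (𝓝 (t ^ 2 / p)) := by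
  have h := (tendsto_nat_floor_mul_div_atTop (R := ℝ) (a := (p : ℝ)⁻¹) (by positivity)).comp
    (tendsto_natCast_atTop_atTop (R := ℝ))
  have h2 := h.mul_const (t ^ 2)
  rw [← div_eq_inv_mul] at h2
  refine h2.congr fun N => ?_
  simp only [Function.comp_apply]
  rw [← div_eq_inv_mul, Nat.floor_div_natCast, Nat.floor_natCast, div_pow,
    Real.sq_sqrt (Nat.cast_nonneg N)]
  ring

namespace IrreducibleQMC

variable {d κ k : ℕ}

/-- The perturbation theorem with S = T^p, ε = t/√N and r = ⌊N/p⌋ blocks, so that r ε² → t²/p. The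
Taylor remainder is O(ε³) per block, and the units after the last block contribute a power of T
applied to 1. -/
theorem tendsto_expect_exp_blockSum (M : IrreducibleQMC d κ) (hk : 0 < k) {Q : UnitAlg κ k}
    (hQ : Q.IsHermitian) {p : ℕ} (hkp : k ≤ p) {v w : Matrix (Fin d) (Fin d) ℂ} {l : ℂ}
    (hv : v - (M.heis ^ p) v = (Complex.I • M.transfer p (blockObs p (M.centred Q))) 1)
    (hw : w - (M.heis ^ p) w = (Complex.I • M.transfer p (blockObs p (M.centred Q))) v +
      ((-(1 / 2) : ℂ) • M.transfer p (blockObs p (M.centred Q) ^ 2)) 1 - l • 1)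
    (ρ : DensityMatrix (Fin d)) (t : ℝ) :
    Tendsto (fun n : ℕ => (M.output n ρ).expect (NormedSpace.exp (Complex.I •
        ((t / √((n + 1 - k : ℕ) : ℝ)) • blockSum n p ((n + 1 - k) / p) (M.centred Q))))) atTop
      (𝓝 (Complex.exp ((t ^ 2 / p : ℝ) * l))) := by
  set b := blockObs p (M.centred Q) with hb
  have hbh : b.IsHermitian := blockObs_isHermitian p (M.centred_isHermitian hQ)
  have hNtop : Tendsto (fun n : ℕ => n + 1 - k) atTop atTop :=
    (tendsto_sub_atTop_nat k).comp (tendsto_add_atTop_nat 1)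
  set ε : ℕ → ℝ := fun n => t / √((n + 1 - k : ℕ) : ℝ) with hε
  set r : ℕ → ℕ := fun n => (n + 1 - k) / p with hr
  set Z : ℕ → UnitAlg κ p := fun n => (Complex.I • (ε n • b)) with hZ
  have hZeq : ∀ n, Z n = (ε n : ℂ) • (Complex.I • b) := fun n => by
    rw [hZ, Complex.coe_smul, smul_comm]
  have hεlim : Tendsto ε atTop (𝓝 0) :=
    tendsto_const_nhds.div_atTop (Real.tendsto_sqrt_atTop.comp
      (tendsto_natCast_atTop_atTop.comp hNtop))
  have hrlim : Tendsto (fun n => (r n : ℝ) * ε n ^ 2) atTop (𝓝 (t ^ 2 / p)) :=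
    (tendsto_natDiv_mul_div p t).comp hNtop
  have hM : ∀ n, ‖M.transfer p (NormedSpace.exp (Z n))‖ ≤ 1 := fun n =>
    (M.norm_transfer_le p _).trans (norm_le_one_of_mem_unitary
      (exp_mem_unitary_of_mem_skewAdjoint (Matrix.IsHermitian.I_smul_mem_skewAdjoint
        (IsSelfAdjoint.smul (IsSelfAdjoint.all _) hbh))))
  have hMo : Tendsto (fun n => (r n : ℝ) * ‖M.transfer p (NormedSpace.exp (Z n)) - M.heis ^ p -
      (ε n : ℂ) • (Complex.I • M.transfer p b) -
      ((ε n : ℂ) ^ 2) • ((-(1 / 2) : ℂ) • M.transfer p (b ^ 2))‖) atTop (𝓝 0) := by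
    have hZ0 : Tendsto Z atTop (𝓝 0) := by
      have h : Tendsto (fun n => Complex.I • (ε n • b)) atTop (𝓝 (Complex.I • ((0 : ℝ) • b))) :=
        (hεlim.smul_const b).const_smul Complex.I
      simpa using h
    obtain ⟨c, hc⟩ := ((isBigO_exp_sub_taylor (A := UnitAlg κ p)).comp_tendsto hZ0).bound
    have hlim : Tendsto (fun n => ((r n : ℝ) * ε n ^ 2) * (|ε n| * (c * ‖b‖ ^ 3))) atTop (𝓝 0) := by
      have := hrlim.mul (hεlim.abs.mul_const (c * ‖b‖ ^ 3))
      simpa using this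
    refine squeeze_zero' (Eventually.of_forall fun _ => by positivity) ?_ hlim
    filter_upwards [hc] with n hn
    have h1 : M.transfer p (NormedSpace.exp (Z n)) - M.heis ^ p -
        (ε n : ℂ) • (Complex.I • M.transfer p b) -
        ((ε n : ℂ) ^ 2) • ((-(1 / 2) : ℂ) • M.transfer p (b ^ 2)) =
        M.transfer p (NormedSpace.exp (Z n) - 1 - Z n - (1 / 2 : ℝ) • Z n ^ 2) := by
      have h2 : (1 / 2 : ℝ) • Z n ^ 2 = ((ε n : ℂ) ^ 2 * (-(1 / 2))) • b ^ 2 := by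
        rw [hZeq, smul_pow, smul_pow, Complex.I_sq, ← Complex.coe_smul, smul_smul, smul_smul]
        congr 1
        push_cast
        ring
      have h4 : M.transfer p (Z n) = (ε n : ℂ) • (Complex.I • M.transfer p b) := by
        rw [hZeq, map_smul, map_smul]
      rw [h2, map_sub, map_sub, map_sub, h4, M.transfer_one, map_smul, mul_smul]
    rw [h1]
    have h3 : ‖Z n‖ = |ε n| * ‖b‖ := by
      rw [hZeq, norm_smul, norm_smul, Complex.norm_real, Complex.norm_I, one_mul, Real.norm_eq_abs]
    simp only [Function.comp_apply, h3, norm_pow, norm_mul, Real.norm_eq_abs,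
      abs_norm, abs_abs] at hn
    calc _ ≤ (r n : ℝ) * (c * (|ε n| * ‖b‖) ^ 3) := by
          gcongr
          exact (M.norm_transfer_le p _).trans hn
      _ = _ := by rw [← sq_abs (ε n)]; ring
  have hmain := tendsto_pow_apply_of_perturbation (S := M.heis ^ p)
    (M := fun n => M.transfer p (NormedSpace.exp (Z n))) (M.heis_pow_one p) hM hεlim hrlim hMo hv hw
  have hcont : Continuous ρ.expect := LinearMap.continuous_of_finiteDimensional _
  have h2 := (hcont.tendsto _).comp hmain
  rw [map_smul, ρ.expect_one, smul_eq_mul, mul_one] at h2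
  refine h2.congr' ?_
  filter_upwards [eventually_ge_atTop k] with n hn
  have hrp : r n * p ≤ n := (Nat.div_mul_le_self _ _).trans (by omega)
  have e1 : ∀ A : UnitAlg κ n, Complex.I • (ε n • A) = ((ε n : ℂ) * Complex.I) • A := fun A => by
    rw [mul_smul, Complex.coe_smul, smul_comm]
  have e2 : Z n = ((ε n : ℂ) * Complex.I) • b := by rw [hZeq, mul_smul]
  rw [M.expect_output, e1, M.transfer_exp_blockSum p (r n) (n - r n * p) n (by omega) hkp,
    mul_apply_eq_comp, M.heis_pow_one, ← hb, ← e2]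
  rfl

/-- The second order perturbation of the eigenvalue `1` of the transfer operator of a block is,
up to a bounded error, `-1/2` times the variance of the sum over the block. -/
theorem exists_block_eigenvalue (M : IrreducibleQMC d κ) {Q : UnitAlg κ k} (hQ : Q.IsHermitian)
    {C : ℝ} (hC0 : 0 ≤ C) : ∃ D : ℝ, ∀ p : ℕ, k ≤ p →
    (∀ x, M.statFun x = 0 → ∃ y, M.statFun y = 0 ∧ y - (M.heis ^ p) y = x ∧ ‖y‖ ≤ C * ‖x‖) →
    ∃ (v w : Matrix (Fin d) (Fin d) ℂ) (l : ℂ),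
      v - (M.heis ^ p) v = (Complex.I • M.transfer p (blockObs p (M.centred Q))) 1 ∧
      w - (M.heis ^ p) w = (Complex.I • M.transfer p (blockObs p (M.centred Q))) v +
        ((-(1 / 2) : ℂ) • M.transfer p (blockObs p (M.centred Q) ^ 2)) 1 - l • 1 ∧
      ‖l + ((∑ j ∈ Finset.range (p + 1 - k), M.variancePartialSum Q j : ℝ) : ℂ) / 2‖ ≤ D := by
  set q := M.centred Q with hq
  have hE := M.isErgodic_heis
  obtain ⟨C₁, hC₁0, hC₁⟩ := hE.exists_sub_map_eq
  set G := M.transfer k q 1 with hG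
  have hG0 : M.statFun G = 0 := M.statFun_transfer_centred hQ
  have hsum : ∀ x, M.statFun x = 0 → ∀ m, ‖∑ i ∈ Finset.range m, (M.heis ^ i) x‖ ≤
      2 * C₁ * ‖x‖ := fun x hx m => by
    obtain ⟨y, -, hy, hyC⟩ := hC₁ x hx
    simpa only [one_mul] using hE.norm_sum_pow_le (p := 1) (by rwa [pow_one]) hyC m
  refine ⟨‖M.statFun‖ * (‖q‖ * (2 * C₁ * (C * (2 * C₁ * ‖G‖)))), fun p hkp hC => ?_⟩
  set b := blockObs p q with hb
  have htr : ∀ X, M.transfer p b X = ∑ i ∈ Finset.range (p + 1 - k),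
      (M.heis ^ i) (M.transfer k q ((M.heis ^ (p - (i + k))) X)) := fun X => by
    rw [hb, blockObs, map_sum, sum_apply]
    refine Finset.sum_congr rfl fun i hi => ?_
    have := Finset.mem_range.1 hi
    rw [M.transfer_localObs (by omega), mul_apply_eq_comp, mul_apply_eq_comp]
  have hb1 : M.transfer p b 1 = ∑ i ∈ Finset.range (p + 1 - k), (M.heis ^ i) G := by
    rw [htr]
    refine Finset.sum_congr rfl fun i _ => ?_
    rw [M.heis_pow_one]
  have hb0 : M.statFun (M.transfer p b 1) = 0 := by
    rw [hb1, map_sum]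
    exact Finset.sum_eq_zero fun i _ => by rw [hE.state_pow, hG0]
  obtain ⟨v, hv0, hv, hvC⟩ := hC ((Complex.I • M.transfer p b) 1) (by
    rw [smul_apply, map_smul, hb0, smul_zero])
  -- Solvability condition: this l puts the right-hand side of the second equation in ker φ.
  set l : ℂ := M.statFun ((Complex.I • M.transfer p b) v +
    ((-(1 / 2) : ℂ) • M.transfer p (b ^ 2)) 1) with hl
  obtain ⟨w, -, hw, -⟩ := hC ((Complex.I • M.transfer p b) v +
    ((-(1 / 2) : ℂ) • M.transfer p (b ^ 2)) 1 - l • 1) (by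
    rw [map_sub, map_smul, hE.state_unit, smul_eq_mul, mul_one, sub_self])
  refine ⟨v, w, l, hv, hw, ?_⟩
  have hvar : M.statFun (M.transfer p (b ^ 2) 1) =
      ((∑ j ∈ Finset.range (p + 1 - k), M.variancePartialSum Q j : ℝ) : ℂ) := by
    obtain ⟨L, hL⟩ := (M.stationaryOutput p).exists_gns
    rw [← M.norm_sq_sum_localObs hQ hL (p + 1 - k) (by omega), ← map_sum,
      DensityMatrix.norm_sq_gns hL, M.expect_stationaryOutput]
    change _ = M.statFun (M.transfer p (bᴴ * b) 1)
    rw [(blockObs_isHermitian p (M.centred_isHermitian hQ)).eq, sq]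
  have hlv : l + ((∑ j ∈ Finset.range (p + 1 - k), M.variancePartialSum Q j : ℝ) : ℂ) / 2 =
      Complex.I * M.statFun (M.transfer p b v) := by
    rw [hl, map_add, smul_apply, smul_apply, map_smul, map_smul, hvar, smul_eq_mul, smul_eq_mul]
    ring
  -- Invariance of the state removes the powers of T in front, leaving a sum of T^i v. Since φ v =
  -- 0, that sum is bounded independently of p.
  have hbv : M.statFun (M.transfer p b v) =
      M.statFun (M.transfer k q (∑ i ∈ Finset.range (p + 1 - k), (M.heis ^ i) v)) := by
    rw [htr, map_sum, map_sum, map_sum, ← Finset.sum_range_reflect]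
    refine Finset.sum_congr rfl fun i hi => ?_
    have := Finset.mem_range.1 hi
    rw [hE.state_pow, show p - (p + 1 - k - 1 - i + k) = i by omega]
  rw [hlv, norm_mul, Complex.norm_I, one_mul, hbv]
  calc _ ≤ ‖M.statFun‖ * (‖q‖ * ‖∑ i ∈ Finset.range (p + 1 - k), (M.heis ^ i) v‖) :=
        (M.statFun.le_opNorm _).trans (by
          gcongr
          exact ContinuousLinearMap.le_of_opNorm_le _ (M.norm_transfer_le k q) _)
    _ ≤ ‖M.statFun‖ * (‖q‖ * (2 * C₁ * ‖v‖)) := by gcongr; exact hsum v hv0 _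
    _ ≤ ‖M.statFun‖ * (‖q‖ * (2 * C₁ * (C * (2 * C₁ * ‖G‖)))) := by
        gcongr
        refine hvC.trans ?_
        rw [smul_apply, norm_smul, Complex.norm_I, one_mul, hb1]
        gcongr
        exact hsum G hG0 _

theorem centredAverage_eq (M : IrreducibleQMC d κ) (Q : UnitAlg κ k) {n : ℕ} (hn : k ≤ n) (t : ℝ) :
    t • centredAverage n Q (M.mean Q) = (t / √((n + 1 - k : ℕ) : ℝ)) •
      ∑ l ∈ Finset.range (n + 1 - k), localObs n (M.centred Q) l := by
  have hN : (0 : ℝ) < ((n + 1 - k : ℕ) : ℝ) := by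
    have : 0 < n + 1 - k := by omega
    exact_mod_cast this
  rw [centredAverage, timeAverage_sub_smul_one n hn, smul_smul, smul_smul, centred]
  congr 1
  rw [mul_assoc, div_eq_mul_inv]
  congr 1
  have := Real.sqrt_pos.2 hN
  rw [mul_inv_eq_iff_eq_mul₀ hN.ne', eq_comm, inv_mul_eq_iff_eq_mul₀ this.ne',
    Real.mul_self_sqrt hN.le]

/-- The central limit theorem. -/
theorem tendsto_fluctuationLaw (M : IrreducibleQMC d κ) (hk : 0 < k) {Q : UnitAlg κ k}
    (hQ : Q.IsHermitian) (hσ : 0 ≤ M.asymptoticVariance Q) (ρ : DensityMatrix (Fin d)) :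
    Tendsto (M.fluctuationLaw ρ Q hQ) atTop
      (𝓝 ⟨gaussianReal 0 (M.asymptoticVariance Q).toNNReal, inferInstance⟩) := by
  refine ProbabilityMeasure.tendsto_iff_tendsto_charFun.2 fun t => ?_
  set σ := M.asymptoticVariance Q with hσdef
  set z₀ : ℂ := ((-(t ^ 2 * σ / 2) : ℝ) : ℂ) with hz₀
  have hlim : charFun (gaussianReal 0 σ.toNNReal) t = Complex.exp z₀ := by
    rw [charFun_gaussianReal, hz₀]
    congr 1
    rw [show ((σ.toNNReal : NNReal) : ℂ) = ((σ.toNNReal : ℝ) : ℂ) from rfl, Real.coe_toNNReal _ hσ]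
    push_cast
    ring
  change Tendsto _ _ (𝓝 (charFun (gaussianReal 0 σ.toNNReal) t))
  rw [hlim, Metric.tendsto_nhds]
  intro δ hδ
  obtain ⟨C, hC0, hC⟩ := M.isErgodic_heis.exists_resolvent_bound
  obtain ⟨D, hD⟩ := M.exists_block_eigenvalue hQ hC0
  set D' : ℝ := t ^ 2 * ((k + 1) * (4 * k * ‖M.centred Q‖ ^ 2)) +
      |t| * (k * √(3 * ((1 + k + 2 * C) * ‖M.centred Q‖ ^ 2)) + ‖M.centred Q‖) with hD'
  have hDlim : Tendsto (fun p : ℕ => D' / √p) atTop (𝓝 0) :=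
    tendsto_const_nhds.div_atTop (Real.tendsto_sqrt_atTop.comp tendsto_natCast_atTop_atTop)
  have hptop : Tendsto (fun p : ℕ => p + 1 - k) atTop atTop :=
    (tendsto_sub_atTop_nat k).comp (tendsto_add_atTop_nat 1)
  have hvlim : Tendsto (fun p : ℕ => (p : ℝ)⁻¹ *
      ∑ j ∈ Finset.range (p + 1 - k), M.variancePartialSum Q j) atTop (𝓝 σ) := by
    have h1 := (M.tendsto_varianceCesaroMean hk hQ).comp hptop
    have h2 : Tendsto (fun p : ℕ => ((p + 1 - k : ℕ) : ℝ) / p) atTop (𝓝 1) := by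
      have h3 : Tendsto (fun p : ℕ => 1 + (1 - k : ℝ) * (p : ℝ)⁻¹) atTop (𝓝 (1 + (1 - k : ℝ) * 0)) :=
        tendsto_const_nhds.add (tendsto_const_nhds.mul
          ((tendsto_inv_atTop_zero (𝕜 := ℝ)).comp tendsto_natCast_atTop_atTop))
      rw [mul_zero, add_zero] at h3
      refine h3.congr' ?_
      filter_upwards [eventually_ge_atTop (max k 1)] with p hp
      have hp0 : (0 : ℝ) < p := by
        have : 0 < p := by omega
        exact_mod_cast this
      rw [Nat.cast_sub (by omega)]
      push_cast
      field_simp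
      ring
    have h4 := h2.mul h1
    rw [one_mul] at h4
    refine h4.congr' ?_
    filter_upwards [eventually_ge_atTop k] with p hp
    have hN : (0 : ℝ) < ((p + 1 - k : ℕ) : ℝ) := by
      have : 0 < p + 1 - k := by omega
      exact_mod_cast this
    simp only [Function.comp_apply, varianceCesaroMean]
    rw [← mul_assoc, div_mul_eq_mul_div, mul_inv_cancel₀ hN.ne', one_div]
  -- This dominates the distance of t² l / p from -t² σ/2: the bounded eigenvalue error divided by
  -- p, plus the deviation of the normalised block variance from σ.
  have hηlim : Tendsto (fun p : ℕ => t ^ 2 * (D * (p : ℝ)⁻¹ + |(p : ℝ)⁻¹ *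
      (∑ j ∈ Finset.range (p + 1 - k), M.variancePartialSum Q j) - σ| / 2)) atTop (𝓝 0) := by
    have h1 := ((tendsto_inv_atTop_zero (𝕜 := ℝ)).comp tendsto_natCast_atTop_atTop).const_mul D
    have h2 := (hvlim.sub_const σ).abs.div_const 2
    have h3 := (h1.add h2).const_mul (t ^ 2)
    simpa using h3
  obtain ⟨η, hη, hηexp⟩ := Metric.continuousAt_iff.1 (Complex.continuous_exp.continuousAt (x := z₀))
    (δ / 3) (by positivity)
  obtain ⟨p₀, hp₀⟩ := eventually_atTop.1 ((hDlim.eventually_lt_const (by positivity : 0 < δ / 3)).and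
    ((hηlim.eventually_lt_const hη).and (eventually_ge_atTop k)))
  -- The block length is fixed before n tends to infinity, among the p with a uniform resolvent
  -- bound; C and D were chosen independently of p.
  obtain ⟨p, hp, hCp⟩ := hC p₀
  obtain ⟨hp1, hp2, hkp⟩ := hp₀ p hp
  obtain ⟨v, w, l, hv, hw, hl⟩ := hD p hkp hCp
  have hp0 : (0 : ℝ) < p := by
    have : 0 < p := by omega
    exact_mod_cast this
  have hz : dist (((t ^ 2 / p : ℝ) : ℂ) * l) z₀ < η := by
    refine lt_of_le_of_lt ?_ hp2
    set V : ℝ := ∑ j ∈ Finset.range (p + 1 - k), M.variancePartialSum Q j with hV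
    have e1 : ((t ^ 2 / p : ℝ) : ℂ) * l - z₀ = ((t ^ 2 / p : ℝ) : ℂ) * (l + (V : ℂ) / 2) -
        ((t ^ 2 * (((p : ℝ)⁻¹ * V - σ) / 2) : ℝ) : ℂ) := by
      rw [hz₀]
      push_cast
      ring
    rw [dist_eq_norm, e1]
    refine (norm_sub_le _ _).trans ?_
    rw [norm_mul, Complex.norm_real, Complex.norm_real, Real.norm_eq_abs, Real.norm_eq_abs,
      abs_of_nonneg (by positivity : 0 ≤ t ^ 2 / (p : ℝ)), abs_mul, abs_of_nonneg (sq_nonneg t),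
      abs_div, abs_two]
    calc _ ≤ t ^ 2 / p * D + t ^ 2 * (|(p : ℝ)⁻¹ * V - σ| / 2) := by gcongr
      _ = _ := by ring
  have hblock := Metric.tendsto_nhds.1
    (M.tendsto_expect_exp_blockSum hk hQ hkp hv hw ρ t) (δ / 3) (by positivity)
  filter_upwards [hblock, eventually_ge_atTop k,
    ((tendsto_sub_atTop_nat k).comp (tendsto_add_atTop_nat 1)).eventually_ge_atTop (p ^ 3)]
    with n hn1 hn2 hn3
  have hcmp := M.norm_expect_exp_sub_blockSum_le hk hQ hkp hC0 hCp ρ t (n := n)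
    (N := n + 1 - k) (by omega) hn3
  rw [← M.centredAverage_eq Q hn2] at hcmp
  rw [fluctuationLaw, charFun_observableLaw]
  rw [← dist_eq_norm] at hcmp
  calc _ ≤ _ := dist_triangle4 _ _ _ _
    _ < δ / 3 + δ / 3 + δ / 3 := add_lt_add (add_lt_add (hcmp.trans_lt hp1) hn1) (hηexp hz)
    _ = δ := by ring

end IrreducibleQMC

/-! ### Notions of output equivalence -/

theorem DensityMatrix.ext_expect {ι : Type} [Fintype ι] [DecidableEq ι] {ρ σ : DensityMatrix ι}
    (h : ∀ A, ρ.expect A = σ.expect A) : ρ = σ :=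
  DensityMatrix.ext (Matrix.ext_iff_trace_mul_right.2 h)

/-- The difference D of the states is itself Hermitian; testing against it gives tr(D*D) = 0. -/
theorem DensityMatrix.ext_expect_re {ι : Type} [Fintype ι] [DecidableEq ι] {ρ σ : DensityMatrix ι}
    (h : ∀ A : Matrix ι ι ℂ, A.IsHermitian → (ρ.expect A).re = (σ.expect A).re) : ρ = σ := by
  have hD : (ρ.mat - σ.mat).IsHermitian := ρ.posSemidef.isHermitian.sub σ.posSemidef.isHermitian
  have hnn : 0 ≤ ((ρ.mat - σ.mat)ᴴ * (ρ.mat - σ.mat)).trace :=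
    (Matrix.posSemidef_conjTranspose_mul_self _).trace_nonneg
  have h0 : ((ρ.mat - σ.mat)ᴴ * (ρ.mat - σ.mat)).trace = 0 := by
    refine Complex.ext ?_ (Complex.le_def.1 hnn).2.symm
    rw [hD.eq, sub_mul, Matrix.trace_sub, Complex.sub_re]
    exact sub_eq_zero.2 (h _ hD)
  exact DensityMatrix.ext (sub_eq_zero.1 (Matrix.trace_conjTranspose_mul_self_eq_zero_iff.1 h0))

namespace IrreducibleQMC

variable {d d₁ d₂ κ k : ℕ}

/-- The output units forget the initial state in the sense of Cesàro. -/
theorem exists_norm_sum_expect_sub_le (M : IrreducibleQMC d κ) (ρ : DensityMatrix (Fin d)) {n : ℕ}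
    (A : UnitAlg κ n) : ∃ K : ℝ, ∀ N : ℕ,
      ‖∑ a ∈ Finset.range N, (M.output (a + n) ρ).expect (tens 1 A) -
        N * (M.stationaryOutput n).expect A‖ ≤ K := by
  have hE := M.isErgodic_heis
  obtain ⟨C, -, hC⟩ := hE.exists_sub_map_eq
  set m := (M.stationaryOutput n).expect A with hm
  set x := M.transfer n A 1 - m • 1 with hx
  have hx0 : M.statFun x = 0 := by
    rw [hx, map_sub, map_smul, hE.state_unit, hm, M.expect_stationaryOutput, smul_eq_mul, mul_one,
      sub_self]
  obtain ⟨y, -, hy, hyC⟩ := hC x hx0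
  refine ⟨2 * C * ‖x‖, fun N => ?_⟩
  have h := hE.norm_sum_pow_le (p := 1) (by rwa [pow_one]) hyC N
  refine le_trans (le_of_eq ?_) ((ρ.norm_expect_le _).trans h)
  congr 1
  have h1 : ∀ a, (M.output (a + n) ρ).expect (tens 1 A) = ρ.expect ((M.heis ^ (1 * a)) x) + m :=
    fun a => by
      rw [M.expect_output, M.transfer_tens, M.transfer_one, mul_apply_eq_comp, one_mul, hx, map_sub,
        map_sub, map_smul, M.heis_pow_one, map_smul, ρ.expect_one, smul_eq_mul, mul_one,
        sub_add_cancel]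
  simp only [h1, Finset.sum_add_distrib, map_sum, Finset.sum_const, Finset.card_range, nsmul_eq_mul,
    add_sub_cancel_right]

/-- The same sums of shifted expectations stay within bounded distance of N m₁ and of N m₂, so N |m₁
- m₂| is bounded in N and m₁ = m₂. -/
theorem WeakOutputEquiv.stationaryOutputEquiv {M₁ : IrreducibleQMC d₁ κ} {M₂ : IrreducibleQMC d₂ κ}
    (h : M₁.WeakOutputEquiv M₂) : M₁.StationaryOutputEquiv M₂ := by
  obtain ⟨ρ₁, ρ₂, h⟩ := h
  refine fun n => DensityMatrix.ext_expect fun A => ?_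
  obtain ⟨K₁, h₁⟩ := M₁.exists_norm_sum_expect_sub_le ρ₁ A
  obtain ⟨K₂, h₂⟩ := M₂.exists_norm_sum_expect_sub_le ρ₂ A
  simp only [h] at h₁
  by_contra hne
  have hpos := norm_pos_iff.2 (sub_ne_zero.2 hne)
  obtain ⟨N, hN⟩ := exists_nat_gt
    ((K₁ + K₂) / ‖(M₁.stationaryOutput n).expect A - (M₂.stationaryOutput n).expect A‖)
  rw [div_lt_iff₀ hpos] at hN
  have h3 := (norm_sub_le _ _).trans (add_le_add (h₂ N) (h₁ N))
  rw [sub_sub_sub_cancel_left, ← mul_sub, norm_mul, Complex.norm_natCast] at h3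
  linarith

theorem StationaryOutputEquiv.sameMeanAndVariance {M₁ : IrreducibleQMC d₁ κ}
    {M₂ : IrreducibleQMC d₂ κ} (h : M₁.StationaryOutputEquiv M₂) : M₁.SameMeanAndVariance M₂ := by
  intro k _ Q _
  have hm : M₁.mean Q = M₂.mean Q := by rw [mean, mean, h k]
  have hc : M₁.correlation Q = M₂.correlation Q := by
    funext a
    rw [correlation, correlation, h (a + k), hm]
  refine ⟨hm, ?_⟩
  have hv : M₁.varianceCesaroMean Q = M₂.varianceCesaroMean Q := by
    funext N
    simp only [varianceCesaroMean, variancePartialSum, hc]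
  rw [asymptoticVariance, asymptoticVariance, hv]

/-- The means alone suffice. The case of zero units is not covered by observables with k > 0, but
there the algebra is one-dimensional. -/
theorem SameMeanAndVariance.stationaryOutputEquiv {M₁ : IrreducibleQMC d₁ κ}
    {M₂ : IrreducibleQMC d₂ κ} (h : M₁.SameMeanAndVariance M₂) : M₁.StationaryOutputEquiv M₂ := by
  intro n
  rcases Nat.eq_zero_or_pos n with rfl | hn
  · refine DensityMatrix.ext_expect fun A => ?_
    have hA : A = A.trace • (1 : UnitAlg κ 0) := by
      ext i j
      obtain rfl := Subsingleton.elim i default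
      obtain rfl := Subsingleton.elim j default
      simp [Matrix.trace]
    rw [hA, map_smul, map_smul, DensityMatrix.expect_one, DensityMatrix.expect_one]
  · exact DensityMatrix.ext_expect_re fun A hA => (h n hn A hA).1

theorem asymptoticVariance_nonneg (M : IrreducibleQMC d κ) (hk : 0 < k) {Q : UnitAlg κ k}
    (hQ : Q.IsHermitian) : 0 ≤ M.asymptoticVariance Q :=
  ge_of_tendsto' (M.tendsto_varianceCesaroMean hk hQ) (M.varianceCesaroMean_nonneg hQ)

theorem SameMeanAndVariance.macroscopicOutputEquiv {M₁ : IrreducibleQMC d₁ κ}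
    {M₂ : IrreducibleQMC d₂ κ} (h : M₁.SameMeanAndVariance M₂) : M₁.MacroscopicOutputEquiv M₂ := by
  intro k hk Q hQ ρ₁ ρ₂
  obtain ⟨hm, hv⟩ := h k hk Q hQ
  have hL := M₂.tendsto_averageLaw hQ ρ₂
  have hF := M₂.tendsto_fluctuationLaw hk hQ (M₂.asymptoticVariance_nonneg hk hQ) ρ₂
  simp only [← hm] at hL
  simp only [← hv] at hF
  exact ⟨⟨_, M₁.tendsto_averageLaw hQ ρ₁, hL⟩,
    ⟨_, M₁.tendsto_fluctuationLaw hk hQ (M₁.asymptoticVariance_nonneg hk hQ) ρ₁, hF⟩⟩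

/-- One pair of initial states is enough, here the stationary ones. Limits are unique, a point mass
determines its point, and a centred Gaussian determines its variance, where nonnegativity makes
`Real.toNNReal` injective. -/
theorem MacroscopicOutputEquiv.sameMeanAndVariance {M₁ : IrreducibleQMC d₁ κ}
    {M₂ : IrreducibleQMC d₂ κ} (h : M₁.MacroscopicOutputEquiv M₂) : M₁.SameMeanAndVariance M₂ := by
  intro k hk Q hQ
  obtain ⟨⟨μ, hμ₁, hμ₂⟩, ⟨ν, hν₁, hν₂⟩⟩ := h k hk Q hQ M₁.stationaryState M₂.stationaryState
  have hσ₁ := M₁.asymptoticVariance_nonneg hk hQ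
  have hσ₂ := M₂.asymptoticVariance_nonneg hk hQ
  constructor
  · have e₁ := tendsto_nhds_unique hμ₁ (M₁.tendsto_averageLaw hQ _)
    have e₂ := tendsto_nhds_unique hμ₂ (M₂.tendsto_averageLaw hQ _)
    exact dirac_eq_dirac_iff.1 (congrArg Subtype.val (e₁.symm.trans e₂))
  · have e₁ := tendsto_nhds_unique hν₁ (M₁.tendsto_fluctuationLaw hk hQ hσ₁ _)
    have e₂ := tendsto_nhds_unique hν₂ (M₂.tendsto_fluctuationLaw hk hQ hσ₂ _)
    exact (Real.toNNReal_eq_toNNReal_iff hσ₁ hσ₂).1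
      (gaussianReal_ext_iff.1 (congrArg Subtype.val (e₁.symm.trans e₂))).2

end IrreducibleQMC

theorem proposition3p5 (κ : ℕ) :
    -- limit theorems, for every irreducible chain, initial state and local observable
    (∀ (d : ℕ) (M : IrreducibleQMC d κ) (k : ℕ), 0 < k →
      ∀ (Q : Matrix (Fin k → Fin κ) (Fin k → Fin κ) ℂ) (hQ : Q.IsHermitian),
      -- the asymptotic variance is well defined
      Tendsto (M.varianceCesaroMean Q) atTop (𝓝 (M.asymptoticVariance Q)) ∧
      0 ≤ M.asymptoticVariance Q ∧
      (∀ s : ℝ, Tendsto (M.variancePartialSum Q) atTop (𝓝 s) → M.asymptoticVariance Q = s) ∧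
      (M.IsPrimitive → Summable (M.correlation Q)) ∧
      ∀ ρ : DensityMatrix (Fin d),
        -- law of large numbers
        Tendsto (M.averageLaw ρ Q hQ) atTop
          (𝓝 ⟨Measure.dirac (M.mean Q), inferInstance⟩) ∧
        -- central limit theorem
        Tendsto (M.fluctuationLaw ρ Q hQ) atTop
          (𝓝 ⟨gaussianReal 0 (M.asymptoticVariance Q).toNNReal, inferInstance⟩)) ∧
    -- equivalence of the notions of output equivalence
    (∀ (d₁ d₂ : ℕ) (M₁ : IrreducibleQMC d₁ κ) (M₂ : IrreducibleQMC d₂ κ),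
      List.TFAE [
        M₁.StationaryOutputEquiv M₂,
        M₁.WeakOutputEquiv M₂,
        M₁.MacroscopicOutputEquiv M₂,
        M₁.SameMeanAndVariance M₂]) := by

  refine ⟨fun d M k hk Q hQ => ?_, fun d₁ d₂ M₁ M₂ => ?_⟩
  · have hlim := M.tendsto_varianceCesaroMean hk hQ
    have hσ := M.asymptoticVariance_nonneg hk hQ
    exact ⟨hlim, hσ, fun s hs => tendsto_nhds_unique hlim hs.cesaro,
      fun hM => M.summable_correlation hM hQ,
      fun ρ => ⟨M.tendsto_averageLaw hQ ρ, M.tendsto_fluctuationLaw hk hQ hσ ρ⟩⟩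
  · tfae_have 1 → 2 := fun h => ⟨M₁.stationaryState, M₂.stationaryState, h⟩
    tfae_have 2 → 1 := fun h => h.stationaryOutputEquiv
    tfae_have 1 → 4 := fun h => h.sameMeanAndVariance
    tfae_have 4 → 1 := fun h => h.stationaryOutputEquiv
    tfae_have 4 → 3 := fun h => h.macroscopicOutputEquiv
    tfae_have 3 → 4 := fun h => h.sameMeanAndVariance
    tfae_finish
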